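/- Let $p$ be a prime, $F$ a finite extension of $\mathbb Q_p$, $G=\mathrm{PGL}_2(F)$, $B$ the subgroup of (classes of) upper triangular matrices, $N_0$ the subgroup of unipotent upper triangular matrices with entry in $\mathcal O_F$, $T\cong F^*$ the diagonal torus (via $\delta(x)=\mathrm{diag}(x,1)$), $T^0\cong\mathcal O_F^*$, $T^+\cong \mathcal O_F\setminus\{0\}$. Let $H\le T^0$ be a closed subgroup, $\overline T=T/H$, and let $\mathcal O$ be a complete noetherian local ring. A representation over $\mathcal O$ is smooth if all stabilizers of vectors are open, admissible if moreover its invariants under each open subgroup are finitely generated over $\mathcal O$, and locally admissible if it is the union of its admissible subrepresentations; $\mathrm{Mod}^{sm}_{\mathcal O}$ and $\mathrm{Mod}^{ladm}_{\mathcal O}$ denote the corresponding categories. Let $\mathscr K$ be a set of open subgroups of $G$ that is cofinal among the open subgroups, stable under conjugation and under passage to open subgroups, and let $\mathscr S$ be the category of $G$-sets all of whose stabilizers lie in $\mathscr K$. An $\mathscr S$-space is a functor $S\mapsto X_S$ from $\mathscr S$ to the category of topological spaces and local homeomorphisms which maps jointly surjective families to jointly surjective families and commutes with fibre products and coproducts;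 it is exact if it also commutes with equalizers. Write $X_K=X_{G/K}$ for $K\in\mathscr K$. Let $\mathrm{Sh}(X,\mathcal O)$ be the category of sheaves of $\mathcal O$-modules on the site of pairs $(U,\alpha)$ with $U$ a topological space and $\alpha\in\varinjlim_S\mathrm{Hom}(U,X_S)$ (local homeomorphisms compatible with the $\alpha$'s, jointly surjective coverings). For $\mathscr F\in\mathrm{Sh}(X,\mathcal O)$ put $H^0(X_\infty,\mathscr F)=\varinjlim_{K\in\mathscr K}\mathscr F(X_K)\in\mathrm{Mod}^{sm}_{\mathcal O}(G)$, and let $H^n(X_\infty,\cdot)$ be the right derived functors. For $V\in\mathrm{Mod}^{sm}_{\mathcal O}(G)$ the monoid $T^+$ acts on $V^{N_0}$ by $v\mapsto\sum_{n\in N_0/tN_0t^{-1}}n\,t\,v$; let $\mathrm{Ord}(V)\in \mathrm{Mod}^{ladm}_{\mathcal O}(T)$ be the submodule of those $\psi\in\mathrm{Hom}_{\mathcal O[T^+]}(\mathcal O[T],V^{N_0})$ for which the translates of $\psi$ under $\delta(\pi)^{\mathbb Z}$ ($\pi$ a uniformizer of $F$) span a finitely generated $\mathcal O$-module. Put $\mathrm{Ord}^H(V)=\mathrm{Ord}(V)^H\in\mathrm{Mod}^{ladm}_{\mathcal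 O}(\overline T)$ and let $\mathrm{Ord}^{H,n}$ be the right derived functors of $\mathrm{Ord}^H$. Let $\mathfrak{Ord}^{H,n}(X,\cdot)$ be the right derived functors of $\mathfrak{Ord}^H(X,\cdot):\mathrm{Sh}(X,\mathcal O)\to\mathrm{Mod}^{ladm}_{\mathcal O}(\overline T)$, $\mathscr F\mapsto\mathrm{Ord}^H(H^0(X_\infty,\mathscr F))$. Let $\Lambda=\varprojlim_{U}\mathcal O[\overline T/U]$, $U$ running over the compact open subgroups of $\overline T$. For $W\in\mathrm{Mod}^{ladm}_{\mathcal O}(\overline T)$ let $W^\iota$ be $W$ with $t\in\overline T$ acting as $t^{-1}$, let $\mathrm{Ext}^r_{\mathcal O,\overline T}(W^\iota,\cdot)$ be the Ext groups in $\mathrm{Mod}^{sm}_{\mathcal O}(\overline T)$, let $\mathrm{Ind}_B^GW$ be the module of functions $\Phi:G\to W$ for which there is an open subgroup $U\le G$ with $\Phi(tngk)=t\,\Phi(g)$ for all $t\in T$, all unipotent upper triangular $n$, all $g\in G$ and all $k\in U$ (with $G$ acting by right translation), and let $\mathbb H^n(X;W,\cdot)$ be the right derived functors of $\mathscr F\mapsto\mathrm{Hom}_{\mathcal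 O[G]}(\mathrm{Ind}_B^GW,H^0(X_\infty,\mathscr F))$. The action of $\Lambda$ on $W$ makes these Ext groups and $\mathbb H^n(X;W,\mathscr F)$ into $\Lambda$-modules. **Proposition.** Let $X$ be an $\mathscr S$-space, $\mathscr F\in\mathrm{Sh}(X,\mathcal O)$ and $W\in\mathrm{Mod}^{ladm}_{\mathcal O}(\overline T)$. (a) For all $n\ge0$ the natural maps induce an isomorphism in $\mathrm{Mod}^{ladm}_{\mathcal O}(\overline T)$ $$\varinjlim_{U\text{ open},\ H\le U\le T^0}\mathfrak{Ord}^{U,n}(X,\mathscr F)\ \cong\ \mathfrak{Ord}^{H,n}(X,\mathscr F).$$ (b) If $X$ is exact, there are convergent first quadrant spectral sequences, the first in $\mathrm{Mod}^{ladm}_{\mathcal O}(\overline T)$ and the second in the category of $\Lambda$-modules: $$E_2^{rs}=\mathrm{Ord}^{H,r}(H^s(X_\infty,\mathscr F))\Longrightarrow\mathfrak{Ord}^{H,r+s}(X,\mathscr F),$$ $$E_2^{rs}=\mathrm{Ext}^r_{\mathcal O,\overline T}(W^\iota,\mathfrak{Ord}^{H,s}(X,\mathscr F))\Longrightarrow\mathbb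 H^{r+s}(X;W,\mathscr F).$$ -/

import Mathlib

open CategoryTheory CategoryTheory.Limits

universe u v w

set_option linter.unusedSectionVars false
set_option linter.unusedVariables false

namespace OrdCoh

/-! ### Categories of representations cut out by a condition on vectors -/

/-- A condition on vectors of representations: for every representation `V` a subrepresentation
`part V`, functorial in `V` and hereditary. -/
structure VectorCondition (k : Type v) (G : Type u) [CommRing k] [Group G] where
  part : ∀ V : Rep.{w} k G, Submodule k V
  act_mem : ∀ (V : Rep.{w} k G) (g : G), part V ≤ (part V).comap (V.ρ g)
  map_mem : ∀ {V W : Rep.{w} k G} (f : V ⟶ W) (x : V), x ∈ part V → f.hom x ∈ part W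
  mem_of_map : ∀ {V W : Rep.{w} k G} (f : V ⟶ W), Function.Injective f.hom →
    ∀ x : V, f.hom x ∈ part W → x ∈ part V

namespace VectorCondition

variable {k : Type v} {G : Type u} [CommRing k] [Group G] (L : VectorCondition.{u, v, w} k G)
  (P : ObjectProperty (Rep.{w} k G))

theorem subobjects (hP : ∀ V, P V ↔ ∀ x : V, x ∈ L.part V) : P.IsClosedUnderSubobjects where
  prop_of_mono {V W} f hf hW := by
    rw [hP] at hW ⊢
    exact fun x => L.mem_of_map f ((Rep.mono_iff_injective f).1 hf) x (hW _)

theorem quotients (hP : ∀ V, P V ↔ ∀ x : V, x ∈ L.part V) : P.IsClosedUnderQuotients where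
  prop_of_epi {V W} f hf hV := by
    rw [hP] at hV ⊢
    intro y
    obtain ⟨x, rfl⟩ := (Rep.epi_iff_surjective f).1 hf y
    exact L.map_mem f x (hV x)

theorem zero (hP : ∀ V, P V ↔ ∀ x : V, x ∈ L.part V) : P.ContainsZero where
  exists_zero := by
    obtain ⟨Z, hZ⟩ := (inferInstance : HasZeroObject (Rep.{w} k G)).zero
    refine ⟨Z, hZ, ?_⟩
    rw [hP]
    intro x
    have h : (𝟙 Z) = 0 := hZ.eq_of_src _ _
    have : x = 0 := by
      have := congr(($h).hom x)
      simpa using this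
    rw [this]
    exact zero_mem _

theorem finiteProducts (hP : ∀ V, P V ↔ ∀ x : V, x ∈ L.part V) : P.IsClosedUnderFiniteProducts := by
  have := L.subobjects P hP
  have := L.zero P hP
  have : P.IsClosedUnderIsomorphisms := inferInstance
  have : P.IsClosedUnderBinaryProducts := by
    refine ⟨?_⟩
    rintro X ⟨p⟩
    have e := p.isLimit.conePointsIsoOfNatIso (BinaryBiproduct.isLimit (p.diag.obj ⟨.left⟩)
      (p.diag.obj ⟨.right⟩)) (diagramIsoPair p.diag)
    refine P.prop_of_iso e.symm ?_
    have h1 := p.prop_diag_obj ⟨.left⟩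
    have h2 := p.prop_diag_obj ⟨.right⟩
    rw [hP] at h1 h2
    generalize p.diag.obj ⟨.left⟩ = A at *
    generalize p.diag.obj ⟨.right⟩ = B at *
    change P (A ⊞ B)
    rw [hP]
    intro x
    have h := congr(($(biprod.total (X := A) (Y := B))).hom x)
    have h' : x = (biprod.inl : A ⟶ A ⊞ B).hom (Rep.Hom.hom (biprod.fst : A ⊞ B ⟶ A) x) +
        (biprod.inr : B ⟶ A ⊞ B).hom (Rep.Hom.hom (biprod.snd : A ⊞ B ⟶ B) x) := h.symm
    rw [h']
    exact add_mem (L.map_mem _ _ (h1 _)) (L.map_mem _ _ (h2 _))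
  exact ObjectProperty.IsClosedUnderFiniteProducts.mk'

/-- The full subcategory of representations all of whose vectors satisfy the condition is
abelian. -/
noncomputable abbrev abelian (hP : ∀ V, P V ↔ ∀ x : V, x ∈ L.part V) : Abelian P.FullSubcategory :=
  have := L.subobjects P hP
  have := L.quotients P hP
  have := L.zero P hP
  have := L.finiteProducts P hP
  inferInstance

theorem part_part (V : Rep.{w} k G) (x : Rep.subrepresentation V (L.part V) (L.act_mem V)) :
    x ∈ L.part (Rep.subrepresentation V (L.part V) (L.act_mem V)) :=
  L.mem_of_map (Rep.subtype V (L.part V) (L.act_mem V)) Subtype.val_injective x x.2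

/-- The right adjoint of the inclusion: pass to the vectors satisfying the condition. -/
noncomputable def coreflector (hP : ∀ V, P V ↔ ∀ x : V, x ∈ L.part V) : Rep.{w} k G ⥤ P.FullSubcategory where
  obj V := ⟨Rep.subrepresentation V (L.part V) (L.act_mem V), (hP _).2 (L.part_part V)⟩
  map {V W} f := P.homMk (Rep.ofHom ⟨f.hom.toLinearMap.restrict fun x hx => L.map_mem f x hx, by
    intro g
    ext x
    simp [Rep.hom_comm_apply]⟩)
  map_id V := by
    ext : 2
    rfl
  map_comp f g := by
    ext : 2
    rfl

/-- The inclusion is left adjoint to `coreflector`. -/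
noncomputable def adjunction (hP : ∀ V, P V ↔ ∀ x : V, x ∈ L.part V) : P.ι ⊣ L.coreflector P hP :=
  Adjunction.mkOfHomEquiv
    { homEquiv := fun V W =>
        { toFun := fun f => P.homMk (Rep.ofHom ⟨f.hom.toLinearMap.codRestrict (L.part W)
            fun x => L.map_mem f x ((hP _).1 V.property x), by
              intro g
              ext x
              simp [Rep.hom_comm_apply]⟩)
          invFun := fun f => f.hom ≫ Rep.subtype W (L.part W) (L.act_mem W)
          left_inv := fun f => by
            ext : 1
            rfl
          right_inv := fun f => by
            ext : 2
            rfl }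
      homEquiv_naturality_left_symm := fun f g => by
        ext : 1
        rfl
      homEquiv_naturality_right := fun f g => by
        ext : 2
        rfl }

theorem enoughInjectives_rep : EnoughInjectives (Rep.{max u v w} k G) :=
  EnoughInjectives.of_equivalence Rep.equivalenceModuleMonoidAlgebra.functor

theorem enoughInjectives (hP : ∀ V, P V ↔ ∀ x : V, x ∈ L.part V)
    [EnoughInjectives (Rep.{w} k G)] :
    EnoughInjectives P.FullSubcategory := by
  have := L.subobjects P hP
  have := L.quotients P hP
  have := L.zero P hP
  have := L.finiteProducts P hP
  have := P.preservesMonomorphisms_ι_of_isNormalEpiCategory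
  exact EnoughInjectives.of_adjunction (L.adjunction P hP)

end VectorCondition

/-! ### Smooth and locally admissible representations -/

section Smooth

variable {k : Type v} {G : Type u} [CommRing k] [Group G]

/-- The vectors of `V` fixed by the subgroup `U`. -/
def fixedVectors (V : Rep.{w} k G) (U : Subgroup G) : Submodule k V where
  carrier := {x | ∀ g ∈ U, V.ρ g x = x}
  add_mem' ha hb g hg := by rw [map_add, ha g hg, hb g hg]
  zero_mem' g _ := map_zero _
  smul_mem' c x hx g hg := by rw [map_smul, hx g hg]

theorem mem_fixedVectors {V : Rep.{w} k G} {U : Subgroup G} {x : V} :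
    x ∈ fixedVectors V U ↔ ∀ g ∈ U, V.ρ g x = x := Iff.rfl

/-- The stabilizer of a vector. -/
def vectorStabilizer (V : Rep.{w} k G) (x : V) : Subgroup G where
  carrier := {g | V.ρ g x = x}
  mul_mem' {a b} (ha : V.ρ a x = x) (hb : V.ρ b x = x) := by
    change V.ρ (a * b) x = x
    rw [map_mul, Module.End.mul_apply, hb, ha]
  one_mem' := by change V.ρ 1 x = x; rw [map_one]; rfl
  inv_mem' {a} (ha : V.ρ a x = x) := by
    change V.ρ a⁻¹ x = x
    conv_lhs => rw [← ha]
    exact V.ρ.inv_self_apply a x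

theorem mem_vectorStabilizer {V : Rep.{w} k G} {x : V} {g : G} :
    g ∈ vectorStabilizer V x ↔ V.ρ g x = x := Iff.rfl

theorem vectorStabilizer_le_map {V W : Rep.{w} k G} (f : V ⟶ W) (x : V) :
    vectorStabilizer V x ≤ vectorStabilizer W (f.hom x) := by
  intro g hg
  rw [mem_vectorStabilizer] at hg ⊢
  rw [← Rep.hom_comm_apply, hg]

variable [TopologicalSpace G]

/-- A representation is smooth if the stabilizer of every vector is open. -/
def IsSmooth : ObjectProperty (Rep.{w} k G) := fun V =>
  ∀ x : V, IsOpen (vectorStabilizer V x : Set G)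

/-- A smooth representation is admissible if for every open subgroup `U` the module of `U`-fixed
vectors is finitely generated. -/
def IsAdmissible : ObjectProperty (Rep.{w} k G) := fun V =>
  IsSmooth V ∧ ∀ U : Subgroup G, IsOpen (U : Set G) → (fixedVectors V U).FG

/-- A representation is locally admissible if it is the union of its admissible
subrepresentations. -/
def IsLocallyAdmissible : ObjectProperty (Rep.{w} k G) := fun V =>
  ∀ x : V, ∃ (M : Submodule k V) (hM : ∀ g, M ≤ M.comap (V.ρ g)),
    x ∈ M ∧ IsAdmissible (Rep.subrepresentation V M hM)

variable (k G) in
/-- Smooth representations of `G` over `k`. -/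
abbrev SmRep := (IsSmooth : ObjectProperty (Rep.{w} k G)).FullSubcategory

variable (k G) in
/-- Locally admissible representations of `G` over `k`. -/
abbrev LAdmRep := (IsLocallyAdmissible : ObjectProperty (Rep.{w} k G)).FullSubcategory

variable [IsTopologicalGroup G]

theorem isOpen_vectorStabilizer_of_le {V : Rep.{w} k G} {x : V} {U : Subgroup G}
    (hU : IsOpen (U : Set G)) (h : U ≤ vectorStabilizer V x) :
    IsOpen (vectorStabilizer V x : Set G) := Subgroup.isOpen_mono h hU

/-- The submodule of smooth vectors. -/
def smoothVectors (V : Rep.{w} k G) : Submodule k V where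
  carrier := {x | IsOpen (vectorStabilizer V x : Set G)}
  add_mem' {x y} hx hy := by
    refine isOpen_vectorStabilizer_of_le (U := vectorStabilizer V x ⊓ vectorStabilizer V y)
      (IsOpen.inter hx hy) ?_
    intro g hg
    rw [mem_vectorStabilizer, map_add, hg.1, hg.2]
  zero_mem' := isOpen_vectorStabilizer_of_le (U := ⊤) isOpen_univ fun g _ => map_zero _
  smul_mem' c x hx := isOpen_vectorStabilizer_of_le (U := vectorStabilizer V x) hx fun g hg => by
    rw [mem_vectorStabilizer, map_smul, hg]

theorem act_mem_smoothVectors (V : Rep.{w} k G) (g : G) :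
    smoothVectors V ≤ (smoothVectors V).comap (V.ρ g) := by
  intro x hx
  have h : IsOpen (((vectorStabilizer V x).comap (MulAut.conj g⁻¹).toMonoidHom :
      Subgroup G) : Set G) := by
    refine hx.preimage ?_
    change Continuous fun h => g⁻¹ * h * g⁻¹⁻¹
    fun_prop
  refine isOpen_vectorStabilizer_of_le h ?_
  intro a ha
  rw [Subgroup.mem_comap, mem_vectorStabilizer] at ha
  have ha' : V.ρ (g⁻¹ * a * g) x = x := by simpa using ha
  rw [mem_vectorStabilizer]
  conv_rhs => rw [← ha']
  simp [← Module.End.mul_apply, ← map_mul, mul_assoc]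

variable (k G) in
/-- The condition of being a smooth vector. -/
def smoothCondition : VectorCondition.{u, v, w} k G where
  part := smoothVectors
  act_mem := act_mem_smoothVectors
  map_mem f x hx := isOpen_vectorStabilizer_of_le hx (vectorStabilizer_le_map f x)
  mem_of_map {V W} f hf x hx := by
    refine isOpen_vectorStabilizer_of_le hx ?_
    intro g hg
    rw [mem_vectorStabilizer, ← Rep.hom_comm_apply] at hg
    exact hf hg

noncomputable instance : Abelian (SmRep.{u, v, w} k G) :=
  (smoothCondition k G).abelian _ fun _ => Iff.rfl

instance [EnoughInjectives (Rep.{w} k G)] : EnoughInjectives (SmRep.{u, v, w} k G) :=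
  (smoothCondition k G).enoughInjectives _ fun _ => Iff.rfl

end Smooth

section LAdm

variable {k : Type v} {G : Type u} [CommRing k] [CommGroup G]

/-- The subrepresentation generated by a vector. -/
def cyclicSpan (V : Rep.{w} k G) (x : V) : Submodule k V :=
  Submodule.span k (Set.range fun g : G => V.ρ g x)

theorem cyclicSpan_stable (V : Rep.{w} k G) (x : V) (g : G) :
    cyclicSpan V x ≤ (cyclicSpan V x).comap (V.ρ g) := by
  refine Submodule.span_le.2 ?_
  rintro _ ⟨h, rfl⟩
  refine Submodule.subset_span ⟨g * h, ?_⟩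
  simp

theorem mem_cyclicSpan (V : Rep.{w} k G) (x : V) : x ∈ cyclicSpan V x :=
  Submodule.subset_span ⟨1, by simp⟩

theorem cyclicSpan_le {V : Rep.{w} k G} {x : V} {M : Submodule k V}
    (hM : ∀ g, M ≤ M.comap (V.ρ g)) (hx : x ∈ M) : cyclicSpan V x ≤ M := by
  refine Submodule.span_le.2 ?_
  rintro _ ⟨h, rfl⟩
  exact hM h hx

theorem map_cyclicSpan {V W : Rep.{w} k G} (f : V ⟶ W) (x : V) :
    (cyclicSpan V x).map f.hom.toLinearMap = cyclicSpan W (f.hom x) := by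
  rw [cyclicSpan, Submodule.map_span, cyclicSpan]
  congr 1
  ext y
  simp [Rep.hom_comm_apply]

variable [IsNoetherianRing k]

/-- The vectors whose orbit spans a finitely generated module. -/
def finiteVectors (V : Rep.{w} k G) : Submodule k V where
  carrier := {x | (cyclicSpan V x).FG}
  add_mem' {x y} hx hy := by
    refine Submodule.FG.of_le (Submodule.FG.sup hx hy) ?_
    refine Submodule.span_le.2 ?_
    rintro _ ⟨h, rfl⟩
    simp only [map_add]
    exact Submodule.add_mem_sup (Submodule.subset_span ⟨h, rfl⟩) (Submodule.subset_span ⟨h, rfl⟩)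
  zero_mem' := by
    have : cyclicSpan V (0 : V) = ⊥ := by simp [cyclicSpan]
    change (cyclicSpan V (0 : V)).FG
    rw [this]
    exact Submodule.fg_bot
  smul_mem' c x hx := by
    refine Submodule.FG.of_le hx ?_
    refine Submodule.span_le.2 ?_
    rintro _ ⟨h, rfl⟩
    simp only [map_smul]
    exact Submodule.smul_mem _ _ (Submodule.subset_span ⟨h, rfl⟩)

variable [TopologicalSpace G] [IsTopologicalGroup G]

variable (k G) in
/-- The condition of being a smooth vector whose orbit spans a finitely generated module. -/
def ladmCondition : VectorCondition.{u, v, w} k G where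
  part V := smoothVectors V ⊓ finiteVectors V
  act_mem V g x hx := ⟨act_mem_smoothVectors V g hx.1,
    Submodule.FG.of_le hx.2 (cyclicSpan_le (cyclicSpan_stable V x)
      (cyclicSpan_stable V x g (mem_cyclicSpan V x)))⟩
  map_mem f x hx := ⟨(smoothCondition k G).map_mem f x hx.1, by
    change (cyclicSpan _ _).FG
    rw [← map_cyclicSpan]
    exact hx.2.map _⟩
  mem_of_map f hf x hx := ⟨(smoothCondition k G).mem_of_map f hf x hx.1, by
    have h : (cyclicSpan _ _).FG := hx.2
    rw [← map_cyclicSpan] at h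
    exact Submodule.fg_of_fg_map_injective _ hf h⟩

/-- Over a noetherian ring and for a commutative group, a representation is locally admissible if
and only if it is smooth and every orbit spans a finitely generated module. -/
theorem isLocallyAdmissible_iff (V : Rep.{w} k G) :
    IsLocallyAdmissible V ↔ ∀ x : V, x ∈ (ladmCondition k G).part V := by
  constructor
  · intro h x
    obtain ⟨M, hM, hx, hs, hf⟩ := h x
    have h1 : IsOpen (vectorStabilizer (Rep.subrepresentation V M hM) ⟨x, hx⟩ : Set G) := hs _
    have h2 := (hf _ h1).map M.subtype
    refine ⟨(smoothCondition k G).map_mem (Rep.subtype V M hM) ⟨x, hx⟩ h1, h2.of_le ?_⟩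
    refine Submodule.span_le.2 ?_
    rintro _ ⟨h, rfl⟩
    refine ⟨⟨V.ρ h x, hM h hx⟩, ?_, rfl⟩
    intro g hg
    refine Subtype.ext ?_
    have hg' : V.ρ g x = x := congr_arg Subtype.val hg
    change V.ρ g (V.ρ h x) = V.ρ h x
    rw [← Module.End.mul_apply, ← map_mul, mul_comm, map_mul, Module.End.mul_apply, hg']
  · intro h x
    refine ⟨cyclicSpan V x, cyclicSpan_stable V x, mem_cyclicSpan V x, ?_, ?_⟩
    · intro y
      exact (smoothCondition k G).mem_of_map
        (Rep.subtype V (cyclicSpan V x) (cyclicSpan_stable V x)) Subtype.val_injective y (h y).1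
    · intro U _
      have : IsNoetherian k (cyclicSpan V x) := isNoetherian_of_fg_of_noetherian _ (h x).2
      exact IsNoetherian.noetherian _

noncomputable instance : Abelian (LAdmRep.{u, v, w} k G) :=
  (ladmCondition k G).abelian _ isLocallyAdmissible_iff

instance [EnoughInjectives (Rep.{w} k G)] : EnoughInjectives (LAdmRep.{u, v, w} k G) :=
  (ladmCondition k G).enoughInjectives _ isLocallyAdmissible_iff

theorem isLocallyAdmissible_le_isSmooth :
    (IsLocallyAdmissible : ObjectProperty (Rep.{w} k G)) ≤ IsSmooth := fun V hV x =>
  ((isLocallyAdmissible_iff V).1 hV x).1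

end LAdm

/-! ### Discrete `G`-sets and topological spaces -/

section GSets

variable {G : Type u} [Group G]

/-- A `G`-set all of whose stabilizers belong to the family `𝒦`. -/
structure GSetCat (𝒦 : Set (Subgroup G)) : Type (u + 1) where
  carrier : Type u
  [action : MulAction G carrier]
  stabilizer_mem : ∀ s : carrier, MulAction.stabilizer G s ∈ 𝒦

attribute [instance] GSetCat.action

namespace GSetCat

variable {𝒦 : Set (Subgroup G)}

/-- Morphisms are the `G`-equivariant maps. -/
instance : Category.{u} (GSetCat 𝒦) where
  Hom S T := S.carrier →[G] T.carrier
  id S := MulActionHom.id G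
  comp f g := g.comp f

/-- A family of equivariant maps with common target is a covering if it is jointly surjective. -/
def IsCovering {S : GSetCat 𝒦} {I : Type u} (T : I → GSetCat 𝒦) (f : ∀ i, T i ⟶ S) : Prop :=
  ∀ s : S.carrier, ∃ (i : I) (t : (T i).carrier), (f i).toFun t = s

end GSetCat

end GSets

/-- The category of topological spaces and local homeomorphisms. -/
structure LHSpace : Type (u + 1) where
  carrier : Type u
  [top : TopologicalSpace carrier]

attribute [instance] LHSpace.top

namespace LHSpace

instance : Category.{u} LHSpace.{u} where
  Hom X Y := {f : X.carrier → Y.carrier // IsLocalHomeomorph f}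
  id X := ⟨id, (Homeomorph.refl _).isLocalHomeomorph⟩
  comp f g := ⟨g.1 ∘ f.1, g.2.comp f.2⟩

/-- A family of local homeomorphisms with common target is a covering if it is jointly
surjective. -/
def IsCovering {X : LHSpace.{u}} {I : Type u} (Y : I → LHSpace.{u}) (f : ∀ i, Y i ⟶ X) : Prop :=
  ∀ x : X.carrier, ∃ (i : I) (y : (Y i).carrier), (f i).1 y = x

/-- An open subset, as a space. -/
def ofOpen {X : LHSpace.{u}} (V : Set X.carrier) : LHSpace.{u} := ⟨V⟩

/-- The inclusion of an open subset. -/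
def ofOpenι {X : LHSpace.{u}} (V : Set X.carrier) (hV : IsOpen V) : ofOpen V ⟶ X :=
  ⟨Subtype.val, hV.isOpenEmbedding_subtypeVal.isLocalHomeomorph⟩

end LHSpace

/-! ### `𝒮`-spaces -/

section SSpace

variable {G : Type u} [Group G] {𝒦 : Set (Subgroup G)}

/-- An `𝒮`-space: a functor from `G`-sets with stabilizers in `𝒦` to spaces which is continuous
(it maps coverings to coverings and commutes with fibre products) and commutes with coproducts. -/
structure IsSSpace (X : GSetCat 𝒦 ⥤ LHSpace.{u}) : Prop where
  map_covering : ∀ {S : GSetCat 𝒦} {I : Type u} (T : I → GSetCat 𝒦) (f : ∀ i, T i ⟶ S),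
    GSetCat.IsCovering T f → LHSpace.IsCovering (fun i => X.obj (T i)) (fun i => X.map (f i))
  preservesPullbacks : PreservesLimitsOfShape WalkingCospan X
  preservesCoproducts : ∀ J : Type u, PreservesColimitsOfShape (Discrete J) X

/-- An `𝒮`-space is exact if it commutes with equalizers. -/
def IsExactSSpace (X : GSetCat 𝒦 ⥤ LHSpace.{u}) : Prop :=
  PreservesLimitsOfShape WalkingParallelPair X

variable (X : GSetCat 𝒦 ⥤ LHSpace.{u})

/-- The colimit of the sets `Hom(U, X_S)` over all `S`: two maps are identified if they are linked
by a chain of morphisms of `G`-sets. -/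
def ColimHom (U : LHSpace.{u}) : Type (u + 1) :=
  Quot fun a b : (Σ S : GSetCat 𝒦, (U ⟶ X.obj S)) => ∃ τ : a.1 ⟶ b.1, a.2 ≫ X.map τ = b.2

namespace ColimHom

variable {X}

/-- The class of a map `U ⟶ X_S`. -/
def mk {U : LHSpace.{u}} (S : GSetCat 𝒦) (ψ : U ⟶ X.obj S) : ColimHom X U := Quot.mk _ ⟨S, ψ⟩

theorem mk_map {U : LHSpace.{u}} {S S' : GSetCat 𝒦} (ψ : U ⟶ X.obj S) (τ : S ⟶ S') :
    mk S' (ψ ≫ X.map τ) = mk S ψ := (Quot.sound ⟨τ, rfl⟩).symm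

/-- Functoriality in `U`. -/
def pullback {U V : LHSpace.{u}} (φ : U ⟶ V) : ColimHom X V → ColimHom X U :=
  Quot.lift (fun a => mk a.1 (φ ≫ a.2)) (by
    rintro a b ⟨τ, h⟩
    exact Quot.sound ⟨τ, (Category.assoc _ _ _).trans (congr_arg (φ ≫ ·) h)⟩)

theorem pullback_mk {U V : LHSpace.{u}} (φ : U ⟶ V) (S : GSetCat 𝒦) (ψ : V ⟶ X.obj S) :
    pullback φ (mk S ψ) = mk S (φ ≫ ψ) := rfl

theorem pullback_id {U : LHSpace.{u}} (α : ColimHom X U) : pullback (𝟙 U) α = α := by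
  induction α using Quot.ind with | mk a => exact congr_arg (mk a.1) (Category.id_comp _)

theorem pullback_comp {U V W : LHSpace.{u}} (φ : U ⟶ V) (χ : V ⟶ W) (α : ColimHom X W) :
    pullback (φ ≫ χ) α = pullback φ (pullback χ α) := by
  induction α using Quot.ind with | mk a => exact congr_arg (mk a.1) (Category.assoc _ _ _)

end ColimHom

/-- The category of spaces over the colimit of `X`: pairs of a space `U` and an element of
`ColimHom X U`. -/
structure Over (X : GSetCat 𝒦 ⥤ LHSpace.{u}) : Type (u + 1) where
  space : LHSpace.{u}
  point : ColimHom X space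

namespace Over

variable {X}

/-- A morphism is a morphism of spaces compatible with the given elements. -/
instance : Category.{u} (Over X) where
  Hom U V := {φ : U.space ⟶ V.space // ColimHom.pullback φ V.point = U.point}
  id U := ⟨𝟙 _, ColimHom.pullback_id _⟩
  comp f g := ⟨f.1 ≫ g.1, by rw [ColimHom.pullback_comp, g.2, f.2]⟩

variable (X) in
/-- The Grothendieck topology on spaces over the colimit of `X`: the sieves that contain a jointly
surjective family. -/
def topology : GrothendieckTopology (Over X) where
  sieves U := {R | ∀ x : U.space.carrier, ∃ (V : Over X) (f : V ⟶ U) (y : V.space.carrier),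
    R f ∧ f.1.1 y = x}
  top_mem' U x := ⟨U, 𝟙 U, x, trivial, rfl⟩
  pullback_stable' {U V} R f hR := by
    intro x
    obtain ⟨W, g, y, hg, hy⟩ := hR (f.1.1 x)
    obtain ⟨e, he, heg⟩ := g.1.2 y
    let O : Set V.space.carrier := f.1.1 ⁻¹' e.target
    have hO : IsOpen O := e.open_target.preimage f.1.2.continuous
    have hx : x ∈ O := by
      change f.1.1 x ∈ e.target
      rw [← hy, heg]
      exact e.map_source he
    let V' : Over X := ⟨LHSpace.ofOpen O, ColimHom.pullback (LHSpace.ofOpenι O hO) V.point⟩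
    let i : V' ⟶ V := ⟨LHSpace.ofOpenι O hO, rfl⟩
    let s : O → W.space.carrier := fun z => e.symm (f.1.1 z.1)
    have hs : g.1.1 ∘ s = f.1.1 ∘ Subtype.val := by
      funext z
      change g.1.1 (e.symm (f.1.1 z.1)) = f.1.1 z.1
      rw [heg]
      exact e.right_inv z.2
    have hs' : IsLocalHomeomorph s := by
      refine IsLocalHomeomorph.of_comp (g := g.1.1) ?_ g.1.2 ?_
      · rw [hs]
        exact f.1.2.comp hO.isOpenEmbedding_subtypeVal.isLocalHomeomorph
      · exact e.continuousOn_symm.comp_continuous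
          (f.1.2.continuous.comp continuous_subtype_val) fun z => z.2
    let j : V'.space ⟶ W.space := ⟨s, hs'⟩
    have hj : j ≫ g.1 = i.1 ≫ f.1 := Subtype.ext hs
    let j' : V' ⟶ W := ⟨j, by
      rw [← g.2, ← ColimHom.pullback_comp, hj, ColimHom.pullback_comp, f.2]⟩
    refine ⟨V', i, ⟨x, hx⟩, ?_, rfl⟩
    have : i ≫ f = j' ≫ g := Subtype.ext hj.symm
    change R (i ≫ f)
    rw [this]
    exact R.downward_closed hg j'
  transitive' {U} R hR R' h x := by
    obtain ⟨V, f, y, hf, hy⟩ := hR x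
    obtain ⟨W, g, z, hg, hz⟩ := h hf y
    refine ⟨W, g ≫ f, z, hg, ?_⟩
    change f.1.1 (g.1.1 z) = x
    rw [hz, hy]

/-- The lift of the functor `X` to spaces over its colimit. -/
def lift (S : GSetCat 𝒦) : Over X := ⟨X.obj S, ColimHom.mk S (𝟙 _)⟩

/-- The lift of the functor `X` on morphisms. -/
def liftMap {S T : GSetCat 𝒦} (τ : S ⟶ T) : (lift S : Over X) ⟶ lift T :=
  ⟨X.map τ, by
    change ColimHom.mk T (X.map τ ≫ 𝟙 _) = ColimHom.mk S (𝟙 _)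
    rw [← ColimHom.mk_map (𝟙 _) τ, Category.comp_id, Category.id_comp]⟩

theorem liftMap_id (S : GSetCat 𝒦) : liftMap (X := X) (𝟙 S) = 𝟙 _ :=
  Subtype.ext (X.map_id S)

theorem liftMap_comp {S T V : GSetCat 𝒦} (σ : S ⟶ T) (τ : T ⟶ V) :
    liftMap (X := X) (σ ≫ τ) = liftMap σ ≫ liftMap τ :=
  Subtype.ext (X.map_comp σ τ)

end Over

/-- Sheaves of `R`-modules on `X`. -/
abbrev Sh (X : GSetCat 𝒦 ⥤ LHSpace.{u}) (R : Type (u + 1)) [CommRing R] :=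
  Sheaf (Over.topology X) (ModuleCat.{u + 1} R)

theorem hasSheafify_over (R : Type (u + 1)) [CommRing R] :
    HasSheafify (Over.topology X) (ModuleCat.{u + 1} R) :=
  have : EssentiallySmall.{u + 1} (Over X) := essentiallySmallSelf.{u + 1} _
  (equivSmallModel.{u + 1} (Over X)).hasSheafify (Over.topology X)
    ((equivSmallModel.{u + 1} (Over X)).inverse.inducedTopology (Over.topology X)) _

noncomputable instance (R : Type (u + 1)) [CommRing R] : Abelian (Sh X R) :=
  have := hasSheafify_over X R
  sheafIsAbelian

instance (R : Type (u + 1)) [CommRing R] : EnoughInjectives (Sh X R) := by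
  have : EssentiallySmall.{u + 1} (Over X) := essentiallySmallSelf.{u + 1} _
  have h := Sheaf.isGrothendieckAbelian_of_essentiallySmall.{u + 1} (Over.topology X)
    (ModuleCat.{u + 1} R)
  exact IsGrothendieckAbelian.enoughInjectives.{u + 1}

end SSpace

section GoodFamily

variable {G : Type u} [Group G] [TopologicalSpace G]

/-- A cofinal family of open subgroups that is closed under conjugation and under passage to open
subgroups. -/
structure IsGoodFamily (𝒦 : Set (Subgroup G)) : Prop where
  isOpen : ∀ K ∈ 𝒦, IsOpen (K : Set G)
  cofinal : ∀ U : Subgroup G, IsOpen (U : Set G) → ∃ K ∈ 𝒦, K ≤ U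
  conj_mem : ∀ K ∈ 𝒦, ∀ g : G, K.map (MulAut.conj g).toMonoidHom ∈ 𝒦
  of_le : ∀ K ∈ 𝒦, ∀ K' : Subgroup G, IsOpen (K' : Set G) → K' ≤ K → K' ∈ 𝒦

variable {𝒦 : Set (Subgroup G)}

/-- The members of `𝒦`, ordered by reverse inclusion. -/
abbrev Level (𝒦 : Set (Subgroup G)) := {K : Subgroup G // K ∈ 𝒦}ᵒᵈ

/-- The subgroup underlying a level. -/
abbrev Level.group (K : Level 𝒦) : Subgroup G := (OrderDual.ofDual K).1

theorem IsGoodFamily.nonempty (h : IsGoodFamily 𝒦) : Nonempty (Level 𝒦) := by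
  obtain ⟨K, hK, -⟩ := h.cofinal ⊤ isOpen_univ
  exact ⟨OrderDual.toDual ⟨K, hK⟩⟩

theorem IsGoodFamily.directed (h : IsGoodFamily 𝒦) : IsDirectedOrder (Level 𝒦) where
  directed K L := by
    refine ⟨OrderDual.toDual ⟨K.group ⊓ L.group, h.of_le _ K.ofDual.2 _ ?_ inf_le_left⟩, ?_, ?_⟩
    · exact (h.isOpen _ K.ofDual.2).inter (h.isOpen _ L.ofDual.2)
    · exact inf_le_left (a := K.group) (b := L.group)
    · exact inf_le_right (a := K.group) (b := L.group)

/-- The conjugate of a level. -/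
def Level.conj (h : IsGoodFamily 𝒦) (g : G) (K : Level 𝒦) : Level 𝒦 :=
  OrderDual.toDual ⟨_, h.conj_mem _ K.ofDual.2 g⟩

theorem Level.mem_conj (h : IsGoodFamily 𝒦) (g : G) (K : Level 𝒦) (x : G) :
    x ∈ (K.conj h g).group ↔ g⁻¹ * x * g ∈ K.group := by
  change x ∈ K.group.map (MulAut.conj g).toMonoidHom ↔ _
  rw [Subgroup.mem_map_equiv]
  simp [MulAut.conj_symm_apply]

/-- The coset space `G / K`. -/
def cosets (h : IsGoodFamily 𝒦) (K : Level 𝒦) : GSetCat 𝒦 where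
  carrier := G ⧸ K.group
  stabilizer_mem s := by
    induction s using QuotientGroup.induction_on with | H g => ?_
    have h1 : (g : G ⧸ K.group) = g • ((1 : G) : G ⧸ K.group) := by
      rw [← QuotientGroup.mk_mul_of_mem g K.group.one_mem, mul_one]
      change _ = ((g * 1 : G) : G ⧸ K.group)
      rw [mul_one]
    rw [h1, MulAction.stabilizer_smul_eq_stabilizer_map_conj, MulAction.stabilizer_quotient]
    exact h.conj_mem _ K.ofDual.2 g

/-- The map `x K' ↦ x g K` of coset spaces, for `K' ≤ g K g⁻¹`. -/
def cosetMap (h : IsGoodFamily 𝒦) (K' K : Level 𝒦) (g : G)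
    (hg : ∀ x ∈ K'.group, g⁻¹ * x * g ∈ K.group) : cosets h K' ⟶ cosets h K :=
  { toFun := Quotient.lift (fun x : G => ((x * g : G) : G ⧸ K.group)) (by
      intro a b hab
      have hab' := hg _ (QuotientGroup.leftRel_apply.1 hab)
      refine QuotientGroup.eq.2 ?_
      simpa [mul_assoc] using hab')
    map_smul' := by
      intro x s
      induction s using QuotientGroup.induction_on with | H y => ?_
      change ((x * y * g : G) : G ⧸ K.group) = ((x * (y * g) : G) : G ⧸ K.group)
      rw [mul_assoc] }

theorem cosetMap_comp (h : IsGoodFamily 𝒦) (K₁ K₂ K₃ : Level 𝒦) (a b : G)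
    (ha : ∀ x ∈ K₁.group, a⁻¹ * x * a ∈ K₂.group) (hb : ∀ x ∈ K₂.group, b⁻¹ * x * b ∈ K₃.group) :
    cosetMap h K₁ K₂ a ha ≫ cosetMap h K₂ K₃ b hb =
      cosetMap h K₁ K₃ (a * b) fun x hx => by simpa [mul_assoc] using hb _ (ha x hx) := by
  refine MulActionHom.ext fun s => ?_
  induction s using QuotientGroup.induction_on with | H y => ?_
  change ((y * a * b : G) : G ⧸ K₃.group) = ((y * (a * b) : G) : G ⧸ K₃.group)
  rw [mul_assoc]

theorem cosetMap_congr (h : IsGoodFamily 𝒦) (K₁ K₂ : Level 𝒦) (a b : G)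
    (ha : ∀ x ∈ K₁.group, a⁻¹ * x * a ∈ K₂.group) (hb : ∀ x ∈ K₁.group, b⁻¹ * x * b ∈ K₂.group)
    (hab : a⁻¹ * b ∈ K₂.group) : cosetMap h K₁ K₂ a ha = cosetMap h K₁ K₂ b hb := by
  refine MulActionHom.ext fun s => ?_
  induction s using QuotientGroup.induction_on with | H y => ?_
  refine QuotientGroup.eq.2 ?_
  simpa [mul_assoc] using hab

theorem cosetMap_one (h : IsGoodFamily 𝒦) (K : Level 𝒦)
    (h1 : ∀ x ∈ K.group, (1 : G)⁻¹ * x * 1 ∈ K.group) : cosetMap h K K 1 h1 = 𝟙 _ := by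
  refine MulActionHom.ext fun s => ?_
  induction s using QuotientGroup.induction_on with | H y => ?_
  exact congr_arg _ (mul_one y)

end GoodFamily

/-! ### Sections at infinity -/

section Infinity

variable {G : Type u} [Group G] [TopologicalSpace G] {𝒦 : Set (Subgroup G)} (h : IsGoodFamily 𝒦)
  {X : GSetCat 𝒦 ⥤ LHSpace.{u}} {R : Type (u + 1)} [CommRing R]

/-- The sections over `X_{G/K}`. -/
abbrev sectionsAt (𝓕 : Sh X R) (K : Level 𝒦) : ModuleCat.{u + 1} R :=
  𝓕.obj.obj (Opposite.op (Over.lift (cosets h K)))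

/-- Restriction of sections along `x K' ↦ x g K`. -/
def sectionsPull (𝓕 : Sh X R) (K K' : Level 𝒦) (g : G)
    (hg : ∀ x ∈ K'.group, g⁻¹ * x * g ∈ K.group) :
    sectionsAt h 𝓕 K →ₗ[R] sectionsAt h 𝓕 K' :=
  (𝓕.obj.map (Over.liftMap (cosetMap h K' K g hg)).op).hom

theorem sectionsPull_comp (𝓕 : Sh X R) (K₁ K₂ K₃ : Level 𝒦) (a b : G)
    (ha : ∀ x ∈ K₁.group, a⁻¹ * x * a ∈ K₂.group) (hb : ∀ x ∈ K₂.group, b⁻¹ * x * b ∈ K₃.group)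
    (hab : ∀ x ∈ K₁.group, (a * b)⁻¹ * x * (a * b) ∈ K₃.group) (s : sectionsAt h 𝓕 K₃) :
    sectionsPull h 𝓕 K₂ K₁ a ha (sectionsPull h 𝓕 K₃ K₂ b hb s) =
      sectionsPull h 𝓕 K₃ K₁ (a * b) hab s := by
  have := cosetMap_comp h K₁ K₂ K₃ a b ha hb
  simp only [sectionsPull]
  rw [← this, Over.liftMap_comp, op_comp, Functor.map_comp]
  rfl

theorem sectionsPull_congr (𝓕 : Sh X R) (K₁ K₂ : Level 𝒦) (a b : G)
    (ha : ∀ x ∈ K₁.group, a⁻¹ * x * a ∈ K₂.group) (hb : ∀ x ∈ K₁.group, b⁻¹ * x * b ∈ K₂.group)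
    (hab : a⁻¹ * b ∈ K₂.group) (s : sectionsAt h 𝓕 K₂) :
    sectionsPull h 𝓕 K₂ K₁ a ha s = sectionsPull h 𝓕 K₂ K₁ b hb s := by
  simp only [sectionsPull]
  rw [cosetMap_congr h K₁ K₂ a b ha hb hab]

/-- Functoriality of the sections. -/
def sectionsMap {𝓕 𝓖 : Sh X R} (f : 𝓕 ⟶ 𝓖) (K : Level 𝒦) :
    sectionsAt h 𝓕 K →ₗ[R] sectionsAt h 𝓖 K :=
  (f.hom.app (Opposite.op (Over.lift (cosets h K)))).hom

theorem sectionsPull_natural {𝓕 𝓖 : Sh X R} (f : 𝓕 ⟶ 𝓖) (K K' : Level 𝒦) (g : G)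
    (hg : ∀ x ∈ K'.group, g⁻¹ * x * g ∈ K.group) (s : sectionsAt h 𝓕 K) :
    sectionsPull h 𝓖 K K' g hg (sectionsMap h f K s) =
      sectionsMap h f K' (sectionsPull h 𝓕 K K' g hg s) :=
  congr(($(f.hom.naturality (Over.liftMap (cosetMap h K' K g hg)).op)).hom s).symm

/-- Restriction of sections along `G/K' → G/K` for `K' ≤ K`. -/
def sectionsRes (𝓕 : Sh X R) (K K' : Level 𝒦) (hK : K ≤ K') :
    sectionsAt h 𝓕 K →ₗ[R] sectionsAt h 𝓕 K' :=
  sectionsPull h 𝓕 K K' 1 fun x hx => by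
    rw [inv_one, one_mul, mul_one]
    exact hK hx

open scoped Classical in
/-- The module of sections of a sheaf over `X_∞`: the direct limit of the sections over `X_{G/K}`
for `K` in `𝒦`. -/
abbrev SectionsInfinity (𝓕 : Sh X R) : Type (u + 1) :=
  Module.DirectLimit (fun K : Level 𝒦 => sectionsAt h 𝓕 K) (sectionsRes h 𝓕)

namespace SectionsInfinity

open scoped Classical in
/-- The element of the direct limit defined by a section over `X_{G/K}`. -/
noncomputable def of (𝓕 : Sh X R) (K : Level 𝒦) : sectionsAt h 𝓕 K →ₗ[R] SectionsInfinity h 𝓕 :=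
  Module.DirectLimit.of R (Level 𝒦) (fun K : Level 𝒦 => sectionsAt h 𝓕 K) (sectionsRes h 𝓕) K

theorem of_res (𝓕 : Sh X R) (K K' : Level 𝒦) (hK : K ≤ K') (s : sectionsAt h 𝓕 K) :
    of h 𝓕 K' (sectionsRes h 𝓕 K K' hK s) = of h 𝓕 K s := by
  classical
  exact Module.DirectLimit.of_f (f := sectionsRes h 𝓕)

theorem exists_of (𝓕 : Sh X R) (z : SectionsInfinity h 𝓕) :
    ∃ (K : Level 𝒦) (s : sectionsAt h 𝓕 K), of h 𝓕 K s = z :=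
  have := h.nonempty
  have := h.directed
  by classical exact Module.DirectLimit.exists_of z

open scoped Classical in
/-- The universal property of the direct limit. -/
noncomputable def lift (𝓕 : Sh X R) {P : Type (u + 1)} [AddCommGroup P] [Module R P]
    (g : ∀ K : Level 𝒦, sectionsAt h 𝓕 K →ₗ[R] P)
    (hg : ∀ (K K' : Level 𝒦) (hK : K ≤ K') (s : sectionsAt h 𝓕 K),
      g K' (sectionsRes h 𝓕 K K' hK s) = g K s) : SectionsInfinity h 𝓕 →ₗ[R] P :=
  Module.DirectLimit.lift R _ _ _ g hg

theorem lift_of (𝓕 : Sh X R) {P : Type (u + 1)} [AddCommGroup P] [Module R P]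
    (g : ∀ K : Level 𝒦, sectionsAt h 𝓕 K →ₗ[R] P)
    (hg : ∀ (K K' : Level 𝒦) (hK : K ≤ K') (s : sectionsAt h 𝓕 K),
      g K' (sectionsRes h 𝓕 K K' hK s) = g K s) (K : Level 𝒦) (s : sectionsAt h 𝓕 K) :
    lift h 𝓕 g hg (of h 𝓕 K s) = g K s := by
  classical
  exact Module.DirectLimit.lift_of (f := sectionsRes h 𝓕) g hg s

/-- The action of `g ∈ G` on the direct limit: a section over `X_{G/K}` is pulled back along
`X_{G/gKg⁻¹} → X_{G/K}`. -/
noncomputable def act (𝓕 : Sh X R) (g : G) : SectionsInfinity h 𝓕 →ₗ[R] SectionsInfinity h 𝓕 :=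
  lift h 𝓕 (fun K => of h 𝓕 (K.conj h g) ∘ₗ sectionsPull h 𝓕 K (K.conj h g) g
    fun x hx => (K.mem_conj h g x).1 hx) (by
      intro K K' hK s
      have hK' : K.conj h g ≤ K'.conj h g := by
        intro x hx
        exact (K.mem_conj h g x).2 (hK ((K'.mem_conj h g x).1 hx))
      have h1 : ∀ x ∈ (K'.conj h g).group, g⁻¹ * x * g ∈ K.group := fun x hx =>
        hK ((K'.mem_conj h g x).1 hx)
      rw [LinearMap.comp_apply, LinearMap.comp_apply, ← of_res h 𝓕 _ _ hK', sectionsRes,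
        sectionsPull_comp h 𝓕 _ _ _ g 1 _ _ (by simpa using h1), sectionsRes,
        sectionsPull_comp h 𝓕 _ _ _ 1 g _ _ (by simpa using h1)]
      congr 1
      exact sectionsPull_congr h 𝓕 _ _ _ _ _ _ (by simp [K.group.one_mem]) s)

theorem act_of (𝓕 : Sh X R) (g : G) (K K' : Level 𝒦)
    (hg : ∀ x ∈ K'.group, g⁻¹ * x * g ∈ K.group) (s : sectionsAt h 𝓕 K) :
    act h 𝓕 g (of h 𝓕 K s) = of h 𝓕 K' (sectionsPull h 𝓕 K K' g hg s) := by
  rw [act, lift_of, LinearMap.comp_apply]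
  have hK' : K.conj h g ≤ K' := fun x hx => (K.mem_conj h g x).2 (hg x hx)
  rw [← of_res h 𝓕 _ _ hK', sectionsRes, sectionsPull_comp h 𝓕 _ _ _ 1 g _ _ (by simpa using hg)]
  congr 1
  exact sectionsPull_congr h 𝓕 _ _ _ _ _ _ (by simp [K.group.one_mem]) s

theorem act_one (𝓕 : Sh X R) : act h 𝓕 1 = LinearMap.id := by
  ext z
  obtain ⟨K, s, rfl⟩ := exists_of h 𝓕 z
  rw [act_of h 𝓕 1 K K (by simp)]
  exact of_res h 𝓕 K K le_rfl s

theorem act_mul (𝓕 : Sh X R) (a b : G) : act h 𝓕 (a * b) = act h 𝓕 a ∘ₗ act h 𝓕 b := by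
  ext z
  obtain ⟨K, s, rfl⟩ := exists_of h 𝓕 z
  have h1 : ∀ x ∈ ((K.conj h b).conj h a).group, (a * b)⁻¹ * x * (a * b) ∈ K.group := by
    intro x hx
    have := (K.mem_conj h b _).1 (((K.conj h b).mem_conj h a x).1 hx)
    simpa [mul_assoc] using this
  rw [LinearMap.comp_apply, act_of h 𝓕 b K (K.conj h b) fun x hx => (K.mem_conj h b x).1 hx,
    act_of h 𝓕 a (K.conj h b) ((K.conj h b).conj h a) fun x hx =>
      ((K.conj h b).mem_conj h a x).1 hx,
    sectionsPull_comp h 𝓕 _ _ _ a b _ _ h1, act_of h 𝓕 (a * b) K _ h1]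

/-- The sections over `X_∞` as a representation of `G`. -/
noncomputable def rep (𝓕 : Sh X R) : Rep.{u + 1} R G :=
  Rep.of (X := SectionsInfinity h 𝓕)
    { toFun := act h 𝓕
      map_one' := act_one h 𝓕
      map_mul' := act_mul h 𝓕 }

theorem rep_smooth [IsTopologicalGroup G] (𝓕 : Sh X R) : IsSmooth (rep h 𝓕) := by
  intro z
  obtain ⟨K, s, rfl⟩ := exists_of h 𝓕 z
  refine isOpen_vectorStabilizer_of_le (h.isOpen _ K.ofDual.2) ?_
  intro g hg
  have h1 : ∀ x ∈ K.group, g⁻¹ * x * g ∈ K.group := fun x hx =>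
    K.group.mul_mem (K.group.mul_mem (K.group.inv_mem hg) hx) hg
  change act h 𝓕 g (of h 𝓕 K s) = of h 𝓕 K s
  rw [act_of h 𝓕 g K K h1, sectionsPull_congr h 𝓕 _ _ g 1 h1 (by simp) (by simpa using hg)]
  exact of_res h 𝓕 K K le_rfl s

/-- Functoriality of the sections over `X_∞`. -/
noncomputable def map {𝓕 𝓖 : Sh X R} (f : 𝓕 ⟶ 𝓖) : SectionsInfinity h 𝓕 →ₗ[R] SectionsInfinity h 𝓖 :=
  lift h 𝓕 (fun K => of h 𝓖 K ∘ₗ sectionsMap h f K) (by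
    intro K K' hK s
    rw [LinearMap.comp_apply, LinearMap.comp_apply, ← of_res h 𝓖 K K' hK, sectionsRes, sectionsRes,
      sectionsPull_natural])

theorem map_of {𝓕 𝓖 : Sh X R} (f : 𝓕 ⟶ 𝓖) (K : Level 𝒦) (s : sectionsAt h 𝓕 K) :
    map h f (of h 𝓕 K s) =
      of h 𝓖 K (sectionsMap h f K s) := lift_of _ _ _ _ _ _

theorem map_act {𝓕 𝓖 : Sh X R} (f : 𝓕 ⟶ 𝓖) (g : G) (z : SectionsInfinity h 𝓕) :
    map h f (act h 𝓕 g z) = act h 𝓖 g (map h f z) := by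
  obtain ⟨K, s, rfl⟩ := exists_of h 𝓕 z
  rw [act_of h 𝓕 g K (K.conj h g) fun x hx => (K.mem_conj h g x).1 hx, map_of, map_of,
    act_of h 𝓖 g K (K.conj h g) fun x hx => (K.mem_conj h g x).1 hx, sectionsPull_natural]

end SectionsInfinity

variable (X R) in
/-- The functor `H⁰(X_∞, -)` from sheaves on `X` to smooth representations of `G`. -/
noncomputable def H0Infinity [IsTopologicalGroup G] : Sh X R ⥤ SmRep.{u, u + 1, u + 1} R G where
  obj 𝓕 := ⟨SectionsInfinity.rep h 𝓕, SectionsInfinity.rep_smooth h 𝓕⟩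
  map f := ObjectProperty.homMk (Rep.ofHom ⟨SectionsInfinity.map h f, fun g =>
    LinearMap.ext fun z => SectionsInfinity.map_act h f g z⟩)
  map_id 𝓕 := by
    ext z
    obtain ⟨K, s, rfl⟩ := SectionsInfinity.exists_of h 𝓕 z
    exact SectionsInfinity.map_of h _ K s
  map_comp f g := by
    ext z
    obtain ⟨K, s, rfl⟩ := SectionsInfinity.exists_of h _ z
    refine Eq.trans (b := SectionsInfinity.map h g
      (SectionsInfinity.map h f (SectionsInfinity.of h _ K s))) ?_ rfl
    refine Eq.trans (SectionsInfinity.map_of h (f ≫ g) K s) ?_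
    rw [SectionsInfinity.map_of, SectionsInfinity.map_of]
    rfl

instance [IsTopologicalGroup G] : (H0Infinity h X R).Additive where
  map_add {𝓕 𝓖 f g} := by
    ext z
    obtain ⟨K, s, rfl⟩ := SectionsInfinity.exists_of h 𝓕 z
    change SectionsInfinity.map h (f + g) _ =
      SectionsInfinity.map h f _ + SectionsInfinity.map h g _
    rw [SectionsInfinity.map_of, SectionsInfinity.map_of, SectionsInfinity.map_of, ← map_add]
    rfl

end Infinity

/-! ### Quotients of commutative groups, inflation and invariants -/

section QuotBy

variable {G : Type u} [CommGroup G]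

/-- The quotient of a commutative group by a subgroup. -/
def QuotBy (H : Subgroup G) : Type u := G ⧸ H

namespace QuotBy

instance (H : Subgroup G) : CommGroup (QuotBy H) := QuotientGroup.Quotient.commGroup H

instance (H : Subgroup G) [TopologicalSpace G] : TopologicalSpace (QuotBy H) :=
  QuotientGroup.instTopologicalSpace H

instance (H : Subgroup G) [TopologicalSpace G] [IsTopologicalGroup G] :
    IsTopologicalGroup (QuotBy H) := QuotientGroup.instIsTopologicalGroup H

/-- The projection. -/
def mk (H : Subgroup G) : G →* QuotBy H := QuotientGroup.mk' H

theorem mk_surjective (H : Subgroup G) : Function.Surjective (mk H) :=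
  QuotientGroup.mk'_surjective H

theorem mk_eq_one {H : Subgroup G} {g : G} : mk H g = 1 ↔ g ∈ H := QuotientGroup.eq_one_iff g

theorem mk_eq_mk {H : Subgroup G} {a b : G} : mk H a = mk H b ↔ a⁻¹ * b ∈ H :=
  QuotientGroup.eq

theorem isOpen_iff {H : Subgroup G} [TopologicalSpace G] (S : Set (QuotBy H)) :
    IsOpen S ↔ IsOpen (mk H ⁻¹' S) := Iff.rfl

/-- Homomorphisms out of the quotient. -/
def lift (H : Subgroup G) {M : Type v} [Monoid M] (f : G →* M) (hf : ∀ h ∈ H, f h = 1) :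
    QuotBy H →* M := QuotientGroup.lift H f fun h hh => MonoidHom.mem_ker.2 (hf h hh)

theorem lift_mk (H : Subgroup G) {M : Type v} [Monoid M] (f : G →* M) (hf : ∀ h ∈ H, f h = 1)
    (g : G) : lift H f hf (mk H g) = f g := rfl

/-- The projection `G/H → G/U` for `H ≤ U`. -/
def proj {H U : Subgroup G} (hHU : H ≤ U) : QuotBy H →* QuotBy U :=
  lift H (mk U) fun _ hh => mk_eq_one.2 (hHU hh)

theorem proj_mk {H U : Subgroup G} (hHU : H ≤ U) (g : G) : proj hHU (mk H g) = mk U g := rfl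

end QuotBy

variable {k : Type v} [CommRing k]

theorem fixedVectors_stable (V : Rep.{w} k G) (H : Subgroup G) (g : G) :
    fixedVectors V H ≤ (fixedVectors V H).comap (V.ρ g) := by
  intro x hx h hh
  rw [← Module.End.mul_apply, ← map_mul, mul_comm, map_mul, Module.End.mul_apply, hx h hh]

/-- The `H`-invariants as a representation of `G/H`. -/
noncomputable abbrev invariantsRep (H : Subgroup G) (V : Rep.{w} k G) : Rep.{w} k (QuotBy H) :=
  Rep.of (X := fixedVectors V H) (QuotBy.lift H
    (V.ρ.subrepresentation (fixedVectors V H) (fixedVectors_stable V H))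
      fun h hh => LinearMap.ext fun x => Subtype.ext (x.2 h hh))

theorem map_mem_fixedVectors {V W : Rep.{w} k G} (f : V ⟶ W) (H : Subgroup G) (x : V)
    (hx : x ∈ fixedVectors V H) : f.hom x ∈ fixedVectors W H := by
  intro h hh
  rw [← Rep.hom_comm_apply, hx h hh]

variable (k) in
/-- The functor of `H`-invariants. -/
noncomputable def invariantsFun (H : Subgroup G) : Rep.{w} k G ⥤ Rep.{w} k (QuotBy H) where
  obj V := invariantsRep H V
  map {V W} f := Rep.ofHom ⟨f.hom.toLinearMap.restrict fun x hx => map_mem_fixedVectors f H x hx, by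
    intro g
    obtain ⟨g, rfl⟩ := QuotBy.mk_surjective H g
    ext x
    exact Rep.hom_comm_apply f g x.1⟩
  map_id V := by
    ext : 1
    rfl
  map_comp f g := by
    ext : 1
    rfl

instance (H : Subgroup G) : (invariantsFun.{u, v, w} k H).Additive where
  map_add {V W f g} := by
    ext : 1
    rfl

theorem cyclicSpan_invariants (H : Subgroup G) (V : Rep.{w} k G) (x : fixedVectors V H) :
    (cyclicSpan (invariantsRep H V) x).map (fixedVectors V H).subtype = cyclicSpan V x := by
  rw [cyclicSpan, Submodule.map_span, cyclicSpan]
  congr 1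
  ext y
  constructor
  · rintro ⟨_, ⟨g, rfl⟩, rfl⟩
    obtain ⟨g, rfl⟩ := QuotBy.mk_surjective H g
    exact ⟨g, rfl⟩
  · rintro ⟨g, rfl⟩
    exact ⟨_, ⟨QuotBy.mk H g, rfl⟩, rfl⟩

variable [TopologicalSpace G] [IsTopologicalGroup G]

theorem invariants_isLocallyAdmissible [IsNoetherianRing k] (H : Subgroup G) (V : Rep.{w} k G)
    (hV : IsLocallyAdmissible V) : IsLocallyAdmissible (invariantsRep H V) := by
  rw [isLocallyAdmissible_iff] at hV ⊢
  intro x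
  obtain ⟨h1, h2⟩ := hV x.1
  constructor
  · refine (QuotBy.isOpen_iff (vectorStabilizer (invariantsRep H V) x : Set (QuotBy H))).2 ?_
    convert (show IsOpen (vectorStabilizer V x.1 : Set G) from h1) using 1
    ext g
    exact Subtype.ext_iff
  · change (cyclicSpan (invariantsRep H V) x).FG
    refine Submodule.fg_of_fg_map_injective (fixedVectors V H).subtype Subtype.val_injective ?_
    rw [cyclicSpan_invariants]
    exact h2

variable (k) in
/-- The functor of `H`-invariants on locally admissible representations. -/
noncomputable def invariantsLAdm [IsNoetherianRing k] (H : Subgroup G) :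
    LAdmRep.{u, v, w} k G ⥤ LAdmRep.{u, v, w} k (QuotBy H) where
  obj V := ⟨(invariantsFun k H).obj V.obj, invariants_isLocallyAdmissible H V.obj V.property⟩
  map f := ObjectProperty.homMk ((invariantsFun k H).map f.hom)
  map_id V := by
    ext : 1
    exact (invariantsFun k H).map_id V.obj
  map_comp f g := by
    ext : 1
    exact (invariantsFun k H).map_comp f.hom g.hom

instance [IsNoetherianRing k] (H : Subgroup G) : (invariantsLAdm.{u, v, w} k H).Additive where
  map_add {V W f g} := by
    ext : 1
    exact (invariantsFun k H).map_add

/-- Inflation along `G/H → G/U` preserves local admissibility. -/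
theorem inflation_isLocallyAdmissible [IsNoetherianRing k] {H U : Subgroup G} (hHU : H ≤ U)
    (V : Rep.{w} k (QuotBy U)) (hV : IsLocallyAdmissible V) :
    IsLocallyAdmissible ((Rep.resFunctor (QuotBy.proj hHU)).obj V) := by
  rw [isLocallyAdmissible_iff] at hV ⊢
  intro x
  obtain ⟨h1, h2⟩ := hV x
  constructor
  · exact (QuotBy.isOpen_iff _).2 ((QuotBy.isOpen_iff _).1
      (show IsOpen (vectorStabilizer V x : Set (QuotBy U)) from h1))
  · change (cyclicSpan _ _).FG
    convert (show (cyclicSpan V x).FG from h2) using 1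
    rw [cyclicSpan, cyclicSpan]
    congr 1
    ext y
    constructor
    · rintro ⟨g, rfl⟩
      exact ⟨QuotBy.proj hHU g, rfl⟩
    · rintro ⟨g, rfl⟩
      obtain ⟨g, rfl⟩ := QuotBy.mk_surjective U g
      exact ⟨QuotBy.mk H g, rfl⟩

variable (k) in
/-- Inflation of locally admissible representations along `G/H → G/U`, for `H ≤ U`. -/
noncomputable def inflation [IsNoetherianRing k] {H U : Subgroup G} (hHU : H ≤ U) :
    LAdmRep.{u, v, w} k (QuotBy U) ⥤ LAdmRep.{u, v, w} k (QuotBy H) where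
  obj V := ⟨(Rep.resFunctor (QuotBy.proj hHU)).obj V.obj,
    inflation_isLocallyAdmissible hHU V.obj V.property⟩
  map f := ObjectProperty.homMk ((Rep.resFunctor (QuotBy.proj hHU)).map f.hom)

instance [IsNoetherianRing k] {H U : Subgroup G} (hHU : H ≤ U) :
    (inflation.{u, v, w} k hHU).Additive where
  map_add {V W f g} := by
    ext : 1
    exact (Rep.resFunctor (QuotBy.proj hHU)).map_add

end QuotBy

/-! ### The group `PGL₂` of a local field -/

section Field

variable (F : Type u) [NontriviallyNormedField F]

/-- The group `PGL₂(F)`, with the quotient topology. -/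
abbrev PGL2 := Matrix.GeneralLinearGroup (Fin 2) F ⧸
  Subgroup.center (Matrix.GeneralLinearGroup (Fin 2) F)

variable {F}

/-- The class of the diagonal matrix with entries `x`, `1`. -/
def delta : Fˣ →* PGL2 F :=
  (QuotientGroup.mk' _).comp
    { toFun := fun x =>
        ⟨!![(x : F), 0; 0, 1], !![((x⁻¹ : Fˣ) : F), 0; 0, 1],
          by simp [Matrix.one_fin_two], by simp [Matrix.one_fin_two]⟩
      map_one' := Units.ext (by simp [Matrix.one_fin_two])
      map_mul' := fun x y => Units.ext (by simp) }

/-- The class of the upper triangular unipotent matrix with entry `y`. -/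
def unip (y : F) : PGL2 F :=
  QuotientGroup.mk (⟨!![1, y; 0, 1], !![1, -y; 0, 1],
    by simp [Matrix.one_fin_two], by simp [Matrix.one_fin_two]⟩ :
      Matrix.GeneralLinearGroup (Fin 2) F)

theorem continuous_delta : Continuous (delta : Fˣ → PGL2 F) := by
  refine continuous_quotient_mk'.comp ?_
  rw [Units.continuous_iff]
  constructor
  · refine continuous_matrix ?_
    intro i j
    fin_cases i <;> fin_cases j <;> simp <;> fun_prop
  · refine continuous_matrix ?_
    intro i j
    fin_cases i <;> fin_cases j <;> simp <;>
      first | exact continuous_const | exact Units.continuous_val.inv₀ fun x => x.ne_zero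

theorem delta_mul_unip (t : Fˣ) (y : F) : delta t * unip y = unip (t * y) * delta t := by
  refine congr_arg (QuotientGroup.mk (s := Subgroup.center (Matrix.GeneralLinearGroup (Fin 2) F)))
    (Units.ext ?_)
  simp

/-- The group of units of the valuation ring. -/
def unitGroup (F : Type u) [NontriviallyNormedField F] : Subgroup Fˣ where
  carrier := {x | ‖(x : F)‖ = 1}
  mul_mem' {a b} (ha : ‖(a : F)‖ = 1) (hb : ‖(b : F)‖ = 1) := by
    change ‖((a * b : Fˣ) : F)‖ = 1
    simp [ha, hb]
  one_mem' := by simp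
  inv_mem' {a} (ha : ‖(a : F)‖ = 1) := by
    change ‖((a⁻¹ : Fˣ) : F)‖ = 1
    simp [ha]

theorem mem_unitGroup {x : Fˣ} : x ∈ unitGroup F ↔ ‖(x : F)‖ = 1 := Iff.rfl

variable [IsUltrametricDist F]

/-- The closed ball of radius `‖t‖`, i.e. `t 𝒪_F`. -/
def ballGroup (t : Fˣ) : AddSubgroup F where
  carrier := {x | ‖x‖ ≤ ‖(t : F)‖}
  add_mem' {a b} ha hb := (IsUltrametricDist.norm_add_le_max a b).trans (max_le ha hb)
  zero_mem' := by simp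
  neg_mem' {a} (ha : ‖a‖ ≤ _) := by
    change ‖-a‖ ≤ _
    rwa [norm_neg]

theorem mem_ballGroup {t : Fˣ} {x : F} : x ∈ ballGroup t ↔ ‖x‖ ≤ ‖(t : F)‖ := Iff.rfl

theorem isOpen_ballGroup (t : Fˣ) : IsOpen (ballGroup t : Set F) := by
  have : (ballGroup t : Set F) = Metric.closedBall 0 ‖(t : F)‖ := by
    ext x
    rw [mem_closedBall_zero_iff]
    rfl
  rw [this]
  exact IsUltrametricDist.isOpen_closedBall 0 (norm_ne_zero_iff.2 t.ne_zero)

/-- The quotient `𝒪_F / t 𝒪_F`, for `t` in `𝒪_F`. -/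
abbrev Residues (t : Fˣ) := ballGroup (1 : Fˣ) ⧸ (ballGroup t).addSubgroupOf (ballGroup (1 : Fˣ))

theorem isOpen_unitGroup : IsOpen (unitGroup F : Set Fˣ) := by
  have : (unitGroup F : Set Fˣ) = ((↑) : Fˣ → F) ⁻¹' Metric.sphere 0 1 := by
    ext x
    simp [mem_unitGroup]
  rw [this]
  exact (IsUltrametricDist.isOpen_sphere 0 one_ne_zero).preimage Units.continuous_val

variable [ProperSpace F]

instance (t : Fˣ) : Finite (Residues t) := by
  have : CompactSpace (ballGroup (1 : Fˣ)) := by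
    have h : ((ballGroup (1 : Fˣ) : AddSubgroup F) : Set F) = Metric.closedBall 0 ‖((1 : Fˣ) : F)‖ := by
      ext x
      rw [mem_closedBall_zero_iff]
      rfl
    refine isCompact_iff_compactSpace.1 ?_
    rw [h]
    exact isCompact_closedBall _ _
  exact AddSubgroup.quotient_finite_of_isOpen _
    ((isOpen_ballGroup t).preimage continuous_subtype_val)

theorem isCompact_unitGroup : IsCompact (unitGroup F : Set Fˣ) := by
  rw [Units.isEmbedding_val₀.isInducing.isCompact_iff]
  convert isCompact_sphere (0 : F) 1 using 1
  ext x
  constructor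
  · rintro ⟨y, hy, rfl⟩
    simpa [mem_unitGroup] using hy
  · intro hx
    have hx' : ‖x‖ = 1 := by simpa using hx
    exact ⟨Units.mk0 x (by rw [← norm_ne_zero_iff, hx']; exact one_ne_zero), hx', rfl⟩

/-- A uniformizer: an element of largest norm in the maximal ideal. -/
def IsUniformizer (π : Fˣ) : Prop := ‖(π : F)‖ < 1 ∧ ∀ x : F, ‖x‖ < 1 → ‖x‖ ≤ ‖(π : F)‖

variable (F) in
theorem exists_isUniformizer : ∃ π : Fˣ, IsUniformizer π := by
  have hc : IsCompact (Metric.ball (0 : F) 1) :=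
    (isCompact_closedBall (0 : F) 1).of_isClosed_subset (IsUltrametricDist.isClosed_ball 0 1)
      Metric.ball_subset_closedBall
  obtain ⟨x, hx, hmax⟩ := hc.exists_isMaxOn ⟨0, by simp⟩ continuous_norm.continuousOn
  obtain ⟨y, hy0, hy1⟩ := NormedField.exists_norm_lt_one F
  have h1 : ‖y‖ ≤ ‖x‖ := hmax (by simpa using hy1)
  have hx0 : x ≠ 0 := norm_pos_iff.1 (hy0.trans_le h1)
  exact ⟨Units.mk0 x hx0, by simpa using hx, fun z hz => hmax (by simpa using hz)⟩

variable (F) in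
/-- A chosen uniformizer. -/
noncomputable def uniformizer : Fˣ := (exists_isUniformizer F).choose

variable (F) in
theorem uniformizer_spec : IsUniformizer (uniformizer F) := (exists_isUniformizer F).choose_spec

theorem exists_eq_zpow_mul (t : Fˣ) : ∃ (n : ℤ) (v : Fˣ), v ∈ unitGroup F ∧
    t = uniformizer F ^ n * v := by
  obtain ⟨h1, h2⟩ := uniformizer_spec F
  set π := uniformizer F
  have hπ : 0 < ‖(π : F)‖ := norm_pos_iff.2 π.ne_zero
  obtain ⟨n, hn1, hn2⟩ := exists_mem_Ioc_zpow (norm_pos_iff.2 t.ne_zero) ((one_lt_inv₀ hπ).2 h1)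
  rw [inv_zpow, ← zpow_neg] at hn1 hn2
  have h0 : ‖((π ^ (n + 1) * t : Fˣ) : F)‖ = ‖(π : F)‖ ^ (n + 1) * ‖(t : F)‖ := by simp
  refine ⟨-(n + 1), π ^ (n + 1) * t, ?_, by rw [← mul_assoc, ← zpow_add]; simp⟩
  have h3 : ‖((π ^ (n + 1) * t : Fˣ) : F)‖ ≤ 1 := by
    rw [h0]
    calc _ ≤ ‖(π : F)‖ ^ (n + 1) * ‖(π : F)‖ ^ (-(n + 1)) := by gcongr
      _ = 1 := by rw [← zpow_add₀ hπ.ne']; simp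
  rw [mem_unitGroup]
  refine h3.eq_or_lt.resolve_right fun h4 => ?_
  have h5 := h2 _ h4
  rw [h0, zpow_add₀ hπ.ne', zpow_one, mul_right_comm, mul_le_iff_le_one_left hπ] at h5
  have h6 : ‖(π : F)‖ ^ n * ‖(π : F)‖ ^ (-n) < 1 :=
    lt_of_lt_of_le (by gcongr) h5
  rw [← zpow_add₀ hπ.ne'] at h6
  simp at h6

end Field

/-! ### Ordinary parts -/

section Ord

variable {F : Type u} [NontriviallyNormedField F] [IsUltrametricDist F] [ProperSpace F]
  {R : Type v} [CommRing R]

/-- The vectors fixed by `N₀`, the image of the valuation ring in the unipotent group. -/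
def unipotentFixed (V : Rep.{w} R (PGL2 F)) : Submodule R V where
  carrier := {x | ∀ y : F, ‖y‖ ≤ 1 → V.ρ (unip y) x = x}
  add_mem' ha hb y hy := by rw [map_add, ha y hy, hb y hy]
  zero_mem' _ _ := map_zero _
  smul_mem' c x hx y hy := by rw [map_smul, hx y hy]

theorem mem_unipotentFixed {V : Rep.{w} R (PGL2 F)} {x : V} :
    x ∈ unipotentFixed V ↔ ∀ y : F, ‖y‖ ≤ 1 → V.ρ (unip y) x = x := Iff.rfl

/-- The Hecke operator of `t` in `𝒪_F`, mapping `v` to the sum of the `n t v`, where `n` runs through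
representatives of `N₀ / t N₀ t⁻¹`. -/
noncomputable def heckeOp (V : Rep.{w} R (PGL2 F)) (t : Fˣ) : V →ₗ[R] V :=
  ∑ᶠ q : Residues t, V.ρ (unip ((Quotient.out q : ballGroup (1 : Fˣ)) : F) * delta t)

theorem heckeOp_map {V W : Rep.{w} R (PGL2 F)} (f : V ⟶ W) (t : Fˣ) (x : V) :
    f.hom (heckeOp V t x) = heckeOp W t (f.hom x) := by
  have := Fintype.ofFinite (Residues t)
  rw [heckeOp, heckeOp, finsum_eq_sum_of_fintype, finsum_eq_sum_of_fintype, LinearMap.sum_apply,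
    LinearMap.sum_apply, map_sum]
  exact Finset.sum_congr rfl fun q _ => Rep.hom_comm_apply f _ x

theorem delta_mem_unipotentFixed (V : Rep.{w} R (PGL2 F)) (t : Fˣ) (ht : t ∈ unitGroup F) (x : V)
    (hx : x ∈ unipotentFixed V) : V.ρ (delta t) x ∈ unipotentFixed V := by
  intro y hy
  have h1 : y = t * (((t⁻¹ : Fˣ) : F) * y) := by simp
  have h2 : ‖((t⁻¹ : Fˣ) : F) * y‖ ≤ 1 := by
    rw [norm_mul, (show ‖((t⁻¹ : Fˣ) : F)‖ = 1 from inv_mem ht), one_mul]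
    exact hy
  rw [← Module.End.mul_apply, ← map_mul, h1, ← delta_mul_unip, map_mul, Module.End.mul_apply,
    hx _ h2]

theorem heckeOp_unit (V : Rep.{w} R (PGL2 F)) (t : Fˣ) (ht : t ∈ unitGroup F) (x : V)
    (hx : x ∈ unipotentFixed V) : heckeOp V t x = V.ρ (delta t) x := by
  have ht' : ‖(t : F)‖ = 1 := ht
  have h1 : Subsingleton (Residues t) := by
    refine ⟨fun a b => ?_⟩
    induction a using QuotientAddGroup.induction_on with | H a => ?_
    induction b using QuotientAddGroup.induction_on with | H b => ?_
    refine QuotientAddGroup.eq.2 ?_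
    rw [AddSubgroup.mem_addSubgroupOf, mem_ballGroup, ht']
    have := (-a + b).2
    rw [mem_ballGroup] at this
    simpa using this
  let _ : Unique (Residues t) := uniqueOfSubsingleton ((0 : ballGroup (1 : Fˣ)) : Residues t)
  rw [heckeOp, finsum_unique, map_mul, Module.End.mul_apply]
  refine delta_mem_unipotentFixed V t ht x hx _ ?_
  generalize (Quotient.out (@default (Residues t) _) : ballGroup (1 : Fˣ)) = a
  have := a.2
  rw [mem_ballGroup] at this
  simpa using this

/-- The submodule of functions `ψ` on `Fˣ` with values in the `N₀`-fixed vectors such that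
`ψ (s t) = h_s (ψ t)` for `s` in `𝒪_F`, i.e. of `R[T⁺]`-linear maps from `R[T]` to the `N₀`-fixed
vectors. -/
def heckeFunctions (V : Rep.{w} R (PGL2 F)) : Submodule R (Fˣ → V) where
  carrier := {ψ | (∀ t, ψ t ∈ unipotentFixed V) ∧
    ∀ s t : Fˣ, ‖(s : F)‖ ≤ 1 → ψ (s * t) = heckeOp V s (ψ t)}
  add_mem' {a b} ha hb := ⟨fun t => add_mem (ha.1 t) (hb.1 t), fun s t hs => by
    rw [Pi.add_apply, Pi.add_apply, map_add, ha.2 s t hs, hb.2 s t hs]⟩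
  zero_mem' := ⟨fun t => zero_mem _, fun s t hs => by
    rw [Pi.zero_apply, Pi.zero_apply, map_zero]⟩
  smul_mem' c a ha := ⟨fun t => Submodule.smul_mem _ _ (ha.1 t), fun s t hs => by
    rw [Pi.smul_apply, Pi.smul_apply, map_smul, ha.2 s t hs]⟩

/-- The action of `Fˣ` on functions by translation of the argument. -/
def translation (F : Type u) [NontriviallyNormedField F] (R : Type v) [CommRing R] (V : Type w)
    [AddCommGroup V] [Module R V] : Representation R Fˣ (Fˣ → V) where
  toFun t' := { toFun := fun ψ t => ψ (t * t'), map_add' := fun _ _ => rfl,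
                map_smul' := fun _ _ => rfl }
  map_one' := by
    ext ψ t
    exact congr_arg _ (mul_one t)
  map_mul' a b := by
    ext ψ t
    change ψ (t * (a * b)) = ψ (t * a * b)
    rw [mul_assoc]

theorem translation_mem_heckeFunctions (V : Rep.{w} R (PGL2 F)) (t' : Fˣ) (ψ : Fˣ → V)
    (hψ : ψ ∈ heckeFunctions V) : translation F R V t' ψ ∈ heckeFunctions V := by
  refine ⟨fun t => hψ.1 _, fun s t hs => ?_⟩
  change ψ (s * t * t') = heckeOp V s (ψ (t * t'))
  rw [mul_assoc, hψ.2 s _ hs]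

/-- The span of the translates of `ψ` by the powers of a uniformizer. -/
def uniformizerSpan {V : Type w} [AddCommGroup V] [Module R V] (ψ : Fˣ → V) :
    Submodule R (Fˣ → V) :=
  Submodule.span R (Set.range fun i : ℤ => translation F R V (uniformizer F ^ i) ψ)

theorem uniformizerSpan_translation {V : Type w} [AddCommGroup V] [Module R V] (ψ : Fˣ → V)
    (t : Fˣ) : uniformizerSpan (translation F R V t ψ) =
      (uniformizerSpan ψ).map (translation F R V t) := by
  rw [uniformizerSpan, uniformizerSpan, Submodule.map_span, ← Set.range_comp]
  congr 2
  ext1 i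
  change translation F R V (uniformizer F ^ i) (translation F R V t ψ) =
    translation F R V t (translation F R V (uniformizer F ^ i) ψ)
  rw [← Module.End.mul_apply, ← Module.End.mul_apply, ← map_mul, ← map_mul, mul_comm]

variable [IsNoetherianRing R]

/-- The ordinary part: the functions in `heckeFunctions` whose translates by the powers of a
uniformizer span a finitely generated module. -/
def ordinaryFunctions (V : Rep.{w} R (PGL2 F)) : Submodule R (Fˣ → V) where
  carrier := {ψ | ψ ∈ heckeFunctions V ∧ (uniformizerSpan (R := R) ψ).FG}
  add_mem' {a b} ha hb := by
    refine ⟨add_mem ha.1 hb.1, Submodule.FG.of_le (Submodule.FG.sup ha.2 hb.2) ?_⟩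
    refine Submodule.span_le.2 ?_
    rintro _ ⟨i, rfl⟩
    exact Submodule.add_mem_sup (Submodule.subset_span ⟨i, rfl⟩) (Submodule.subset_span ⟨i, rfl⟩)
  zero_mem' := by
    refine ⟨zero_mem _, ?_⟩
    have : uniformizerSpan (R := R) (0 : Fˣ → V) = ⊥ := by simp [uniformizerSpan]
    rw [this]
    exact Submodule.fg_bot
  smul_mem' c a ha := by
    refine ⟨Submodule.smul_mem _ _ ha.1, Submodule.FG.of_le ha.2 ?_⟩
    refine Submodule.span_le.2 ?_
    rintro _ ⟨i, rfl⟩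
    exact Submodule.smul_mem _ _ (Submodule.subset_span ⟨i, rfl⟩)

theorem translation_mem_ordinaryFunctions (V : Rep.{w} R (PGL2 F)) (t : Fˣ) :
    ordinaryFunctions V ≤ (ordinaryFunctions V).comap (translation F R V t) := by
  intro ψ hψ
  refine ⟨translation_mem_heckeFunctions V t ψ hψ.1, ?_⟩
  rw [uniformizerSpan_translation]
  exact hψ.2.map _

/-- The ordinary part of a representation of `PGL₂(F)`, as a representation of the torus. -/
noncomputable abbrev ordRep (V : Rep.{w} R (PGL2 F)) : Rep.{max u w} R Fˣ :=
  Rep.of (X := ordinaryFunctions V) ((translation F R V).subrepresentation (ordinaryFunctions V)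
    (translation_mem_ordinaryFunctions V))

theorem comp_mem_ordinaryFunctions {V W : Rep.{w} R (PGL2 F)} (f : V ⟶ W) (ψ : Fˣ → V)
    (hψ : ψ ∈ ordinaryFunctions V) :
    f.hom.toLinearMap.compLeft Fˣ ψ ∈ ordinaryFunctions W := by
  refine ⟨⟨fun t y hy => ?_, fun s t hs => ?_⟩, ?_⟩
  · change W.ρ (unip y) (f.hom (ψ t)) = f.hom (ψ t)
    rw [← Rep.hom_comm_apply, hψ.1.1 t y hy]
  · change f.hom (ψ (s * t)) = heckeOp W s (f.hom (ψ t))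
    rw [hψ.1.2 s t hs, heckeOp_map]
  · convert hψ.2.map (f.hom.toLinearMap.compLeft Fˣ) using 1
    rw [uniformizerSpan, uniformizerSpan, Submodule.map_span, ← Set.range_comp]
    rfl

/-- Functoriality of the ordinary part. -/
noncomputable def ordMap {V W : Rep.{w} R (PGL2 F)} (f : V ⟶ W) : ordRep V ⟶ ordRep W :=
  Rep.ofHom ⟨(f.hom.toLinearMap.compLeft Fˣ).restrict fun ψ hψ =>
    comp_mem_ordinaryFunctions f ψ hψ, fun g => by
      ext ψ t
      rfl⟩

theorem ord_stabilizer (V : Rep.{w} R (PGL2 F)) (hV : IsSmooth V) (ψ : ordinaryFunctions V) :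
    ∃ U : Subgroup Fˣ, IsOpen (U : Set Fˣ) ∧ U ≤ unitGroup F ∧
      ∀ g ∈ U, translation F R V g ψ.1 = ψ.1 := by
  obtain ⟨S, hS⟩ := ψ.2.2
  let U : Subgroup Fˣ := unitGroup F ⊓
    ⨅ φ ∈ S, (vectorStabilizer V (φ 1)).comap delta
  have hU : IsOpen (U : Set Fˣ) := by
    have h1 : (U : Set Fˣ) = (unitGroup F : Set Fˣ) ∩
        ⋂ φ ∈ S, delta ⁻¹' (vectorStabilizer V (φ 1) : Set (PGL2 F)) := by
      ext x
      simp [U]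
    rw [h1]
    exact isOpen_unitGroup.inter
      (isOpen_biInter_finset fun φ _ => (hV (φ 1)).preimage continuous_delta)
  refine ⟨U, hU, inf_le_left, fun g hg => ?_⟩
  have hfix : ∀ φ ∈ uniformizerSpan (R := R) ψ.1, V.ρ (delta g) (φ 1) = φ 1 := by
    rw [← hS]
    intro φ hφ
    induction hφ using Submodule.span_induction with
    | mem φ hφ =>
      have h2 := Subgroup.mem_iInf.1 hg.2 φ
      exact Subgroup.mem_iInf.1 h2 hφ
    | zero => exact map_zero _
    | add a b _ _ ha hb => rw [Pi.add_apply, map_add, ha, hb]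
    | smul c a _ ha => rw [Pi.smul_apply, map_smul, ha]
  have hfix' : ∀ i : ℤ, V.ρ (delta g) (ψ.1 (uniformizer F ^ i)) = ψ.1 (uniformizer F ^ i) := by
    intro i
    have h3 := hfix _ (Submodule.subset_span ⟨i, rfl⟩)
    change V.ρ (delta g) (ψ.1 (1 * uniformizer F ^ i)) = ψ.1 (1 * uniformizer F ^ i) at h3
    rwa [one_mul] at h3
  have hmul : ∀ (s t : Fˣ), s ∈ unitGroup F → ψ.1 (s * t) = V.ρ (delta s) (ψ.1 t) := by
    intro s t hs
    rw [ψ.2.1.2 s t (le_of_eq hs), heckeOp_unit V s hs _ (ψ.2.1.1 t)]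
  funext t
  change ψ.1 (t * g) = ψ.1 t
  obtain ⟨n, v, hv, rfl⟩ := exists_eq_zpow_mul t
  rw [mul_right_comm, mul_comm _ v, mul_comm _ v, hmul v _ hv, hmul v _ hv, mul_comm _ g,
    hmul g _ hg.1, hfix' n]

theorem ordRep_isLocallyAdmissible (V : Rep.{w} R (PGL2 F)) (hV : IsSmooth V) :
    IsLocallyAdmissible (ordRep V) := by
  rw [isLocallyAdmissible_iff]
  intro ψ
  obtain ⟨U, hU, hU0, hfix⟩ := ord_stabilizer V hV ψ
  constructor
  · exact isOpen_vectorStabilizer_of_le hU fun g hg => Subtype.ext (hfix g hg)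
  · change (cyclicSpan _ _).FG
    refine Submodule.fg_of_fg_map_injective (ordinaryFunctions V).subtype Subtype.val_injective ?_
    have hcompact : CompactSpace (unitGroup F) := isCompact_iff_compactSpace.1 isCompact_unitGroup
    have hfin : Finite (unitGroup F ⧸ U.subgroupOf (unitGroup F)) :=
      Subgroup.quotient_finite_of_isOpen _ (hU.preimage continuous_subtype_val)
    have hFG : (⨆ q : unitGroup F ⧸ U.subgroupOf (unitGroup F),
        (uniformizerSpan ψ.1).map (translation F R V (q.out : Fˣ))).FG :=
      Submodule.fg_iSup _ fun q => ψ.2.2.map _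
    refine hFG.of_le ?_
    rw [cyclicSpan, Submodule.map_span, Submodule.span_le]
    rintro _ ⟨_, ⟨g, rfl⟩, rfl⟩
    obtain ⟨n, v, hv, rfl⟩ := exists_eq_zpow_mul g
    let q : unitGroup F ⧸ U.subgroupOf (unitGroup F) := QuotientGroup.mk ⟨v, hv⟩
    have hq : ((q.out : unitGroup F) : Fˣ)⁻¹ * v ∈ U := by
      have := QuotientGroup.eq.1 (QuotientGroup.out_eq' q)
      exact this
    refine Submodule.mem_iSup_of_mem q ⟨translation F R V (uniformizer F ^ n) ψ.1,
      Submodule.subset_span ⟨n, rfl⟩, ?_⟩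
    change translation F R V _ _ = translation F R V (uniformizer F ^ n * v) ψ.1
    have h1 : uniformizer F ^ n * v = (q.out : Fˣ) * uniformizer F ^ n * ((q.out : Fˣ)⁻¹ * v) := by
      rw [mul_comm (q.out : Fˣ), mul_assoc, mul_inv_cancel_left]
    rw [h1, map_mul, map_mul, Module.End.mul_apply, Module.End.mul_apply, hfix _ hq]

end Ord

section OrdFunctor

variable (F : Type u) [NontriviallyNormedField F] [IsUltrametricDist F] [ProperSpace F]
  (R : Type (u + 1)) [CommRing R] [IsNoetherianRing R]

/-- The functor of ordinary parts from smooth representations of `PGL₂(F)` to locally admissible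
representations of the torus. -/
noncomputable def ordFunctor : SmRep.{u, u + 1, u + 1} R (PGL2 F) ⥤ LAdmRep.{u, u + 1, u + 1} R Fˣ where
  obj V := ⟨ordRep V.obj, ordRep_isLocallyAdmissible V.obj V.property⟩
  map f := ObjectProperty.homMk (ordMap f.hom)

instance : (ordFunctor F R).Additive where
  map_add {V W f g} := by
    ext : 1
    rfl

variable {F}

/-- The functor `Ord^H`: the `H`-invariants of the ordinary part. -/
noncomputable def ordH (H : Subgroup Fˣ) :
    SmRep.{u, u + 1, u + 1} R (PGL2 F) ⥤ LAdmRep.{u, u + 1, u + 1} R (QuotBy H) :=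
  ordFunctor F R ⋙ invariantsLAdm R H

instance (H : Subgroup Fˣ) : (ordH R H).Additive := by
  unfold ordH
  infer_instance

end OrdFunctor

instance (R : Type (u + 1)) [CommRing R] (G : Type u) [Group G] :
    EnoughInjectives (Rep.{u + 1} R G) :=
  VectorCondition.enoughInjectives_rep.{u, u + 1, u + 1} (k := R) (G := G)

/-! ### Parabolic induction -/

section Ind

variable {F : Type u} [NontriviallyNormedField F] {R : Type v} [CommRing R] {H : Subgroup Fˣ}

/-- The functions `Φ` on `PGL₂(F)` with values in `W` for which there is an open subgroup `U` with
`Φ (t n g k) = t Φ(g)` for `t` in the torus, `n` in the unipotent group and `k` in `U`. -/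
def inducedFunctions (W : Rep.{w} R (QuotBy H)) : Submodule R (PGL2 F → W) where
  carrier := {Φ | ∃ U : Subgroup (PGL2 F), IsOpen (U : Set (PGL2 F)) ∧
    ∀ (t : Fˣ) (y : F) (g k : PGL2 F), k ∈ U →
      Φ (delta t * unip y * g * k) = W.ρ (QuotBy.mk H t) (Φ g)}
  add_mem' := by
    rintro a b ⟨U, hU, ha⟩ ⟨U', hU', hb⟩
    refine ⟨U ⊓ U', hU.inter hU', fun t y g k hk => ?_⟩
    rw [Pi.add_apply, Pi.add_apply, map_add, ha t y g k hk.1, hb t y g k hk.2]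
  zero_mem' := ⟨⊤, isOpen_univ, fun t y g k _ => by
    rw [Pi.zero_apply, Pi.zero_apply, map_zero]⟩
  smul_mem' := by
    rintro c a ⟨U, hU, ha⟩
    refine ⟨U, hU, fun t y g k hk => ?_⟩
    rw [Pi.smul_apply, Pi.smul_apply, map_smul, ha t y g k hk]

/-- The action of a group on functions by right translation. -/
def rightTranslation (G : Type u) [Group G] (R : Type v) [CommRing R] (V : Type w)
    [AddCommGroup V] [Module R V] : Representation R G (G → V) where
  toFun h := { toFun := fun Φ g => Φ (g * h), map_add' := fun _ _ => rfl,
               map_smul' := fun _ _ => rfl }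
  map_one' := by
    ext Φ g
    exact congr_arg _ (mul_one g)
  map_mul' a b := by
    ext Φ g
    change Φ (g * (a * b)) = Φ (g * a * b)
    rw [mul_assoc]

theorem rightTranslation_mem (W : Rep.{w} R (QuotBy H)) (h : PGL2 F) :
    inducedFunctions W ≤ (inducedFunctions W).comap (rightTranslation (PGL2 F) R W h) := by
  rintro Φ ⟨U, hU, hΦ⟩
  refine ⟨U.comap (MulAut.conj h⁻¹).toMonoidHom, ?_, fun t y g k hk => ?_⟩
  · refine hU.preimage ?_
    change Continuous fun g => h⁻¹ * g * h⁻¹⁻¹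
    fun_prop
  · have hk' : h⁻¹ * k * h ∈ U := by simpa using hk
    change Φ (delta t * unip y * g * k * h) = W.ρ (QuotBy.mk H t) (Φ (g * h))
    rw [← hΦ t y (g * h) _ hk']
    congr 1
    group

/-- The parabolically induced representation. -/
noncomputable abbrev indRep (W : Rep.{w} R (QuotBy H)) : Rep.{max u w} R (PGL2 F) :=
  Rep.of (X := inducedFunctions W) ((rightTranslation (PGL2 F) R W).subrepresentation
    (inducedFunctions W) (rightTranslation_mem W))

theorem indRep_isSmooth (W : Rep.{w} R (QuotBy H)) : IsSmooth (indRep W) := by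
  rintro ⟨Φ, U, hU, hΦ⟩
  refine isOpen_vectorStabilizer_of_le hU fun h hh => Subtype.ext (funext fun g => ?_)
  have h1 := hΦ 1 0 g h hh
  have h2 : delta (1 : Fˣ) * unip (0 : F) = 1 := by
    refine congr_arg (QuotientGroup.mk (s := Subgroup.center (Matrix.GeneralLinearGroup (Fin 2) F)))
      (Units.ext ?_)
    simp [Matrix.one_fin_two]
  rw [h2, one_mul, map_one, map_one] at h1
  exact h1

theorem comp_mem_inducedFunctions {V W : Rep.{w} R (QuotBy H)} (f : V ⟶ W) (Φ : PGL2 F → V)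
    (hΦ : Φ ∈ inducedFunctions V) :
    f.hom.toLinearMap.compLeft (PGL2 F) Φ ∈ inducedFunctions W := by
  obtain ⟨U, hU, hΦ⟩ := hΦ
  refine ⟨U, hU, fun t y g k hk => ?_⟩
  change f.hom (Φ _) = W.ρ _ (f.hom (Φ g))
  rw [hΦ t y g k hk, Rep.hom_comm_apply]

/-- Functoriality of parabolic induction. -/
noncomputable def indMap {V W : Rep.{w} R (QuotBy H)} (f : V ⟶ W) : indRep V ⟶ indRep W :=
  Rep.ofHom ⟨(f.hom.toLinearMap.compLeft (PGL2 F)).restrict fun Φ hΦ =>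
    comp_mem_inducedFunctions f Φ hΦ, fun g => by
      ext Φ t
      rfl⟩

end Ind

section IndFunctor

variable {F : Type u} [NontriviallyNormedField F] (R : Type (u + 1)) [CommRing R] (H : Subgroup Fˣ)

/-- Parabolic induction from smooth representations of `T/H` to smooth representations of
`PGL₂(F)`. -/
noncomputable def indFunctor :
    SmRep.{u, u + 1, u + 1} R (QuotBy H) ⥤ SmRep.{u, u + 1, u + 1} R (PGL2 F) where
  obj W := ⟨indRep W.obj, indRep_isSmooth W.obj⟩
  map f := ObjectProperty.homMk (indMap f.hom)

instance : (indFunctor R H).Additive where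
  map_add {V W f g} := by
    ext : 1
    rfl

end IndFunctor

/-! ### The twist by inversion, completed group rings, and spaces of homomorphisms -/

section Aug

variable {k : Type v} [CommRing k] {G : Type u} [CommGroup G] [TopologicalSpace G]
  [IsTopologicalGroup G]

theorem twist_isSmooth (V : Rep.{w} k G) (hV : IsSmooth V) :
    IsSmooth ((Rep.resFunctor (invMonoidHom : G →* G)).obj V) :=
  fun x => (hV x).preimage continuous_inv

variable (k G) in
/-- The functor `W ↦ W^ι`: the same module, on which `t` acts as `t⁻¹` acts on `W`. -/
noncomputable def twist : SmRep.{u, v, w} k G ⥤ SmRep.{u, v, w} k G where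
  obj V := ⟨(Rep.resFunctor (invMonoidHom : G →* G)).obj V.obj, twist_isSmooth V.obj V.property⟩
  map f := ObjectProperty.homMk ((Rep.resFunctor (invMonoidHom : G →* G)).map f.hom)

instance : (twist.{u, v, w} k G).Additive where
  map_add {V W f g} := by
    ext : 1
    exact (Rep.resFunctor (invMonoidHom : G →* G)).map_add

variable (G) in
/-- The compact open subgroups. -/
def CompactOpen := {U : Subgroup G // IsOpen (U : Set G) ∧ IsCompact (U : Set G)}

variable (k G) in
/-- The completed group ring: the projective limit of the group rings `k[G/U]` over all compact
open subgroups `U`, realized as a ring of compatible families. -/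
def completedGroupRing : Subring (∀ U : CompactOpen G, MonoidAlgebra k (QuotBy U.1)) where
  carrier := {a | ∀ (U U' : CompactOpen G) (hU : U.1 ≤ U'.1),
    MonoidAlgebra.mapDomainRingHom k (QuotBy.proj hU) (a U) = a U'}
  mul_mem' ha hb U U' hU := by
    rw [Pi.mul_apply, Pi.mul_apply, map_mul, ha U U' hU, hb U U' hU]
  one_mem' U U' hU := map_one _
  add_mem' ha hb U U' hU := by
    rw [Pi.add_apply, Pi.add_apply, map_add, ha U U' hU, hb U U' hU]
  zero_mem' U U' hU := map_zero _
  neg_mem' ha U U' hU := by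
    rw [Pi.neg_apply, Pi.neg_apply, map_neg, ha U U' hU]

variable (k G) in
/-- The completed group ring as a type. -/
abbrev Lambda := completedGroupRing k G

variable (W : Rep.{w} k G)

/-- The action of `k[G/U]` on the `U`-invariants of `W`. -/
noncomputable def levelAct (U : Subgroup G) :
    MonoidAlgebra k (QuotBy U) →ₐ[k] Module.End k (fixedVectors W U) :=
  Representation.asAlgebraHom (invariantsRep U W).ρ

theorem levelAct_single (U : Subgroup G) (g : G) (r : k) (x : fixedVectors W U) :
    (levelAct W U (MonoidAlgebra.single (QuotBy.mk U g) r) x : W) = r • W.ρ g x := by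
  rw [levelAct, Representation.asAlgebraHom_single]
  rfl

theorem levelAct_compat {U U' : Subgroup G} (hU : U ≤ U') (x : W) (hx : x ∈ fixedVectors W U)
    (hx' : x ∈ fixedVectors W U') (a : MonoidAlgebra k (QuotBy U)) :
    (levelAct W U a ⟨x, hx⟩ : W) =
      levelAct W U' (MonoidAlgebra.mapDomainRingHom k (QuotBy.proj hU) a) ⟨x, hx'⟩ := by
  induction a using MonoidAlgebra.induction_linear with
  | zero => rw [map_zero, map_zero, map_zero]; rfl
  | add a b ha hb =>
    rw [map_add, map_add, map_add, LinearMap.add_apply, LinearMap.add_apply, Submodule.coe_add,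
      Submodule.coe_add, ha, hb]
  | single g r =>
    obtain ⟨g, rfl⟩ := QuotBy.mk_surjective U g
    rw [levelAct_single, MonoidAlgebra.mapDomainRingHom_apply, MonoidAlgebra.mapDomain_single,
      QuotBy.proj_mk, levelAct_single]

variable (G) in
/-- The group has a compact open subgroup. -/
class HasCompactOpen : Prop where
  nonempty : Nonempty (CompactOpen G)

theorem exists_compactOpen_le [HasCompactOpen G] (S : Subgroup G) (hS : IsOpen (S : Set G)) :
    ∃ U : CompactOpen G, U.1 ≤ S := by
  obtain ⟨U⟩ := HasCompactOpen.nonempty (G := G)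
  refine ⟨⟨S ⊓ U.1, hS.inter U.2.1, ?_⟩, inf_le_left⟩
  exact U.2.2.inter_left (Subgroup.isClosed_of_isOpen S hS)

section Act

variable [HasCompactOpen G] (hW : IsSmooth W)

/-- The action of the completed group ring on a smooth representation: an element `a` acts on a
vector fixed by a compact open subgroup `U` through its component in `k[G/U]`. -/
noncomputable def lambdaAct (a : Lambda k G) (x : W) : W :=
  levelAct W (exists_compactOpen_le _ (hW x)).choose.1
    (a.1 (exists_compactOpen_le _ (hW x)).choose)
      ⟨x, (exists_compactOpen_le _ (hW x)).choose_spec⟩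

theorem lambdaAct_eq (a : Lambda k G) (x : W) (U : CompactOpen G)
    (hx : x ∈ fixedVectors W U.1) :
    lambdaAct W hW a x = levelAct W U.1 (a.1 U) ⟨x, hx⟩ := by
  obtain ⟨V, hV⟩ := exists_compactOpen_le _ (hW x)
  set U' := (exists_compactOpen_le _ (hW x)).choose with hU'
  have hx' : x ∈ fixedVectors W U'.1 := (exists_compactOpen_le _ (hW x)).choose_spec
  obtain ⟨U'', h⟩ := exists_compactOpen_le (U.1 ⊓ U'.1) (U.2.1.inter U'.2.1)
  have hx'' : x ∈ fixedVectors W U''.1 := fun g hg => hx g (h hg).1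
  have h1 := levelAct_compat W (h.trans inf_le_left) x hx'' hx (a.1 U'')
  have h2 := levelAct_compat W (h.trans inf_le_right) x hx'' hx' (a.1 U'')
  rw [a.2 U'' U (h.trans inf_le_left)] at h1
  rw [a.2 U'' U' (h.trans inf_le_right)] at h2
  exact h2.symm.trans h1

theorem lambdaAct_add (a : Lambda k G) (x y : W) :
    lambdaAct W hW a (x + y) = lambdaAct W hW a x + lambdaAct W hW a y := by
  obtain ⟨U, hU⟩ := exists_compactOpen_le (vectorStabilizer W x ⊓ vectorStabilizer W y)
    ((hW x).inter (hW y))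
  have hx : x ∈ fixedVectors W U.1 := fun g hg => (hU hg).1
  have hy : y ∈ fixedVectors W U.1 := fun g hg => (hU hg).2
  rw [lambdaAct_eq W hW a x U hx, lambdaAct_eq W hW a y U hy,
    lambdaAct_eq W hW a (x + y) U (add_mem hx hy), ← Submodule.coe_add, ← map_add]
  rfl

theorem lambdaAct_smul (a : Lambda k G) (c : k) (x : W) :
    lambdaAct W hW a (c • x) = c • lambdaAct W hW a x := by
  obtain ⟨U, hU⟩ := exists_compactOpen_le (vectorStabilizer W x) (hW x)
  have hx : x ∈ fixedVectors W U.1 := hU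
  rw [lambdaAct_eq W hW a x U hx, lambdaAct_eq W hW a (c • x) U (Submodule.smul_mem _ c hx),
    ← Submodule.coe_smul, ← map_smul]
  rfl

theorem lambdaAct_act (a : Lambda k G) (g : G) (x : W) :
    lambdaAct W hW a (W.ρ g x) = W.ρ g (lambdaAct W hW a x) := by
  obtain ⟨U, hU⟩ := exists_compactOpen_le (vectorStabilizer W x) (hW x)
  have hx : x ∈ fixedVectors W U.1 := hU
  rw [lambdaAct_eq W hW a x U hx, lambdaAct_eq W hW a (W.ρ g x) U (fixedVectors_stable W U.1 g hx)]
  have h1 : ∀ z : fixedVectors W U.1, (levelAct W U.1 (MonoidAlgebra.single (QuotBy.mk U.1 g) 1) z : W) =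
      W.ρ g z := fun z => by rw [levelAct_single, one_smul]
  rw [← h1]
  have h2 : (⟨W.ρ g x, fixedVectors_stable W U.1 g hx⟩ : fixedVectors W U.1) =
      levelAct W U.1 (MonoidAlgebra.single (QuotBy.mk U.1 g) 1) ⟨x, hx⟩ := Subtype.ext (h1 ⟨x, hx⟩).symm
  rw [h2, ← Module.End.mul_apply, ← Module.End.mul_apply, ← map_mul, ← map_mul, mul_comm]

theorem lambdaAct_mul (a b : Lambda k G) (x : W) :
    lambdaAct W hW (a * b) x = lambdaAct W hW a (lambdaAct W hW b x) := by
  obtain ⟨U, hU⟩ := exists_compactOpen_le (vectorStabilizer W x) (hW x)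
  have hx : x ∈ fixedVectors W U.1 := hU
  rw [lambdaAct_eq W hW b x U hx, lambdaAct_eq W hW (a * b) x U hx,
    lambdaAct_eq W hW a _ U (levelAct W U.1 (b.1 U) ⟨x, hx⟩).2]
  change (levelAct W U.1 (a.1 U * b.1 U) ⟨x, hx⟩ : W) = _
  rw [map_mul, Module.End.mul_apply]

theorem lambdaAct_one (x : W) : lambdaAct W hW 1 x = x := by
  obtain ⟨U, hU⟩ := exists_compactOpen_le (vectorStabilizer W x) (hW x)
  have hx : x ∈ fixedVectors W U.1 := hU
  rw [lambdaAct_eq W hW 1 x U hx]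
  change (levelAct W U.1 1 ⟨x, hx⟩ : W) = x
  rw [map_one]
  rfl

theorem lambdaAct_add_left (a b : Lambda k G) (x : W) :
    lambdaAct W hW (a + b) x = lambdaAct W hW a x + lambdaAct W hW b x := by
  obtain ⟨U, hU⟩ := exists_compactOpen_le (vectorStabilizer W x) (hW x)
  have hx : x ∈ fixedVectors W U.1 := hU
  rw [lambdaAct_eq W hW a x U hx, lambdaAct_eq W hW b x U hx, lambdaAct_eq W hW (a + b) x U hx]
  change (levelAct W U.1 (a.1 U + b.1 U) ⟨x, hx⟩ : W) = _
  rw [map_add]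
  rfl

/-- The endomorphism of a smooth representation given by an element of the completed group ring. -/
noncomputable def lambdaHom (W : SmRep.{u, v, w} k G) (a : Lambda k G) : W ⟶ W :=
  ObjectProperty.homMk (Rep.ofHom
    ⟨{ toFun := lambdaAct W.obj W.property a
       map_add' := lambdaAct_add W.obj W.property a
       map_smul' := lambdaAct_smul W.obj W.property a },
      fun g => LinearMap.ext fun x => lambdaAct_act W.obj W.property a g x⟩)

/-- The homomorphism from the completed group ring to the endomorphisms of a smooth
representation. -/
noncomputable def lambdaEnd (W : SmRep.{u, v, w} k G) : Lambda k G →+* End W where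
  toFun a := lambdaHom W a
  map_one' := by
    refine ObjectProperty.hom_ext _ (Rep.hom_ext ?_)
    ext x
    exact lambdaAct_one W.obj W.property x
  map_mul' a b := by
    refine ObjectProperty.hom_ext _ (Rep.hom_ext ?_)
    ext x
    exact lambdaAct_mul W.obj W.property a b x
  map_zero' := by
    refine ObjectProperty.hom_ext _ (Rep.hom_ext ?_)
    ext x
    change lambdaAct W.obj W.property 0 x = 0
    have := lambdaAct_add_left W.obj W.property 0 0 x
    rw [add_zero] at this
    simpa using this
  map_add' a b := by
    refine ObjectProperty.hom_ext _ (Rep.hom_ext ?_)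
    ext x
    exact lambdaAct_add_left W.obj W.property a b x

end Act

end Aug

section Hom

variable {k : Type v} [CommRing k] {G : Type u} [CommGroup G] [TopologicalSpace G]
  [IsTopologicalGroup G] [HasCompactOpen G]

variable {C : Type*} [Category* C] [Preadditive C]

/-- The ring homomorphism between endomorphism rings given by an additive functor. -/
def mapEndRing {D : Type*} [Category* D] [Preadditive D] (T : D ⥤ C) [T.Additive] (W : D) :
    End W →+* End (T.obj W) where
  __ := Functor.mapEnd W T
  map_zero' := T.map_zero W W
  map_add' _ _ := T.map_add

/-- For an additive functor `T` on smooth representations, the functor `Hom(T(W), -)` with values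
in modules over the completed group ring, which acts through its action on `W`. -/
noncomputable def homFunctor (T : SmRep.{u, v, w} k G ⥤ C) [T.Additive] (W : SmRep.{u, v, w} k G) :
    C ⥤ ModuleCat (Lambda k G) :=
  preadditiveCoyonedaObj (T.obj W) ⋙ ModuleCat.restrictScalars
    (RingHom.toOpposite ((mapEndRing T W).comp (lambdaEnd W))
      fun a b => (Commute.all a b).map ((mapEndRing T W).comp (lambdaEnd W)))

instance (T : SmRep.{u, v, w} k G ⥤ C) [T.Additive] (W : SmRep.{u, v, w} k G) :
    (homFunctor T W).Additive := by
  unfold homFunctor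
  infer_instance

end Hom

theorem hasCompactOpen_quotBy {F : Type u} [NontriviallyNormedField F] [IsUltrametricDist F]
    [ProperSpace F] (H : Subgroup Fˣ) : HasCompactOpen (QuotBy H) where
  nonempty := ⟨⟨(unitGroup F).map (QuotBy.mk H),
    QuotientGroup.isOpenMap_coe _ isOpen_unitGroup,
    isCompact_unitGroup.image continuous_quotient_mk'⟩⟩

instance {F : Type u} [NontriviallyNormedField F] [IsUltrametricDist F]
    [ProperSpace F] (H : Subgroup Fˣ) : HasCompactOpen (QuotBy H) := hasCompactOpen_quotBy H

/-! ### Spectral sequences -/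

section SpectralSequence

variable {C : Type u} [Category.{v} C] [Abelian C]

/-- Convergence of a first quadrant spectral sequence `E` to the objects `A n`: a decreasing
filtration of each `A n` of length `n + 1` whose graded pieces are the entries of the page at
infinity. The page `p + q + 2` has reached its limit value at the position `(p, q)`. -/
structure SpectralConvergence (E : E₂CohomologicalSpectralSequenceNat C) (A : ℕ → C) where
  fil (n p : ℕ) : Subobject (A n)
  antitone (n : ℕ) : Antitone (fil n)
  fil_zero (n : ℕ) : fil n 0 = ⊤
  fil_succ (n : ℕ) : fil n (n + 1) = ⊥
  graded (p q : ℕ) :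
    cokernel ((fil (p + q) (p + 1)).ofLE (fil (p + q) p) (antitone (p + q) p.le_succ)) ≅
      (E.page ((p : ℤ) + q + 2) (by lia)).X (p, q)

/-- There is a spectral sequence with second page `E₂` converging to `A`. -/
def HasSpectralSequence (E₂ : ℕ → ℕ → C) (A : ℕ → C) : Prop :=
  ∃ E : E₂CohomologicalSpectralSequenceNat C,
    (∀ r s : ℕ, Nonempty ((E.page 2).X (r, s) ≅ E₂ r s)) ∧ Nonempty (SpectralConvergence E A)

end SpectralSequence

/-! ### Derived functors of composites with exact functors -/

section Derived

variable {A B C : Type*} [Category* A] [Category* B] [Category* C] [Abelian A] [Abelian B]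
  [Abelian C] [HasInjectiveResolutions A]

/-- Right derived functors commute with postcomposition by an exact functor. -/
noncomputable def rightDerivedCompIso (S : A ⥤ B) [S.Additive] (T : B ⥤ C) [T.Additive]
    [T.PreservesHomology] (n : ℕ) (Z : A) :
    ((S ⋙ T).rightDerived n).obj Z ≅ T.obj ((S.rightDerived n).obj Z) :=
  (injectiveResolution Z).isoRightDerivedObj (S ⋙ T) n ≪≫
    ShortComplex.mapHomologyIso
      (((S.mapHomologicalComplex _).obj (injectiveResolution Z).cocomplex).sc n) T ≪≫
    T.mapIso ((injectiveResolution Z).isoRightDerivedObj S n).symm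

end Derived

section Inflation

variable {G : Type u} [CommGroup G] [TopologicalSpace G] [IsTopologicalGroup G]
  {k : Type v} [CommRing k] [IsNoetherianRing k]

theorem preservesHomology_ι :
    (IsLocallyAdmissible : ObjectProperty (Rep.{w} k G)).ι.PreservesHomology where
  preservesKernels X Y f :=
    have := (ladmCondition k G).subobjects _ isLocallyAdmissible_iff
    ObjectProperty.preservesKernels_ι _ f
  preservesCokernels X Y f :=
    have := (ladmCondition k G).quotients _ isLocallyAdmissible_iff
    ObjectProperty.preservesCokernels_ι _ f

theorem forget_preservesHomology (G : Type u) [Group G] :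
    (forget₂ (Rep.{w} k G) (ModuleCat.{w} k)).PreservesHomology := inferInstance

theorem exact_iff_forget (S : ShortComplex (LAdmRep.{u, v, w} k G)) :
    S.Exact ↔ ((S.map (IsLocallyAdmissible : ObjectProperty (Rep.{w} k G)).ι).map
      (forget₂ (Rep.{w} k G) (ModuleCat.{w} k))).Exact := by
  have := preservesHomology_ι (k := k) (G := G)
  have := forget_preservesHomology (k := k) G
  rw [ShortComplex.exact_map_iff_of_faithful, ShortComplex.exact_map_iff_of_faithful]

instance {H U : Subgroup G} (hHU : H ≤ U) : (inflation.{u, v, w} k hHU).PreservesHomology :=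
  Functor.preservesHomology_of_map_exact _ fun S hS =>
    (exact_iff_forget _).2 ((exact_iff_forget S).1 hS)

variable (k) in
/-- The inclusion of the `U`-invariants in the `U'`-invariants, for `U' ≤ U`, as representations of
`G/H` with `H ≤ U'`. -/
noncomputable def invariantsInclusion {H U U' : Subgroup G} (h' : H ≤ U') (hU : U' ≤ U) :
    invariantsLAdm.{u, v, w} k U ⋙ inflation k (h'.trans hU) ⟶
      invariantsLAdm k U' ⋙ inflation k h' where
  app V := ObjectProperty.homMk (Rep.ofHom ⟨Submodule.inclusion
    fun x hx g hg => hx g (hU hg), fun g => by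
      obtain ⟨g, rfl⟩ := QuotBy.mk_surjective H g
      ext x
      rfl⟩)
  naturality V W f := by
    ext x
    rfl

variable (k) in
/-- The inclusion of the `U`-invariants in the `H`-invariants, for `H ≤ U`, as representations of
`G/H`. -/
noncomputable def invariantsInclusionTop {H U : Subgroup G} (hU : H ≤ U) :
    invariantsLAdm.{u, v, w} k U ⋙ inflation k hU ⟶ invariantsLAdm k H where
  app V := ObjectProperty.homMk (Rep.ofHom ⟨Submodule.inclusion
    fun x hx g hg => hx g (hU hg), fun g => by
      obtain ⟨g, rfl⟩ := QuotBy.mk_surjective H g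
      ext x
      rfl⟩)
  naturality V W f := by
    ext x
    rfl

end Inflation

/-! ### Ordinary cohomology -/

section OrdCohomology

variable {F : Type u} [NontriviallyNormedField F] [IsUltrametricDist F] [ProperSpace F]
  {𝒦 : Set (Subgroup (PGL2 F))} (h : IsGoodFamily 𝒦) (X : GSetCat 𝒦 ⥤ LHSpace.{u})
  (R : Type (u + 1)) [CommRing R] [IsNoetherianRing R]

/-- The functor `𝓕 ↦ Ord^H (H⁰(X_∞, 𝓕))`. -/
noncomputable def ordSheaf (H : Subgroup Fˣ) : Sh X R ⥤ LAdmRep.{u, u + 1, u + 1} R (QuotBy H) :=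
  H0Infinity h X R ⋙ ordH R H

instance (H : Subgroup Fˣ) : (ordSheaf h X R H).Additive := by
  unfold ordSheaf
  infer_instance

/-- The `n`-th ordinary cohomology, the `n`-th right derived functor of `ordSheaf`. -/
noncomputable def ordCohomology (H : Subgroup Fˣ) (n : ℕ) :
    Sh X R ⥤ LAdmRep.{u, u + 1, u + 1} R (QuotBy H) :=
  (ordSheaf h X R H).rightDerived n

/-- The cohomology of `X_∞`: the right derived functors of `H⁰(X_∞, -)`. -/
noncomputable def cohomologyInfinity (n : ℕ) : Sh X R ⥤ SmRep.{u, u + 1, u + 1} R (PGL2 F) :=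
  (H0Infinity h X R).rightDerived n

/-- The right derived functors of `Ord^H`. -/
noncomputable def derivedOrd (H : Subgroup Fˣ) (n : ℕ) :
    SmRep.{u, u + 1, u + 1} R (PGL2 F) ⥤ LAdmRep.{u, u + 1, u + 1} R (QuotBy H) :=
  (ordH R H).rightDerived n

variable {R} in
/-- The smooth representation underlying a locally admissible one. -/
noncomputable abbrev LAdmRep.toSm {H : Subgroup Fˣ} (W : LAdmRep.{u, u + 1, u + 1} R (QuotBy H)) :
    SmRep.{u, u + 1, u + 1} R (QuotBy H) :=
  (ObjectProperty.ιOfLE isLocallyAdmissible_le_isSmooth).obj W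

variable {R} in
/-- The groups `Ext^n(W^ι, -)` on smooth representations of `T/H`, as modules over the completed
group ring: the right derived functors of `Hom(W^ι, -)`. -/
noncomputable def extTwist {H : Subgroup Fˣ} (W : SmRep.{u, u + 1, u + 1} R (QuotBy H)) (n : ℕ) :
    SmRep.{u, u + 1, u + 1} R (QuotBy H) ⥤ ModuleCat.{u + 1} (Lambda R (QuotBy H)) :=
  (homFunctor (twist R (QuotBy H)) W).rightDerived n

variable {R} in
/-- The cohomology of `X` with coefficients in the parabolically induced representation of `W`, as
modules over the completed group ring of `T/H`: the right derived functors of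
`𝓕 ↦ Hom(Ind W, H⁰(X_∞, 𝓕))`. -/
noncomputable def indCohomology {H : Subgroup Fˣ} (W : SmRep.{u, u + 1, u + 1} R (QuotBy H))
    (n : ℕ) : Sh X R ⥤ ModuleCat.{u + 1} (Lambda R (QuotBy H)) :=
  (H0Infinity h X R ⋙ homFunctor (indFunctor R H) W).rightDerived n

/-- The open subgroups `U` of the unit group that contain `H`, ordered by reverse inclusion. -/
abbrev OpenAbove (H : Subgroup Fˣ) :=
  {U : Subgroup Fˣ // IsOpen (U : Set Fˣ) ∧ H ≤ U ∧ U ≤ unitGroup F}ᵒᵈ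

namespace OpenAbove

variable {H : Subgroup Fˣ}

/-- The underlying subgroup. -/
abbrev group (U : OpenAbove H) : Subgroup Fˣ := (OrderDual.ofDual U).1

theorem le_group (U : OpenAbove H) : H ≤ U.group := (OrderDual.ofDual U).2.2.1

/-- The functor `Ord^U (H⁰(X_∞, -))`, with values in representations of `T/H`. -/
noncomputable abbrev fn (U : OpenAbove H) : Sh X R ⥤ LAdmRep.{u, u + 1, u + 1} R (QuotBy H) :=
  ordSheaf h X R U.group ⋙ inflation R U.le_group

/-- The inclusions `Ord^U ⊆ Ord^U'` for `U' ≤ U`. -/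
noncomputable def trans {U U' : OpenAbove H} (hU : U ≤ U') : U.fn h X R ⟶ U'.fn h X R :=
  Functor.whiskerLeft (H0Infinity h X R ⋙ ordFunctor F R)
    (invariantsInclusion R U'.le_group (show U'.group ≤ U.group from hU))

/-- The inclusions `Ord^U ⊆ Ord^H` for `H ≤ U`. -/
noncomputable def transTop (U : OpenAbove H) : U.fn h X R ⟶ ordSheaf h X R H :=
  Functor.whiskerLeft (H0Infinity h X R ⋙ ordFunctor F R) (invariantsInclusionTop R U.le_group)

theorem trans_self (U : OpenAbove H) : trans h X R (le_refl U) = 𝟙 _ := by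
  ext
  rfl

theorem trans_comp {U U' U'' : OpenAbove H} (hU : U ≤ U') (hU' : U' ≤ U'') :
    trans h X R hU ≫ trans h X R hU' = trans h X R (hU.trans hU') := by
  ext
  rfl

theorem trans_transTop {U U' : OpenAbove H} (hU : U ≤ U') :
    trans h X R hU ≫ U'.transTop h X R = U.transTop h X R := by
  ext
  rfl

variable {X R} (𝓕 : Sh X R) (n : ℕ)

/-- Inflation to representations of `T/H` commutes with passing to derived functors. -/
noncomputable def derivedIso (U : OpenAbove H) : ((U.fn h X R).rightDerived n).obj 𝓕 ≅
    (inflation R U.le_group).obj ((ordCohomology h X R U.group n).obj 𝓕) :=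
  rightDerivedCompIso (ordSheaf h X R U.group) (inflation R U.le_group) n 𝓕

end OpenAbove

variable {X R} (𝓕 : Sh X R) (n : ℕ) (H : Subgroup Fˣ)

/-- The direct system `U ↦ Ord^{U,n}(X, 𝓕)` of representations of `T/H`, with the transition maps
induced by the inclusions `Ord^U ⊆ Ord^U'`. -/
noncomputable def ordSystem : OpenAbove H ⥤ LAdmRep.{u, u + 1, u + 1} R (QuotBy H) where
  obj U := (inflation R U.le_group).obj ((ordCohomology h X R U.group n).obj 𝓕)
  map {U U'} f := (U.derivedIso h 𝓕 n).inv ≫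
    (NatTrans.rightDerived (OpenAbove.trans h X R (leOfHom f)) n).app 𝓕 ≫
      (U'.derivedIso h 𝓕 n).hom
  map_id U := by
    rw [OpenAbove.trans_self, NatTrans.rightDerived_id, NatTrans.id_app, Category.id_comp,
      Iso.inv_hom_id]
  map_comp {U U' U''} f g := by
    rw [← OpenAbove.trans_comp h X R (leOfHom f) (leOfHom g), NatTrans.rightDerived_comp,
      NatTrans.comp_app]
    simp only [Category.assoc, Iso.hom_inv_id_assoc]

/-- The cocone of the natural maps `Ord^{U,n}(X, 𝓕) → Ord^{H,n}(X, 𝓕)`. -/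
noncomputable def ordCocone : Cocone (ordSystem h 𝓕 n H) where
  pt := (ordCohomology h X R H n).obj 𝓕
  ι :=
    { app := fun U => (U.derivedIso h 𝓕 n).inv ≫
        (NatTrans.rightDerived (U.transTop h X R) n).app 𝓕
      naturality := fun U U' f => by
        change ((U.derivedIso h 𝓕 n).inv ≫ _ ≫ (U'.derivedIso h 𝓕 n).hom) ≫
          (U'.derivedIso h 𝓕 n).inv ≫ _ = (_ ≫ _) ≫ 𝟙 _
        rw [← OpenAbove.trans_transTop h X R (leOfHom f), NatTrans.rightDerived_comp,
          NatTrans.comp_app]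
        simp only [Category.assoc, Category.comp_id]
        congr 2
        exact Iso.hom_inv_id_assoc (U'.derivedIso h 𝓕 n) _ }

end OrdCohomology

end OrdCoh

open OrdCoh

namespace OrdCoh

/-! ### First quadrant spectral objects converge -/

section SpectralObjectConvergence

open ComposableArrows Abelian

variable {C : Type u} [Category.{v} C] [Abelian C]

/-- The cokernel of the inclusion of an image into a larger one. -/
noncomputable def cokernelImageOfLEIso {A₁ B D A E : C} (a : A₁ ⟶ B) (d : D ⟶ B) (b : B ⟶ A)
    (e : B ⟶ E) [Epi e] (w : d ≫ b = 0) (hb : (ShortComplex.mk d b w).Exact)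
    (w' : biprod.desc a d ≫ e = 0) (he : (ShortComplex.mk (biprod.desc a d) e w').Exact)
    (h : imageSubobject (a ≫ b) ≤ imageSubobject b) :
    cokernel ((imageSubobject (a ≫ b)).ofLE (imageSubobject b) h) ≅ E := by
  have wae : a ≫ e = 0 := by simpa using biprod.inl ≫= w'
  have wde : d ≫ e = 0 := by simpa using biprod.inr ≫= w'
  have hw : d ≫ factorThruImageSubobject b = 0 := by
    rw [← cancel_mono (imageSubobject b).arrow]; simp [w]
  have hb' : (ShortComplex.mk d (factorThruImageSubobject b) hw).Exact := by
    let φ : ShortComplex.mk d (factorThruImageSubobject b) hw ⟶ ShortComplex.mk d b w :=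
      { τ₁ := 𝟙 _, τ₂ := 𝟙 _, τ₃ := (imageSubobject b).arrow }
    have : Epi φ.τ₁ := by dsimp [φ]; infer_instance
    have : IsIso φ.τ₂ := by dsimp [φ]; infer_instance
    have : Mono φ.τ₃ := by dsimp [φ]; infer_instance
    exact (ShortComplex.exact_iff_of_epi_of_isIso_of_mono φ).2 hb
  have hE : Epi (ShortComplex.mk d (factorThruImageSubobject b) hw).g := by
    dsimp; infer_instance
  have he' : Epi (ShortComplex.mk (biprod.desc a d) e w').g := by dsimp; infer_instance
  have key : a ≫ factorThruImageSubobject b =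
      factorThruImageSubobject (a ≫ b) ≫ (imageSubobject (a ≫ b)).ofLE (imageSubobject b) h := by
    rw [← cancel_mono (imageSubobject b).arrow]; simp
  let f₀ : (imageSubobject b : C) ⟶ E := hb'.desc e wde
  have hf₀ : factorThruImageSubobject b ≫ f₀ = e := hb'.g_desc e wde
  let g₀ : E ⟶ cokernel ((imageSubobject (a ≫ b)).ofLE (imageSubobject b) h) :=
    he.desc (factorThruImageSubobject b ≫ cokernel.π _) (by
      dsimp
      ext
      · rw [biprod.inl_desc_assoc, reassoc_of% key]; simp
      · rw [biprod.inr_desc_assoc, reassoc_of% hw]; simp)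
  have hg₀ : e ≫ g₀ = factorThruImageSubobject b ≫ cokernel.π _ := he.g_desc _ _
  refine
    { hom := cokernel.desc _ f₀ ?_
      inv := g₀
      hom_inv_id := ?_
      inv_hom_id := ?_ }
  · rw [← cancel_epi (factorThruImageSubobject (a ≫ b)), ← reassoc_of% key, hf₀, wae, comp_zero]
  · rw [← cancel_epi (cokernel.π _), ← cancel_epi (factorThruImageSubobject b)]
    simp [reassoc_of% hf₀, hg₀]
  · rw [← cancel_epi e]
    simp [reassoc_of% hg₀, hf₀]

variable (Y : SpectralObject C EInt) {A : ℕ → C}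

/-- The map from the cohomology of a truncation to the abutment. -/
noncomputable def truncToAbutment (e : ∀ n : ℕ, (Y.H n).obj (mk₁ (homOfLE (bot_le : (⊥ : EInt) ≤ ⊤))) ≅ A n)
    (n : ℕ) (a : EInt) : (Y.H n).obj (mk₁ (homOfLE (bot_le : (⊥ : EInt) ≤ a))) ⟶ A n :=
  (Y.H n).map (twoδ₂Toδ₁' ⊥ a ⊤ bot_le le_top) ≫ (e n).hom

variable (e : ∀ n : ℕ, (Y.H n).obj (mk₁ (homOfLE (bot_le : (⊥ : EInt) ≤ ⊤))) ≅ A n)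

theorem map_truncToAbutment (n : ℕ) (a b : EInt) (h : a ≤ b) :
    (Y.H n).map (twoδ₂Toδ₁' ⊥ a b bot_le h) ≫ truncToAbutment Y e n b =
      truncToAbutment Y e n a := by
  unfold truncToAbutment
  rw [← Category.assoc, ← Functor.map_comp]
  rfl

theorem image_truncToAbutment_mono (n : ℕ) {a b : EInt} (h : a ≤ b) :
    imageSubobject (truncToAbutment Y e n a) ≤ imageSubobject (truncToAbutment Y e n b) := by
  rw [← map_truncToAbutment Y e n a b h]
  exact imageSubobject_comp_le _ _

theorem delta_truncToAbutment (n : ℕ) (a : EInt) (m : ℤ) (hm : m + 1 = n) :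
    Y.δ (homOfLE (bot_le : (⊥ : EInt) ≤ a)) (homOfLE (le_top : a ≤ ⊤)) m n hm ≫
      truncToAbutment Y e n a = 0 := by
  unfold truncToAbutment
  rw [← Category.assoc]
  have := Y.zero₁ (homOfLE (bot_le : (⊥ : EInt) ≤ a)) (homOfLE (le_top : a ≤ ⊤))
    (homOfLE bot_le) (by rfl) m n hm
  erw [this]
  simp

theorem delta_truncToAbutment_exact (n : ℕ) (a : EInt) (m : ℤ) (hm : m + 1 = n) :
    (ShortComplex.mk _ _ (delta_truncToAbutment Y e n a m hm)).Exact := by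
  have h := Y.exact₁ (homOfLE (bot_le : (⊥ : EInt) ≤ a)) (homOfLE (le_top : a ≤ ⊤))
    (homOfLE bot_le) (by rfl) m n hm
  refine (ShortComplex.exact_iff_of_iso (ShortComplex.isoMk
    (S₁ := Y.sc₁ (homOfLE (bot_le : (⊥ : EInt) ≤ a)) (homOfLE (le_top : a ≤ ⊤))
      (homOfLE bot_le) (by rfl) m n hm) (S₂ := ShortComplex.mk _ _
    (delta_truncToAbutment Y e n a m hm)) (Iso.refl _) (Iso.refl _) (e n) ?_ ?_)).1 h
  · exact (Category.id_comp _).trans (Category.comp_id _).symm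
  · exact Category.id_comp _

variable [Y.IsFirstQuadrant]

noncomputable def pageIsoInfinity (p q : ℕ) :
    (Y.E₂SpectralSequenceNat.page ((p : ℤ) + q + 2) (by lia)).X (p, q) ≅
      Y.E (homOfLE (bot_le : (⊥ : EInt) ≤ (q : ℤ)))
        (homOfLE (show ((q : ℤ) : EInt) ≤ ((q + 1 : ℤ) : EInt) by simp))
        (homOfLE (le_top : ((q + 1 : ℤ) : EInt) ≤ ⊤)) ((p + q : ℕ) - 1 : ℤ) (p + q : ℕ)
          ((p + q : ℕ) + 1 : ℤ) :=
  Y.spectralSequencePageXIso _ _ (by lia) _ ((-p : ℤ) : EInt) ((q : ℤ) : EInt)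
      ((q + 1 : ℤ) : EInt) ((2 * q + p + 1 : ℤ) : EInt)
      (by simp; lia) (by simp) (by simp) (by simp; lia)
      ((p + q : ℕ) - 1 : ℤ) (p + q : ℕ) ((p + q : ℕ) + 1 : ℤ) (by simp) ≪≫
    (Y.isoMapFourδ₁Toδ₀' ⊥ ((-p : ℤ) : EInt) ((q : ℤ) : EInt) ((q + 1 : ℤ) : EInt)
      ((2 * q + p + 1 : ℤ) : EInt) bot_le (by simp) (by simp) (by simp; lia) _ _ _
      (Y.isZero₁_of_isFirstQuadrant _ _ _ (by simp) _)).symm ≪≫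
    Y.isoMapFourδ₄Toδ₃' ⊥ ((q : ℤ) : EInt) ((q + 1 : ℤ) : EInt)
      ((2 * q + p + 1 : ℤ) : EInt) ⊤ bot_le (by simp) (by simp; lia) le_top _ _ _
      (Y.isZero₂_of_isFirstQuadrant _ _ _ _ (by simp; lia))

theorem image_truncToAbutment_top (n : ℕ) {a : EInt} (ha : ((n : ℤ) : EInt) < a) :
    imageSubobject (truncToAbutment Y e n a) = ⊤ := by
  have : Epi (truncToAbutment Y e n a) := by
    have : Epi ((Y.H n).map (twoδ₂Toδ₁' ⊥ a ⊤ bot_le le_top)) :=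
      (Y.exact₂ (homOfLE (bot_le : (⊥ : EInt) ≤ a)) (homOfLE (le_top : a ≤ ⊤))
        (homOfLE bot_le) (by rfl) n).epi_f
        ((Y.isZero₂_of_isFirstQuadrant a ⊤ le_top n ha).eq_of_tgt _ _)
    unfold truncToAbutment
    infer_instance
  have h1 : Epi (imageSubobject (truncToAbutment Y e n a)).arrow :=
    epi_of_epi_fac (imageSubobject_arrow_comp (truncToAbutment Y e n a))
  have := isIso_of_mono_of_epi (imageSubobject (truncToAbutment Y e n a)).arrow
  exact Subobject.eq_top_of_isIso_arrow _

theorem image_truncToAbutment_bot (n : ℕ) {a : EInt} (ha : a ≤ ((0 : ℤ) : EInt)) :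
    imageSubobject (truncToAbutment Y e n a) = ⊥ := by
  have : truncToAbutment Y e n a = 0 :=
    (Y.isZero₁_of_isFirstQuadrant _ a bot_le ha n).eq_of_src _ _
  rw [this, imageSubobject_zero]

noncomputable def convergence : SpectralConvergence Y.E₂SpectralSequenceNat A where
  fil n p := imageSubobject (truncToAbutment Y e n ((n - p + 1 : ℤ) : EInt))
  antitone n p p' h := image_truncToAbutment_mono _ _ _ (by simp; lia)
  fil_zero n := image_truncToAbutment_top _ _ _ (by simp)
  fil_succ n := image_truncToAbutment_bot _ _ _ (by simp)
  graded p q := by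
    refine ?_ ≪≫ (pageIsoInfinity Y p q).symm
    have h₁ : (((p + q : ℕ) - (p + 1 : ℕ) + 1 : ℤ) : EInt) = ((q : ℤ) : EInt) := by
      simp
    have h₂ : (((p + q : ℕ) - (p : ℕ) + 1 : ℤ) : EInt) = ((q + 1 : ℤ) : EInt) := by
      simp
    have hle : imageSubobject (truncToAbutment Y e (p + q) ((q : ℤ) : EInt)) ≤
      imageSubobject (truncToAbutment Y e (p + q) ((q + 1 : ℤ) : EInt)) :=
      image_truncToAbutment_mono _ _ _ (by simp)
    have key : ∀ (S₁ S₁' S₂ S₂' : Subobject (A (p + q))) (h₁ : S₁ = S₁') (h₂ : S₂ = S₂')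
        (h : S₁ ≤ S₂) (h' : S₁' ≤ S₂'), cokernel (S₁.ofLE S₂ h) = cokernel (S₁'.ofLE S₂' h') := by
      rintro _ _ _ _ rfl rfl _ _; rfl
    refine eqToIso (key _ (imageSubobject ((Y.H (p + q : ℕ)).map (twoδ₂Toδ₁' ⊥ ((q : ℤ) : EInt)
      ((q + 1 : ℤ) : EInt) bot_le (by simp)) ≫ truncToAbutment Y e (p + q) ((q + 1 : ℤ) : EInt)))
      _ (imageSubobject (truncToAbutment Y e (p + q) ((q + 1 : ℤ) : EInt)))
      (by rw [h₁, map_truncToAbutment]) (by rw [h₂]) _ (by rw [map_truncToAbutment]; exact hle)) ≪≫ ?_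
    exact cokernelImageOfLEIso _ _ _ _ (delta_truncToAbutment Y e (p + q) ((q + 1 : ℤ) : EInt)
        ((p + q : ℕ) - 1 : ℤ) (by lia))
      (delta_truncToAbutment_exact Y e (p + q) ((q + 1 : ℤ) : EInt)
        ((p + q : ℕ) - 1 : ℤ) (by lia)) _ 
      (Y.cokernelSequenceE_exact (homOfLE (bot_le : (⊥ : EInt) ≤ (q : ℤ)))
        (homOfLE (show ((q : ℤ) : EInt) ≤ ((q + 1 : ℤ) : EInt) by simp))
        (homOfLE (le_top : ((q + 1 : ℤ) : EInt) ≤ ⊤)) (homOfLE bot_le) (by rfl)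
        ((p + q : ℕ) - 1 : ℤ) (p + q : ℕ) ((p + q : ℕ) + 1 : ℤ)) _

theorem hasSpectralSequence_of_spectralObject {E₂ : ℕ → ℕ → C}
    (h₂ : ∀ p q : ℕ, Nonempty ((Y.H (p + q : ℤ)).obj (mk₁ (homOfLE
      (show ((q : ℤ) : EInt) ≤ ((q + 1 : ℤ) : EInt) by simp))) ≅ E₂ p q))
    (hA : ∀ n : ℕ, Nonempty ((Y.H n).obj (mk₁ (homOfLE (bot_le : (⊥ : EInt) ≤ ⊤))) ≅ A n)) :
    HasSpectralSequence E₂ A :=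
  ⟨Y.E₂SpectralSequenceNat, fun p q => (h₂ p q).map fun i =>
    Y.spectralSequenceFirstPageXIso SpectralObject.coreE₂CohomologicalNat (p, q)
      ((q : ℤ) : EInt) ((q + 1 : ℤ) : EInt) (by simp) (by simp) (p + q : ℤ) (by simp) ≪≫ i,
    ⟨convergence Y fun n => (hA n).some⟩⟩

end SpectralObjectConvergence

end OrdCoh

namespace OrdCoh

/-! ### From triangulated to abelian spectral objects -/

section AbelianSpectralObject

open ComposableArrows Pretriangulated

variable {T ι A : Type*} [Category* T] [Category* ι] [Category* A] [HasZeroObject T]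
  [HasShift T ℤ] [Preadditive T] [∀ n : ℤ, (shiftFunctor T n).Additive] [Pretriangulated T]
  [Abelian A]

/-- The image of a spectral object under a homological functor. -/
noncomputable def abelianSpectralObject (X : Triangulated.SpectralObject T ι) (L : T ⥤ A)
    [L.IsHomological] [L.ShiftSequence ℤ] : Abelian.SpectralObject A ι where
  H n := X.ω₁ ⋙ L.shift n
  δ' n₀ n₁ h :=
    { app D := L.homologySequenceδ (X.ω₂.obj D) n₀ n₁ h
      naturality D D' φ := L.homologySequenceδ_naturality _ _ (X.ω₂.map φ) n₀ n₁ h }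
  exact₁' n₀ n₁ h D :=
    (L.homologySequence_exact₁ _ (X.ω₂_obj_distinguished D) n₀ n₁ h).exact_toComposableArrows
  exact₂' n D :=
    (L.homologySequence_exact₂ _ (X.ω₂_obj_distinguished D) n).exact_toComposableArrows
  exact₃' n₀ n₁ h D :=
    (L.homologySequence_exact₃ _ (X.ω₂_obj_distinguished D) n₀ n₁ h).exact_toComposableArrows

/-- Cohomology in degree `q` is not changed by truncation around `q`. -/
theorem nonempty_truncIso (Y : Abelian.SpectralObject A EInt) (q : ℤ)
    (h₁ : ∀ n ≥ q, IsZero ((Y.H n).obj (mk₁ (homOfLE (bot_le : (⊥ : EInt) ≤ (q : ℤ))))))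
    (h₂ : ∀ n ≤ q, IsZero ((Y.H n).obj (mk₁ (homOfLE (le_top : ((q + 1 : ℤ) : EInt) ≤ ⊤))))) :
    Nonempty ((Y.H q).obj (mk₁ (homOfLE (show ((q : ℤ) : EInt) ≤ ((q + 1 : ℤ) : EInt) by simp))) ≅
      (Y.H q).obj (mk₁ (homOfLE (bot_le : (⊥ : EInt) ≤ ⊤)))) := by
  have i₁ : IsIso ((Y.H q).map (twoδ₁Toδ₀' ⊥ ((q : ℤ) : EInt) ((q + 1 : ℤ) : EInt) bot_le (by simp))) :=
    Y.isIso_H_map_twoδ₁Toδ₀' q (q + 1) rfl _ _ _ _ _ (h₁ _ le_rfl) (h₁ _ (by lia))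
  have i₂ : IsIso ((Y.H q).map (twoδ₂Toδ₁' ⊥ ((q + 1 : ℤ) : EInt) ⊤ bot_le le_top)) := by
    have e := (Y.exact₂ (homOfLE (bot_le : (⊥ : EInt) ≤ (q + 1 : ℤ)))
      (homOfLE (le_top : ((q + 1 : ℤ) : EInt) ≤ ⊤)) (homOfLE bot_le) (by rfl) q).epi_f
        ((h₂ _ le_rfl).eq_of_tgt _ _)
    have m := (Y.exact₁ (homOfLE (bot_le : (⊥ : EInt) ≤ (q + 1 : ℤ)))
      (homOfLE (le_top : ((q + 1 : ℤ) : EInt) ≤ ⊤)) (homOfLE bot_le) (by rfl) (q - 1) q).mono_g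
        ((h₂ _ (by lia)).eq_of_src _ _)
    exact @isIso_of_mono_of_epi _ _ _ _ _ _ m e
  exact ⟨(@asIso _ _ _ _ _ i₁).symm ≪≫ @asIso _ _ _ _ _ i₂⟩

end AbelianSpectralObject

section Extend

variable {B C : Type*} [Category* B] [Category* C] [Preadditive B] [Preadditive C]
  [HasZeroObject B] [HasZeroObject C] (G : B ⥤ C) [G.Additive]
  {ι ι' : Type*} {c : ComplexShape ι} {c' : ComplexShape ι'}

/-- Additive functors commute with extension by zero, on objects. -/
noncomputable def mapExtendXIso (K : HomologicalComplex B c) : ∀ x : Option ι,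
    G.obj (HomologicalComplex.extend.X K x) ≅
      HomologicalComplex.extend.X ((G.mapHomologicalComplex c).obj K) x
  | some _ => Iso.refl _
  | none => G.mapZeroObject

/-- Additive functors commute with extension by zero. -/
noncomputable def mapExtendIso (K : HomologicalComplex B c) (e : c.Embedding c') :
    (G.mapHomologicalComplex c').obj (K.extend e) ≅
      ((G.mapHomologicalComplex c).obj K).extend e :=
  HomologicalComplex.Hom.isoOfComponents (fun i => mapExtendXIso G K (e.r i)) (by
    intro i j _
    have : ∀ x y : Option ι, (mapExtendXIso G K x).hom ≫
        HomologicalComplex.extend.d ((G.mapHomologicalComplex c).obj K) x y =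
          G.map (HomologicalComplex.extend.d K x y) ≫ (mapExtendXIso G K y).hom := by
      rintro (_ | x) (_ | y)
      · simp [HomologicalComplex.extend.d]
      · simp [HomologicalComplex.extend.d]
      · simp [HomologicalComplex.extend.d]
      · exact (Category.id_comp _).trans (Category.comp_id _).symm
    exact this _ _)

end Extend

/-! ### Derived functors via the bounded below derived category -/

section DerivedPlus

open DerivedCategory Pretriangulated

variable {B : Type*} [Category* B] [Abelian B] [EnoughInjectives B] [HasDerivedCategory.{w} B]
  {C : Type*} [Category* C] [Abelian C]

variable (B) in
/-- The functor from bounded below complexes of injectives to the derived category. -/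
noncomputable abbrev injectivesToDerived :
    HomotopyCategory.Plus (InjectiveObject B) ⥤ DerivedCategory.Plus B :=
  (InjectiveObject.ι B).mapHomotopyCategoryPlus ⋙ DerivedCategory.Plus.Qh

instance : (injectivesToDerived B).Full where
  map_surjective {K L} f := by
    obtain ⟨g, rfl⟩ := (Plus.Qh_map_bijective_of_isKInjective
      ((InjectiveObject.ι B).mapHomotopyCategoryPlus.obj K)
      ((InjectiveObject.ι B).mapHomotopyCategoryPlus.obj L) (by
        obtain ⟨L, rfl⟩ := HomotopyCategory.Plus.quotient_obj_surjective L
        exact inferInstanceAs (CochainComplex.IsKInjective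
          (((InjectiveObject.ι B).mapHomologicalComplex (.up ℤ)).obj L.obj)))).2 f
    obtain ⟨h, rfl⟩ := (InjectiveObject.ι B).mapHomotopyCategoryPlus.map_surjective g
    exact ⟨h, rfl⟩

instance : (injectivesToDerived B).Faithful where
  map_injective {K L} f g h := by
    refine (InjectiveObject.ι B).mapHomotopyCategoryPlus.map_injective
      ((Plus.Qh_map_bijective_of_isKInjective
      ((InjectiveObject.ι B).mapHomotopyCategoryPlus.obj K)
      ((InjectiveObject.ι B).mapHomotopyCategoryPlus.obj L) (by
        obtain ⟨L, rfl⟩ := HomotopyCategory.Plus.quotient_obj_surjective L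
        exact inferInstanceAs (CochainComplex.IsKInjective
          (((InjectiveObject.ι B).mapHomologicalComplex (.up ℤ)).obj L.obj)))).1 h)

theorem exists_injectivesToDerived_iso (K : DerivedCategory.Plus B) (n : ℤ) [K.IsGE n] :
    ∃ (L : CochainComplex.Plus (InjectiveObject B)) (_ : L.obj.IsStrictlyGE n),
      Nonempty ((injectivesToDerived B).obj ((HomotopyCategory.Plus.quotient _).obj L) ≅ K) := by
  obtain ⟨L, h, ⟨e⟩⟩ := DerivedCategory.Plus.exists_injective_nonempty_iso K n
  exact ⟨L, h, ⟨e⟩⟩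

instance : (injectivesToDerived B).EssSurj where
  mem_essImage K := by
    obtain ⟨n, hn⟩ := K.property
    have : K.IsGE n := (DerivedCategory.Plus.isGE_ι_obj_iff K n).1 hn
    obtain ⟨L, _, ⟨e⟩⟩ := exists_injectivesToDerived_iso K n
    exact ⟨_, ⟨e⟩⟩

instance : (injectivesToDerived B).IsEquivalence where

variable (B) in
noncomputable abbrev injectivesEquiv :
    HomotopyCategory.Plus (InjectiveObject B) ≌ DerivedCategory.Plus B :=
  (injectivesToDerived B).asEquivalence

noncomputable instance : (injectivesEquiv B).functor.CommShift ℤ :=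
  inferInstanceAs ((injectivesToDerived B).CommShift ℤ)

instance : (injectivesEquiv B).functor.IsTriangulated :=
  inferInstanceAs ((injectivesToDerived B).IsTriangulated)

noncomputable instance : (injectivesEquiv B).inverse.CommShift ℤ :=
  (injectivesEquiv B).commShiftInverse ℤ

instance : (injectivesEquiv B).CommShift ℤ :=
  (injectivesEquiv B).commShift_of_functor ℤ

instance : (injectivesEquiv B).inverse.IsTriangulated :=
  (Equivalence.IsTriangulated.mk' (injectivesEquiv B) inferInstance).rightAdjoint_isTriangulated

variable (G : B ⥤ C) [G.Additive]

/-- Cohomology of the image of a complex of injectives. -/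
noncomputable abbrev injectivesHomology : HomotopyCategory.Plus (InjectiveObject B) ⥤ C :=
  (InjectiveObject.ι B ⋙ G).mapHomotopyCategoryPlus ⋙ HomotopyCategory.Plus.ι C ⋙
    HomotopyCategory.homologyFunctor C (.up ℤ) 0

noncomputable abbrev derivedHomology : DerivedCategory.Plus B ⥤ C :=
  (injectivesEquiv B).inverse ⋙ injectivesHomology G

instance : (derivedHomology G).IsHomological := inferInstance
noncomputable instance : (derivedHomology G).ShiftSequence ℤ := inferInstance

noncomputable def derivedHomologyIso (L : CochainComplex.Plus (InjectiveObject B)) (n : ℤ) :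
    ((derivedHomology G).shift n).obj
      ((injectivesToDerived B).obj ((HomotopyCategory.Plus.quotient _).obj L)) ≅
      (((InjectiveObject.ι B ⋙ G).mapHomologicalComplex (.up ℤ)).obj L.obj).homology n :=
  ((injectivesHomology G).shift n).mapIso ((injectivesEquiv B).unitIso.symm.app
    ((HomotopyCategory.Plus.quotient _).obj L)) ≪≫
    (HomotopyCategory.homologyFunctorFactors C (.up ℤ) n).app
      (((InjectiveObject.ι B ⋙ G).mapHomologicalComplex (.up ℤ)).obj L.obj)

/-- A bounded below complex of injectives as an object of the homotopy category. -/
noncomputable def injComplex (K : CochainComplex B ℕ) (hK : ∀ n, Injective (K.X n)) :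
    CochainComplex.Plus (InjectiveObject B) :=
  ⟨HomologicalComplex.liftObjectProperty _ (K.extend ComplexShape.embeddingUpNat) (fun n => by
    by_cases hn : 0 ≤ n
    · obtain ⟨k, rfl⟩ := Int.eq_ofNat_of_zero_le hn
      have := hK k
      exact Injective.of_iso (K.extendXIso ComplexShape.embeddingUpNat rfl).symm inferInstance
    · exact IsZero.injective (CochainComplex.isZero_of_isStrictlyGE
        (K.extend ComplexShape.embeddingUpNat) 0 _ (by lia))), 0, by
    rw [← CochainComplex.isStrictlyGE_mapHomologicalComplex_obj_iff _ (InjectiveObject.ι _)]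
    exact inferInstanceAs (CochainComplex.IsStrictlyGE (K.extend ComplexShape.embeddingUpNat) 0)⟩

/-- A bounded below complex of injectives as an object of the derived category. -/
noncomputable abbrev injObject (K : CochainComplex B ℕ) (hK : ∀ n, Injective (K.X n)) :
    DerivedCategory.Plus B :=
  (injectivesToDerived B).obj ((HomotopyCategory.Plus.quotient _).obj (injComplex K hK))

noncomputable def derivedHomologyInjIso (K : CochainComplex B ℕ) (hK : ∀ n, Injective (K.X n))
    (n : ℕ) :
    ((derivedHomology G).shift (n : ℤ)).obj (injObject K hK) ≅
      ((G.mapHomologicalComplex _).obj K).homology n :=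
  derivedHomologyIso G _ _ ≪≫
    (HomologicalComplex.homologyFunctor C (.up ℤ) n).mapIso
      (mapExtendIso G K ComplexShape.embeddingUpNat) ≪≫
    HomologicalComplex.extendHomologyIso _ ComplexShape.embeddingUpNat rfl

noncomputable def homologyInjIso (K : CochainComplex B ℕ) (hK : ∀ n, Injective (K.X n)) (n : ℕ) :
    (DerivedCategory.Plus.homologyFunctor B n).obj (injObject K hK) ≅ K.homology n :=
  (DerivedCategory.homologyFunctorFactorsh B n).app _ ≪≫
    (HomotopyCategory.homologyFunctorFactors B (.up ℤ) n).app
      (K.extend ComplexShape.embeddingUpNat) ≪≫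
    HomologicalComplex.extendHomologyIso _ ComplexShape.embeddingUpNat rfl

noncomputable def singleIsoInjObject {X : B} (R : InjectiveResolution X) :
    (DerivedCategory.Plus.singleFunctor B 0).obj X ≅ injObject R.cocomplex inferInstance :=
  DerivedCategory.Plus.ι.preimageIso
    (@asIso _ _ _ _ (DerivedCategory.Q.map R.ι')
      ((DerivedCategory.isIso_Q_map_iff_quasiIso _ R.ι').2 inferInstance))

theorem nonempty_derivedHomology_single (X : B) (p : ℕ) (q : ℤ) :
    Nonempty (((derivedHomology G).shift (p + q)).obj
      ((DerivedCategory.Plus.singleFunctor B q).obj X) ≅ (G.rightDerived p).obj X) := by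
  obtain ⟨R⟩ := (inferInstance : HasInjectiveResolution X).out
  refine ⟨((derivedHomology G).shiftIso q p (p + q) (by lia)).symm.app _ ≪≫
    ((derivedHomology G).shift (p : ℤ)).mapIso
      (((DerivedCategory.Plus.singleFunctors B).shiftIso q 0 q (by lia)).app X ≪≫
        singleIsoInjObject R) ≪≫
    derivedHomologyInjIso G _ _ p ≪≫ (R.isoRightDerivedObj G p).symm⟩

theorem isZero_derivedHomology_of_isGE (K : DerivedCategory.Plus B) (m n : ℤ) [K.IsGE m]
    (h : n < m) : IsZero (((derivedHomology G).shift n).obj K) := by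
  obtain ⟨L, hL, ⟨e⟩⟩ := exists_injectivesToDerived_iso K m
  refine IsZero.of_iso ?_ ((((derivedHomology G).shift n).mapIso e).symm ≪≫
    derivedHomologyIso G L n)
  have : CochainComplex.IsStrictlyGE
    (((InjectiveObject.ι B ⋙ G).mapHomologicalComplex (.up ℤ)).obj L.obj) m :=
    inferInstance
  exact HomologicalComplex.exactAt_iff_isZero_homology _ _ |>.1
    (HomologicalComplex.ExactAt.of_isZero
      (CochainComplex.isZero_of_isStrictlyGE _ m n h))

/-- The spectral object of truncations of `K`, after applying derived functors of `G`. -/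
noncomputable abbrev hyperSpectralObject (K : DerivedCategory.Plus B) :
    Abelian.SpectralObject C EInt :=
  abelianSpectralObject (DerivedCategory.Plus.TStructure.t.spectralObject K) (derivedHomology G)

theorem isFirstQuadrant_hyperSpectralObject (K : DerivedCategory.Plus B) [K.IsGE 0] :
    (hyperSpectralObject G K).IsFirstQuadrant where
  isZero₁ i j hij hj n :=
    Functor.map_isZero ((derivedHomology G).shift n)
      (Functor.map_isZero (DerivedCategory.Plus.TStructure.t.eTruncGE.obj i)
      (DerivedCategory.Plus.TStructure.t.isZero_eTruncLT_obj_obj K 0 j hj))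
  isZero₂ i j hij n hi := by
    have : DerivedCategory.Plus.IsGE ((DerivedCategory.Plus.TStructure.t.eTruncGE.obj i).obj
        ((DerivedCategory.Plus.TStructure.t.eTruncLT.obj j).obj K)) (n + 1) :=
      DerivedCategory.Plus.TStructure.t.isGE_eTruncGE_obj_obj _ _ (by
        induction i using WithBotTop.rec with
        | bot => simp at hi
        | coe i => simpa using hi
        | top => simp) _
    exact @isZero_derivedHomology_of_isGE _ _ _ _ _ _ _ _ G _ _ (n + 1) n this (by lia)

theorem hasSpectralSequence_hyper (K : CochainComplex B ℕ) (hK : ∀ n, Injective (K.X n))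
    {E₂ : ℕ → ℕ → C} {A : ℕ → C}
    (hE : ∀ p q, Nonempty ((G.rightDerived p).obj (K.homology q) ≅ E₂ p q))
    (hA : ∀ n, Nonempty (((G.mapHomologicalComplex _).obj K).homology n ≅ A n)) :
    HasSpectralSequence E₂ A := by
  have hge : (injObject K hK).IsGE 0 := by
    rw [← DerivedCategory.Plus.isGE_ι_obj_iff]
    exact (DerivedCategory.isGE_Q_obj_iff (K.extend ComplexShape.embeddingUpNat) 0).2 inferInstance
  have := isFirstQuadrant_hyperSpectralObject G (injObject K hK)
  refine hasSpectralSequence_of_spectralObject (hyperSpectralObject G (injObject K hK)) ?_ ?_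
  · intro p q
    let t := (DerivedCategory.Plus.TStructure.t (C := B))
    let Z : DerivedCategory.Plus B := (t.eTruncGE.obj ((q : ℤ) : EInt)).obj
      ((t.eTruncLT.obj ((q + 1 : ℤ) : EInt)).obj (injObject K hK))
    have h₁ : Z.IsGE q := t.isGE_eTruncGE_obj_obj _ _ le_rfl _
    have h₂ : Z.IsLE q := by
      have : t.IsLE ((t.eTruncLT.obj ((q + 1 : ℤ) : EInt)).obj (injObject K hK)) q :=
        t.isLE_eTruncLT_obj_obj _ _ le_rfl _
      exact inferInstanceAs (t.IsLE ((t.eTruncGE.obj ((q : ℤ) : EInt)).obj _) q)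
    obtain ⟨W, ⟨e⟩⟩ := DerivedCategory.exists_iso_singleFunctor_obj_of_isGE_of_isLE
      (DerivedCategory.Plus.ι.obj Z) q
    let e' : Z ≅ (DerivedCategory.Plus.singleFunctor B q).obj W :=
      DerivedCategory.Plus.ι.preimageIso e
    obtain ⟨f⟩ := nonempty_derivedHomology_single G W p q
    have hW : Nonempty (W ≅ K.homology q) := by
      let Y := abelianSpectralObject (t.spectralObject (injObject K hK))
        (DerivedCategory.Plus.homologyFunctor B 0)
      obtain ⟨g⟩ := nonempty_truncIso Y q
        (fun n hn => by
          have : t.IsLE ((t.eTruncLT.obj ((q : ℤ) : EInt)).obj (injObject K hK)) (q - 1) :=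
            t.isLE_eTruncLT_obj_obj _ _ (by simp) _
          exact @DerivedCategory.Plus.isZero_homology_of_isLE _ _ _ _ _ (q - 1)
            (inferInstanceAs (t.IsLE ((t.eTruncGE.obj (⊥ : EInt)).obj
              ((t.eTruncLT.obj ((q : ℤ) : EInt)).obj (injObject K hK))) (q - 1))) n (by lia))
        (fun n hn => by
          have : t.IsGE ((t.eTruncGE.obj ((q + 1 : ℤ) : EInt)).obj
              ((t.eTruncLT.obj (⊤ : EInt)).obj (injObject K hK))) (q + 1) :=
            t.isGE_eTruncGE_obj_obj _ _ le_rfl _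
          exact @DerivedCategory.Plus.isZero_homology_of_isGE _ _ _ _ _ (q + 1) this n (by lia))
      refine ⟨?_ ≪≫ g ≪≫ homologyInjIso K hK q⟩
      refine ?_ ≪≫ (DerivedCategory.Plus.homologyFunctor B q).mapIso e'.symm
      exact ((DerivedCategory.singleFunctorCompHomologyFunctorIso B q).app W).symm
    obtain ⟨g⟩ := hW
    exact ⟨((derivedHomology G).shift (p + q : ℤ)).mapIso e' ≪≫ f ≪≫
      (G.rightDerived p).mapIso g ≪≫ (hE p q).some⟩
  · intro n
    exact ⟨derivedHomologyInjIso G K hK n ≪≫ (hA n).some⟩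

end DerivedPlus

/-- The Grothendieck spectral sequence. -/
theorem hasSpectralSequence_comp {A B C : Type*} [Category* A] [Category* B] [Category* C]
    [Abelian A] [Abelian B] [Abelian C] [EnoughInjectives A] [EnoughInjectives B]
    (F : A ⥤ B) [F.Additive] (G : B ⥤ C) [G.Additive]
    (hF : ∀ I : A, Injective I → Injective (F.obj I)) (X : A) {E₂ : ℕ → ℕ → C} {M : ℕ → C}
    (hE : ∀ r s, Nonempty ((G.rightDerived r).obj ((F.rightDerived s).obj X) ≅ E₂ r s))
    (hM : ∀ n, Nonempty (((F ⋙ G).rightDerived n).obj X ≅ M n)) :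
    HasSpectralSequence E₂ M := by
  let := HasDerivedCategory.standard B
  obtain ⟨R⟩ := (inferInstance : HasInjectiveResolution X).out
  exact hasSpectralSequence_hyper G ((F.mapHomologicalComplex _).obj R.cocomplex)
    (fun n => hF _ (R.injective n))
    (fun r s => ⟨(G.rightDerived r).mapIso (R.isoRightDerivedObj F s).symm ≪≫ (hE r s).some⟩)
    (fun n => ⟨(R.isoRightDerivedObj (F ⋙ G) n).symm ≪≫ (hM n).some⟩)

end OrdCoh

namespace OrdCoh

/-! ### Finiteness of essential extensions -/

section Algebra

variable {k A : Type*} [CommRing k] [IsNoetherianRing k] [CommRing A] [Algebra k A]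

/-- A finite module killed by a power of an ideal with finite quotient is finite. -/
theorem finite_of_pow_smul_eq_bot [IsNoetherianRing A] (I : Ideal A) [Module.Finite k (A ⧸ I)]
    (n : ℕ) : ∀ (M : Type w) [AddCommGroup M] [Module A M] [Module k M] [IsScalarTower k A M]
      [Module.Finite A M], (I ^ n • ⊤ : Submodule A M) = ⊥ → Module.Finite k M := by
  induction n with
  | zero =>
    intro M _ _ _ _ _ h
    have : Subsingleton M := by
      rw [pow_zero, Ideal.one_eq_top, Submodule.top_smul] at h
      exact Submodule.subsingleton_iff A |>.1 (subsingleton_of_bot_eq_top h.symm)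
    infer_instance
  | succ n ih =>
    intro M _ _ _ _ _ h
    let N : Submodule A M := I • ⊤
    have hN : Module.Finite k N := by
      refine ih N ?_
      rw [eq_bot_iff, ← Submodule.map_le_map_iff_of_injective N.injective_subtype]
      rw [Submodule.map_smul'', Submodule.map_top, Submodule.range_subtype, Submodule.map_bot,
        ← mul_smul, ← pow_succ, h]
    have hQ : Module.Finite k (M ⧸ N) := by
      have : Module.Finite (A ⧸ I) (M ⧸ N) := Module.Finite.of_restrictScalars_finite A _ _
      exact Module.Finite.trans (A ⧸ I) _
    have h1 : Module.Finite k (N.restrictScalars k) := hN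
    have h2 : Module.Finite k (M ⧸ N.restrictScalars k) := hQ
    exact Module.Finite.of_submodule_quotient (N.restrictScalars k)

theorem finite_quotient_annihilator {N : Type*} [AddCommGroup N] [Module A N] [Module k N]
    [IsScalarTower k A N] [Module.Finite k N] : Module.Finite k (A ⧸ Module.annihilator A N) := by
  obtain ⟨n, s, hs⟩ := Module.Finite.exists_fin (R := k) (M := N)
  let f : A →ₗ[A] (Fin n → N) := LinearMap.pi fun i => LinearMap.toSpanSingleton A N (s i)
  have hf : LinearMap.ker f = Module.annihilator A N := by
    ext a
    rw [LinearMap.mem_ker, Module.mem_annihilator]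
    constructor
    · intro h y
      have hy : y ∈ Submodule.span k (Set.range s) := hs ▸ Submodule.mem_top
      induction hy using Submodule.span_induction with
      | mem x hx =>
        obtain ⟨i, rfl⟩ := hx
        exact congr_fun h i
      | zero => exact smul_zero _
      | add x y _ _ hx hy => rw [smul_add, hx, hy, add_zero]
      | smul c x _ hx => rw [smul_comm, hx, smul_zero]
    · intro h
      ext i
      exact h (s i)
  rw [← hf]
  let g : (A ⧸ LinearMap.ker f) →ₗ[A] (Fin n → N) := Submodule.liftQ _ f le_rfl
  have hg : Function.Injective g :=
    LinearMap.ker_eq_bot.1 (Submodule.ker_liftQ_eq_bot _ _ _ le_rfl)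
  exact Module.Finite.of_injective (g.restrictScalars k) hg

/-- A finite module is finite over the base as soon as it has an essential submodule which is. -/
theorem finite_of_essential [IsNoetherianRing A] (M : Type*) [AddCommGroup M] [Module A M]
    [Module k M] [IsScalarTower k A M] [Module.Finite A M] (N : Submodule A M)
    [Module.Finite k N] (h : ∀ E : Submodule A M, E ⊓ N = ⊥ → E = ⊥) : Module.Finite k M := by
  have := finite_quotient_annihilator (k := k) (A := A) (N := N)
  obtain ⟨n, hn⟩ := Ideal.exists_pow_inf_eq_pow_smul (Module.annihilator A N) N
  refine finite_of_pow_smul_eq_bot (k := k) (Module.annihilator A N) (n + 1) M (h _ ?_)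
  rw [hn (n + 1) n.le_succ, eq_bot_iff, Nat.add_sub_cancel_left, pow_one]
  refine (Submodule.smul_mono le_rfl inf_le_right).trans ?_
  exact (Submodule.annihilator_smul N).le

end Algebra

section Mono

variable {k : Type v} {G : Type u} [CommRing k] [Group G] [TopologicalSpace G] [IsTopologicalGroup G]

theorem smRep_injective_of_mono {V W : SmRep.{u, v, w} k G} (f : V ⟶ W) [Mono f] :
    Function.Injective f.hom.hom := by
  have := (smoothCondition.{u, v, w} k G).subobjects IsSmooth fun _ => Iff.rfl
  have := (smoothCondition.{u, v, w} k G).quotients IsSmooth fun _ => Iff.rfl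
  have := (smoothCondition.{u, v, w} k G).zero IsSmooth fun _ => Iff.rfl
  have := (smoothCondition.{u, v, w} k G).finiteProducts IsSmooth fun _ => Iff.rfl
  have := ObjectProperty.preservesMonomorphisms_ι_of_isNormalEpiCategory
    (IsSmooth : ObjectProperty (Rep.{w} k G))
  exact (Rep.mono_iff_injective _).1
    (inferInstanceAs (Mono ((IsSmooth : ObjectProperty (Rep.{w} k G)).ι.map f)))

end Mono

section Essential

variable {k : Type v} {G : Type u} [CommRing k] [CommGroup G]

theorem exists_maximal_disjoint (J : Rep.{w} k G) (I : Submodule k J) :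
    ∃ D : Submodule k J, ∃ hD : ∀ g, D ≤ D.comap (J.ρ g), D ⊓ I = ⊥ ∧
      ∀ E : Submodule k (Rep.quotient J D hD), (∀ g, E ≤ E.comap ((Rep.quotient J D hD).ρ g)) →
        E ⊓ I.map (Rep.mkQ J D hD).hom.toLinearMap = ⊥ → E = ⊥ := by
  obtain ⟨D, hD⟩ := zorn_le₀ {D : Submodule k J | (∀ g, D ≤ D.comap (J.ρ g)) ∧ D ⊓ I = ⊥} (by
    intro c hc hchain
    refine ⟨sSup c, ⟨fun g => sSup_le fun D hD => ((hc hD).1 g).trans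
      (Submodule.comap_mono (le_sSup hD)), ?_⟩, fun D hD => le_sSup hD⟩
    rw [hchain.directedOn.sSup_inf_eq, eq_bot_iff]
    exact iSup₂_le fun D hD => (hc hD).2.le)
  refine ⟨D, hD.prop.1, hD.prop.2, ?_⟩
  intro E hE h
  let q : J →ₗ[k] J ⧸ D := D.mkQ
  have hq : ∀ x, q x = 0 ↔ x ∈ D := fun x => Submodule.Quotient.mk_eq_zero D
  have hDE : D ≤ E.comap q := fun x hx => by
    rw [Submodule.mem_comap, (hq x).2 hx]
    exact zero_mem _
  have h1 : E.comap q ≤ D := by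
    refine hD.2 ⟨fun g x hx => ?_, ?_⟩ hDE
    · exact hE g hx
    · rw [eq_bot_iff]
      rintro x ⟨hx, hxI⟩
      have : q x ∈ E ⊓ I.map q := ⟨hx, x, hxI, rfl⟩
      have h' : q x ∈ (⊥ : Submodule k (J ⧸ D)) := h.le this
      rw [← hD.prop.2]
      exact ⟨(hq x).1 h', hxI⟩
  rw [eq_bot_iff]
  intro y hy
  obtain ⟨x, rfl⟩ := Submodule.mkQ_surjective D y
  exact (hq x).2 (h1 hy)

variable [IsNoetherianRing k]

theorem cyclicSpan_fg_of_essential (Q : Rep.{w} k G) (N : Submodule k Q)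
    (hN : ∀ g, N ≤ N.comap (Q.ρ g)) (hfin : N ≤ finiteVectors Q)
    (hess : ∀ E : Submodule k Q, (∀ g, E ≤ E.comap (Q.ρ g)) → E ⊓ N = ⊥ → E = ⊥)
    (x : Q) (G₀ : Subgroup G) (hG₀ : G₀.FG) (hx : G₀ ⊔ vectorStabilizer Q x = ⊤) :
    (cyclicSpan Q x).FG := by
  let σ : Representation k G₀ Q := Q.ρ.comp G₀.subtype
  have : Group.FG G₀ := (Group.fg_iff_subgroup_fg _).2 hG₀
  have : Monoid.FG G₀ := inferInstance
  have : IsNoetherianRing (MonoidAlgebra k G₀) :=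
    Algebra.FiniteType.isNoetherianRing k _
  let x' : σ.asModule := σ.asModuleEquiv.symm x
  let M : Submodule (MonoidAlgebra k G₀) σ.asModule := Submodule.span _ {x'}
  have hG : ∀ (g : G₀) (y : σ.asModule), MonoidAlgebra.of k G₀ g • y =
    σ.asModuleEquiv.symm (Q.ρ g (σ.asModuleEquiv y)) := fun g y =>
      (σ.asModuleEquiv_symm_map_rho g _).symm
  let toK : Submodule (MonoidAlgebra k G₀) σ.asModule → Submodule k Q :=
    fun E => (E.restrictScalars k).map σ.asModuleEquiv.toLinearMap
  let ofK : (E : Submodule k Q) → (∀ g, E ≤ E.comap (Q.ρ g)) →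
      Submodule (MonoidAlgebra k G₀) σ.asModule := fun E hE =>
    Subrepresentation.asSubmodule ⟨E, fun g v hv => hE g hv⟩
  have hfix : M ≤ ofK (fixedVectors Q (vectorStabilizer Q x)) (fixedVectors_stable _ _) := by
    refine Submodule.span_le.2 (Set.singleton_subset_iff.2 ?_)
    exact fun g hg => hg
  have hstab : ∀ E ≤ M, ∀ g, toK E ≤ (toK E).comap (Q.ρ g) := by
    rintro E hE g _ ⟨y, hy, rfl⟩
    obtain ⟨a, ha, b, hb, rfl⟩ := Subgroup.mem_sup.1 (hx.symm ▸ Subgroup.mem_top g)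
    refine ⟨MonoidAlgebra.of k G₀ ⟨a, ha⟩ • y, E.smul_mem _ hy, ?_⟩
    rw [hG, map_mul]
    have := hfix (hE hy) b hb
    change Q.ρ a (σ.asModuleEquiv y) = Q.ρ a (Q.ρ b (σ.asModuleEquiv y))
    exact congr_arg _ this.symm
  have hM : Module.Finite (MonoidAlgebra k G₀) M :=
    Module.Finite.iff_fg.2 (Submodule.fg_span_singleton x')
  let N' : Submodule (MonoidAlgebra k G₀) M := (ofK N hN).comap M.subtype
  have hN' : Module.Finite k N' := by
    obtain ⟨s, hs⟩ : N'.FG := IsNoetherian.noetherian _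
    have hc : ∀ g, (⨆ y ∈ s, cyclicSpan Q (σ.asModuleEquiv y.1)) ≤
        (⨆ y ∈ s, cyclicSpan Q (σ.asModuleEquiv y.1)).comap (Q.ρ g) := fun g =>
      iSup₂_le fun y hy => (cyclicSpan_stable Q _ g).trans
        (Submodule.comap_mono (le_iSup₂_of_le y hy le_rfl))
    have hle : N' ≤ (ofK _ hc).comap M.subtype := by
      rw [← hs]
      refine Submodule.span_le.2 fun y hy => ?_
      exact le_iSup₂_of_le (f := fun (y : M) (_ : y ∈ s) => cyclicSpan Q (σ.asModuleEquiv y.1))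
        y hy le_rfl (mem_cyclicSpan _ _)
    have hfg : (⨆ y ∈ s, cyclicSpan Q (σ.asModuleEquiv y.1)).FG :=
      Submodule.fg_biSup _ _ fun y hy => hfin
        (show y ∈ N' from hs ▸ Submodule.subset_span hy)
    have := Module.Finite.iff_fg.2 hfg
    let f : N' →ₗ[k] Q := σ.asModuleEquiv.toLinearMap ∘ₗ
      (M.subtype ∘ₗ N'.subtype).restrictScalars k
    refine Module.Finite.of_injective (f.codRestrict (⨆ y ∈ s, cyclicSpan Q (σ.asModuleEquiv y.1))
      fun y => hle y.2) fun a b hab => ?_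
    have h := congr_arg Subtype.val hab
    exact Subtype.ext (Subtype.ext h)
  have : Module.Finite k M := by
    refine finite_of_essential (A := MonoidAlgebra k G₀) M N' fun E hE => ?_
    have hle : E.map M.subtype ≤ M := by
      rintro _ ⟨y, _, rfl⟩
      exact y.2
    have h := hess (toK (E.map M.subtype)) (hstab _ hle) (by
      rw [eq_bot_iff]
      rintro _ ⟨⟨_, ⟨y, hy, rfl⟩, rfl⟩, hyN⟩
      have h0 : y ∈ E ⊓ N' := ⟨hy, hyN⟩
      rw [hE] at h0
      rw [(Submodule.mem_bot _).1 h0]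
      exact zero_mem _)
    rw [eq_bot_iff]
    intro y hy
    have h0 : σ.asModuleEquiv y.1 ∈ (⊥ : Submodule k Q) := h ▸ ⟨y.1, ⟨y, hy, rfl⟩, rfl⟩
    exact Subtype.ext h0
  let f : M →ₗ[k] Q := σ.asModuleEquiv.toLinearMap ∘ₗ M.subtype.restrictScalars k
  have hf : (LinearMap.range f).FG := Module.Finite.iff_fg.1 (Module.Finite.range f)
  refine hf.of_le ?_
  refine cyclicSpan_le (fun g => ?_) ⟨⟨x', Submodule.mem_span_singleton_self _⟩, rfl⟩
  rintro _ ⟨y, rfl⟩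
  obtain ⟨z, hz, h⟩ := hstab M le_rfl g ⟨y.1, y.2, rfl⟩
  exact ⟨⟨z, hz⟩, h⟩

variable [TopologicalSpace G] [IsTopologicalGroup G]

theorem isSmooth_quotient (J : Rep.{w} k G) (hJ : IsSmooth J) (D : Submodule k J)
    (hD : ∀ g, D ≤ D.comap (J.ρ g)) : IsSmooth (Rep.quotient J D hD) := by
  intro y
  obtain ⟨x, rfl⟩ := Submodule.mkQ_surjective D y
  exact (smoothCondition k G).map_mem (Rep.mkQ J D hD) x (hJ x)

/-- An injective locally admissible representation is injective among smooth representations, if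
the group is topologically finitely generated modulo each open subgroup. -/
theorem injective_toSm [EnoughInjectives (Rep.{w} k G)]
    (hG : ∀ U : Subgroup G, IsOpen (U : Set G) → ∃ G₀ : Subgroup G, G₀.FG ∧ G₀ ⊔ U = ⊤)
    (I : LAdmRep.{u, v, w} k G) [Injective I] :
    Injective ((ObjectProperty.ιOfLE
      (isLocallyAdmissible_le_isSmooth (k := k) (G := G))).obj I) := by
  set I' := (ObjectProperty.ιOfLE (isLocallyAdmissible_le_isSmooth (k := k) (G := G))).obj I
  let J := Injective.under I'
  let i : I' ⟶ J := Injective.ι I'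
  have hi : Function.Injective i.hom.hom := smRep_injective_of_mono i
  obtain ⟨D, hD, hDI, hess⟩ := exists_maximal_disjoint J.obj (LinearMap.range i.hom.hom.toLinearMap)
  let q := Rep.mkQ J.obj D hD
  let N : Submodule k (Rep.quotient J.obj D hD) :=
    (LinearMap.range i.hom.hom.toLinearMap).map q.hom.toLinearMap
  have hN : ∀ y, y ∈ N ↔ ∃ x : I.obj, q.hom (i.hom.hom x) = y := by
    intro y
    constructor
    · rintro ⟨_, ⟨x, rfl⟩, rfl⟩
      exact ⟨x, rfl⟩
    · rintro ⟨x, rfl⟩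
      exact ⟨_, ⟨x, rfl⟩, rfl⟩
  have hsm := isSmooth_quotient J.obj J.property D hD
  have hQ : IsLocallyAdmissible (Rep.quotient J.obj D hD) := by
    rw [isLocallyAdmissible_iff]
    intro x
    refine ⟨hsm x, ?_⟩
    obtain ⟨G₀, h1, h2⟩ := hG _ (hsm x)
    refine cyclicSpan_fg_of_essential _ N ?_ ?_ hess x G₀ h1 h2
    · intro g y hy
      obtain ⟨x, rfl⟩ := (hN _).1 hy
      refine (hN _).2 ⟨I.obj.ρ g x, ?_⟩
      rw [← Rep.hom_comm_apply]
      exact congr_arg _ (Rep.hom_comm_apply i.hom g x)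
    · intro y hy
      obtain ⟨x, rfl⟩ := (hN _).1 hy
      exact ((ladmCondition k G).map_mem (i.hom ≫ q) x
        ((isLocallyAdmissible_iff _).1 I.property x)).2
  let Q : LAdmRep.{u, v, w} k G := ⟨_, hQ⟩
  let j : I ⟶ Q := ObjectProperty.homMk (i.hom ≫ q)
  have hj : Function.Injective j.hom.hom := by
    intro a b hab
    refine hi ?_
    rw [← sub_eq_zero, ← Submodule.mem_bot k, ← hDI]
    refine ⟨(Submodule.Quotient.eq D).1 hab, a - b, map_sub _ _ _⟩
  have : Mono j := (IsLocallyAdmissible : ObjectProperty (Rep.{w} k G)).ι.mono_of_mono_map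
    ((Rep.mono_iff_injective _).2 hj)
  let r : Q ⟶ I := Injective.factorThru (𝟙 I) j
  have hr : j ≫ r = 𝟙 I := Injective.comp_factorThru _ _
  let s : J ⟶ I' := ObjectProperty.homMk (q ≫ r.hom)
  have hs : i ≫ s = 𝟙 I' := by
    ext : 1
    have h := congr_arg (fun f : I ⟶ I => f.hom) hr
    exact h
  refine ⟨fun {X Y} g f _ => ⟨Injective.factorThru (g ≫ i) f ≫ s, ?_⟩⟩
  rw [Injective.comp_factorThru_assoc, Category.assoc, hs, Category.comp_id]

end Essential

section FieldQuot

variable {F : Type u} [NontriviallyNormedField F] [IsUltrametricDist F] [ProperSpace F]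

theorem exists_fg_sup_eq_top (U : Subgroup Fˣ) (hU : IsOpen (U : Set Fˣ)) :
    ∃ G₀ : Subgroup Fˣ, G₀.FG ∧ G₀ ⊔ U = ⊤ := by
  obtain ⟨t, ht⟩ := isCompact_unitGroup.elim_finite_subcover (fun g : Fˣ => (g⁻¹ * ·) ⁻¹' (U : Set Fˣ))
    (fun g => hU.preimage (continuous_const_mul _)) (fun x _ => Set.mem_iUnion.2 ⟨x, by simp⟩)
  refine ⟨Subgroup.closure (insert (uniformizer F) t),
    (Subgroup.fg_iff _).2 ⟨_, rfl, t.finite_toSet.insert _⟩, ?_⟩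
  rw [eq_top_iff]
  intro x _
  obtain ⟨n, v, hv, rfl⟩ := exists_eq_zpow_mul x
  obtain ⟨g, hg, hgv⟩ := Set.mem_iUnion₂.1 (ht hv)
  refine mul_mem (Subgroup.mem_sup_left (zpow_mem (Subgroup.subset_closure
    (Set.mem_insert _ _)) n)) ?_
  rw [← mul_inv_cancel_left g v]
  exact mul_mem (Subgroup.mem_sup_left (Subgroup.subset_closure (Set.mem_insert_of_mem _ hg)))
    (Subgroup.mem_sup_right hgv)

theorem QuotBy.exists_fg_sup_eq_top (H : Subgroup Fˣ) (U : Subgroup (QuotBy H))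
    (hU : IsOpen (U : Set (QuotBy H))) : ∃ G₀ : Subgroup (QuotBy H), G₀.FG ∧ G₀ ⊔ U = ⊤ := by
  obtain ⟨G₀, h1, h2⟩ := OrdCoh.exists_fg_sup_eq_top (U.comap (QuotBy.mk H))
    ((QuotBy.isOpen_iff _).1 hU)
  refine ⟨G₀.map (QuotBy.mk H), ?_, ?_⟩
  · rw [Subgroup.fg_iff_submonoid_fg] at h1 ⊢
    exact h1.map _
  have h3 := congr_arg (Subgroup.map (QuotBy.mk H)) h2
  rwa [Subgroup.map_sup, Subgroup.map_comap_eq_self_of_surjective (QuotBy.mk_surjective H),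
    Subgroup.map_top_of_surjective _ (QuotBy.mk_surjective H)] at h3

end FieldQuot

end OrdCoh

namespace OrdCoh

/-! ### Matrix calculus in `PGL₂` -/

section PGL

variable {F : Type u} [NontriviallyNormedField F]

/-- The class of an invertible matrix given by its entries. -/
def pgl (a b c d : F) (h : a * d - b * c ≠ 0) : PGL2 F :=
  QuotientGroup.mk (Matrix.GeneralLinearGroup.mkOfDetNeZero !![a, b; c, d]
    (by rwa [Matrix.det_fin_two_of]))

theorem pgl_surjective (g : PGL2 F) : ∃ a b c d h, g = pgl (F := F) a b c d h := by
  induction g using QuotientGroup.induction_on with | H g => ?_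
  have h : g.1 0 0 * g.1 1 1 - g.1 0 1 * g.1 1 0 ≠ 0 := by
    rw [← Matrix.det_fin_two]
    exact (Matrix.GeneralLinearGroup.det g).ne_zero
  refine ⟨g.1 0 0, g.1 0 1, g.1 1 0, g.1 1 1, h, congr_arg _ (Units.ext ?_)⟩
  exact Matrix.eta_fin_two _

theorem pgl_mul (a b c d a' b' c' d' : F) (h h') : pgl a b c d h * pgl a' b' c' d' h' =
    pgl (a * a' + b * c') (a * b' + b * d') (c * a' + d * c') (c * b' + d * d') (by
      convert mul_ne_zero h h' using 1
      ring) := by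
  refine congr_arg (QuotientGroup.mk (s := Subgroup.center (Matrix.GeneralLinearGroup (Fin 2) F)))
    (Units.ext ?_)
  exact Matrix.mul_fin_two ..

theorem pgl_eq_pgl {a b c d a' b' c' d' : F} {h h'} (l : F) (ha : a' = l * a)
    (hb : b' = l * b) (hc : c' = l * c) (hd : d' = l * d) :
    pgl a b c d h = pgl a' b' c' d' h' := by
  have hl : l ≠ 0 := by
    rintro rfl
    refine h' ?_
    rw [ha, hb]
    ring
  refine QuotientGroup.eq.2 ?_
  have h1 : Matrix.GeneralLinearGroup.mkOfDetNeZero !![a', b'; c', d']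
      (by rwa [Matrix.det_fin_two_of]) = Matrix.GeneralLinearGroup.mkOfDetNeZero !![a, b; c, d]
      (by rwa [Matrix.det_fin_two_of]) * Matrix.GeneralLinearGroup.scalar (Fin 2) (Units.mk0 l hl) := by
    refine Units.ext ?_
    ext i j
    rw [Units.val_mul]
    fin_cases i <;> fin_cases j <;>
      simp [Matrix.GeneralLinearGroup.mkOfDetNeZero, ha, hb, hc, hd, mul_comm]
  rw [h1, inv_mul_cancel_left, Matrix.GeneralLinearGroup.center_eq_range_scalar]
  exact ⟨_, rfl⟩

theorem pgl_eq_iff {a b c d a' b' c' d' : F} {h h'} (he : pgl a b c d h = pgl a' b' c' d' h') :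
    ∃ l : F, l ≠ 0 ∧ a' = l * a ∧ b' = l * b ∧ c' = l * c ∧ d' = l * d := by
  have h1 := QuotientGroup.eq.1 he
  rw [Matrix.GeneralLinearGroup.center_eq_range_scalar] at h1
  obtain ⟨l, hl⟩ := h1
  have h2 := eq_inv_mul_iff_mul_eq.1 hl
  have h3 := congr_arg Units.val h2
  refine ⟨l, l.ne_zero, ?_, ?_, ?_, ?_⟩
  · simpa [Matrix.GeneralLinearGroup.mkOfDetNeZero, mul_comm] using congr($h3.symm 0 0)
  · simpa [Matrix.GeneralLinearGroup.mkOfDetNeZero, mul_comm] using congr($h3.symm 0 1)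
  · simpa [Matrix.GeneralLinearGroup.mkOfDetNeZero, mul_comm] using congr($h3.symm 1 0)
  · simpa [Matrix.GeneralLinearGroup.mkOfDetNeZero, mul_comm] using congr($h3.symm 1 1)

theorem delta_eq (t : Fˣ) : delta t = pgl (t : F) 0 0 1 (by simp) :=
  congr_arg (QuotientGroup.mk (s := Subgroup.center (Matrix.GeneralLinearGroup (Fin 2) F)))
    (Units.ext rfl)

theorem unip_eq (y : F) : unip y = pgl 1 y 0 1 (by simp) :=
  congr_arg (QuotientGroup.mk (s := Subgroup.center (Matrix.GeneralLinearGroup (Fin 2) F)))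
    (Units.ext rfl)

variable (F) in
/-- The class of the nontrivial permutation matrix. -/
def weyl : PGL2 F := pgl 0 1 1 0 (by simp)

/-- The class of a lower triangular unipotent matrix. -/
def lowerUnip (z : F) : PGL2 F := pgl 1 0 z 1 (by simp)

theorem one_eq_pgl : (1 : PGL2 F) = pgl 1 0 0 1 (by simp) := by
  rw [← map_one delta, delta_eq]
  simp

theorem weyl_mul_weyl : weyl F * weyl F = 1 := by
  rw [weyl, pgl_mul, one_eq_pgl]
  exact pgl_eq_pgl 1 (by simp) (by simp) (by simp) (by simp)

theorem weyl_inv : (weyl F)⁻¹ = weyl F := inv_eq_of_mul_eq_one_left weyl_mul_weyl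

theorem unip_add (y z : F) : unip (y + z) = unip y * unip z := by
  rw [unip_eq, unip_eq, unip_eq, pgl_mul]
  exact pgl_eq_pgl 1 (by simp) (by simp [add_comm]) (by simp) (by simp)

theorem unip_zero : unip (0 : F) = 1 := by
  rw [unip_eq, one_eq_pgl]

theorem unip_neg (y : F) : unip (-y) = (unip y)⁻¹ := by
  refine eq_inv_of_mul_eq_one_left ?_
  rw [← unip_add, neg_add_cancel, unip_zero]

theorem lowerUnip_eq (z : F) : lowerUnip z = weyl F * unip z * weyl F := by
  rw [lowerUnip, weyl, unip_eq, pgl_mul, pgl_mul]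
  exact pgl_eq_pgl 1 (by simp) (by simp) (by simp) (by simp)

theorem lowerUnip_mul_delta (z : F) (s : Fˣ) :
    lowerUnip z * delta s = delta s * lowerUnip (z * s) := by
  rw [lowerUnip, lowerUnip, delta_eq, pgl_mul, pgl_mul]
  exact pgl_eq_pgl 1 (by simp) (by simp) (by simp) (by simp)

theorem continuous_unip : Continuous (unip : F → PGL2 F) := by
  refine continuous_quotient_mk'.comp ?_
  rw [Units.continuous_iff]
  constructor
  · refine continuous_matrix ?_
    intro i j
    fin_cases i <;> fin_cases j <;> simp <;> fun_prop
  · refine continuous_matrix ?_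
    intro i j
    fin_cases i <;> fin_cases j <;> simp <;> fun_prop

open Classical in
/-- The unit attached to a nonzero element of a field. -/
noncomputable def unitOf (x : F) : Fˣ := if h : x = 0 then 1 else Units.mk0 x h

theorem val_unitOf {x : F} (h : x ≠ 0) : (unitOf x : F) = x := by
  rw [unitOf, dif_neg h, Units.val_mk0]

theorem unitOf_val (x : Fˣ) : unitOf (x : F) = x := Units.ext (val_unitOf x.ne_zero)

theorem pgl_decomposition (a b c d : F) (h) (hd : d ≠ 0) : pgl a b c d h =
    unip (b / d) * delta (unitOf ((a * d - b * c) / d ^ 2)) * lowerUnip (c / d) := by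
  rw [unip_eq, delta_eq, lowerUnip, pgl_mul, pgl_mul]
  refine pgl_eq_pgl d⁻¹ ?_ ?_ ?_ ?_ <;>
    simp only [val_unitOf (div_ne_zero h (pow_ne_zero 2 hd))] <;> field_simp <;> ring

end PGL

/-! ### The cell `B w N₀` -/

section Cell

variable {F : Type u} [NontriviallyNormedField F]

open Classical in
/-- The torus component of an element of `B w N₀`, and nothing outside of this set. -/
noncomputable def cellTorus (g : PGL2 F) : Option Fˣ :=
  if h : ∃ t y z, ‖z‖ ≤ 1 ∧ g = delta t * unip y * weyl F * unip z then some h.choose else none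

theorem delta_unip_weyl_unip (t : Fˣ) (y z : F) : delta t * unip y * weyl F * unip z =
    pgl (t * y) (t * y * z + t) 1 z (by ring_nf; simp) := by
  rw [delta_eq, unip_eq, unip_eq, weyl, pgl_mul, pgl_mul, pgl_mul]
  exact pgl_eq_pgl 1 (by simp) (by simp) (by simp) (by simp)

theorem pgl_mem_cell (a b c d : F) (h) (hc : c ≠ 0) : pgl a b c d h =
    delta (unitOf (-(a * d - b * c) / c ^ 2)) * unip (a / c / (unitOf (-(a * d - b * c) / c ^ 2)))
      * weyl F * unip (d / c) := by
  have h1 : -(a * d - b * c) / c ^ 2 ≠ 0 := div_ne_zero (neg_ne_zero.2 h) (pow_ne_zero 2 hc)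
  rw [delta_unip_weyl_unip]
  have h2 : (unitOf (-(a * d - b * c) / c ^ 2) : F) = -(a * d - b * c) / c ^ 2 := val_unitOf h1
  refine pgl_eq_pgl c⁻¹ ?_ ?_ ?_ ?_
  · field_simp
  · rw [mul_div_cancel₀ _ (Units.ne_zero _), h2]
    field_simp
    ring
  · field_simp
  · field_simp

open Classical in
theorem cellTorus_pgl (a b c d : F) (h) : cellTorus (pgl a b c d h) =
    if ‖d‖ ≤ ‖c‖ then some (unitOf (-(a * d - b * c) / c ^ 2)) else none := by
  have key : ∀ t y z, pgl a b c d h = delta t * unip y * weyl F * unip z →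
      c ≠ 0 ∧ d = c * z ∧ t = unitOf (-(a * d - b * c) / c ^ 2) := by
    intro t y z he
    rw [delta_unip_weyl_unip] at he
    obtain ⟨l, hl, h1, h2, h3, h4⟩ := pgl_eq_iff he.symm
    rw [mul_one] at h3
    subst h3
    refine ⟨hl, h4, Units.ext ?_⟩
    rw [val_unitOf (div_ne_zero (neg_ne_zero.2 h) (pow_ne_zero 2 hl)), h1, h2, h4]
    field_simp
    ring
  rw [cellTorus]
  split_ifs with h1 h2 h2
  · obtain ⟨y, z, hz, he⟩ := h1.choose_spec
    rw [← (key _ _ _ he).2.2]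
  · refine absurd ?_ h2
    obtain ⟨t, y, z, hz, he⟩ := h1
    rw [(key _ _ _ he).2.1, norm_mul]
    exact mul_le_of_le_one_right (norm_nonneg _) hz
  · refine absurd ?_ h1
    have hc : c ≠ 0 := by
      rintro rfl
      rw [norm_zero, norm_le_zero_iff] at h2
      subst h2
      simp at h
    refine ⟨_, _, _, ?_, pgl_mem_cell a b c d h hc⟩
    rw [norm_div]
    exact div_le_one_of_le₀ h2 (norm_nonneg _)
  · rfl

theorem exists_of_cellTorus_eq_some {g : PGL2 F} {t : Fˣ} (h : cellTorus g = some t) :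
    ∃ y z, ‖z‖ ≤ 1 ∧ g = delta t * unip y * weyl F * unip z := by
  rw [cellTorus] at h
  split_ifs at h with h1
  obtain rfl := Option.some_injective _ h
  exact h1.choose_spec

theorem cellTorus_delta_unip_weyl_unip (t : Fˣ) (y z : F) (hz : ‖z‖ ≤ 1) :
    cellTorus (delta t * unip y * weyl F * unip z) = some t := by
  rw [delta_unip_weyl_unip, cellTorus_pgl, if_pos (by simpa using hz)]
  refine congr_arg some ?_
  rw [← unitOf_val t]
  congr 1
  rw [unitOf_val]
  ring

theorem cellTorus_delta_unip_mul (t : Fˣ) (y : F) (g : PGL2 F) :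
    cellTorus (delta t * unip y * g) = (cellTorus g).map (t * ·) := by
  obtain ⟨a, b, c, d, h, rfl⟩ := pgl_surjective g
  rw [delta_eq, unip_eq, pgl_mul, pgl_mul, cellTorus_pgl, cellTorus_pgl]
  simp only [mul_zero, zero_mul, mul_one, one_mul, add_zero, zero_add]
  split_ifs with h1
  · have hc : c ≠ 0 := by
      rintro rfl
      rw [norm_zero, norm_le_zero_iff] at h1
      subst h1
      simp at h
    rw [Option.map_some]
    refine congr_arg some (Units.ext ?_)
    rw [Units.val_mul, val_unitOf, val_unitOf]
    · field_simp
      ring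
    · exact div_ne_zero (neg_ne_zero.2 h) (pow_ne_zero 2 hc)
    · refine div_ne_zero (neg_ne_zero.2 ?_) (pow_ne_zero 2 hc)
      convert mul_ne_zero t.ne_zero h using 1
      ring
  · rfl

theorem cellTorus_mul_unip [IsUltrametricDist F] (g : PGL2 F) (z : F) (hz : ‖z‖ ≤ 1) :
    cellTorus (g * unip z) = cellTorus g := by
  have key : ∀ (g : PGL2 F) (z : F), ‖z‖ ≤ 1 → ∀ t, cellTorus g = some t →
      cellTorus (g * unip z) = some t := by
    intro g z hz t h
    obtain ⟨y, z', hz', rfl⟩ := exists_of_cellTorus_eq_some h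
    rw [mul_assoc, ← unip_add]
    exact cellTorus_delta_unip_weyl_unip _ _ _
      ((IsUltrametricDist.norm_add_le_max _ _).trans (max_le hz' hz))
  refine Option.ext fun t => ⟨fun h => ?_, key g z hz t⟩
  have := key _ (-z) (by rwa [norm_neg]) t h
  rwa [unip_neg, mul_inv_cancel_right] at this

end Cell

end OrdCoh

namespace OrdCoh

section Cosets

variable {F : Type u} [NontriviallyNormedField F] [IsUltrametricDist F]

theorem cellTorus_weyl_unip_delta (x : F) (s : Fˣ) :
    cellTorus (weyl F * unip x * delta s) = if ‖x‖ ≤ ‖(s : F)‖ then some s⁻¹ else none := by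
  have h : weyl F * unip x * delta s = pgl 0 1 (s : F) x (by simp) := by
    rw [delta_eq, unip_eq, weyl, pgl_mul, pgl_mul]
    exact pgl_eq_pgl 1 (by simp) (by simp) (by simp) (by simp)
  rw [h, cellTorus_pgl]
  congr 2
  rw [← unitOf_val s⁻¹]
  congr 1
  rw [Units.val_inv_eq_inv_val]
  field_simp
  ring

theorem cellTorus_mul_unip_delta (g : PGL2 F) (q : F) (hq : ‖q‖ ≤ 1) (s : Fˣ)
    (hs : ‖(s : F)‖ ≤ 1) (h : cellTorus g = none) :
    cellTorus (g * (unip q * delta s)) = none := by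
  rw [← mul_assoc]
  rw [← cellTorus_mul_unip g q hq] at h
  generalize g * unip q = g at h
  obtain ⟨a, b, c, d, h', rfl⟩ := pgl_surjective g
  rw [delta_eq, pgl_mul, cellTorus_pgl]
  rw [cellTorus_pgl] at h
  split_ifs at h with h1
  refine if_neg fun h2 => h1 ?_
  simp only [mul_zero, zero_add, mul_one, add_zero, norm_mul] at h2
  exact h2.trans (mul_le_of_le_one_right (norm_nonneg _) hs)

/-- The representative of a residue class. -/
noncomputable def Residues.rep {t : Fˣ} (q : Residues t) : F := (Quotient.out q : ballGroup (1 : Fˣ))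

theorem Residues.norm_rep_le {t : Fˣ} (q : Residues t) : ‖q.rep‖ ≤ 1 := by
  have := (Quotient.out q : ballGroup (1 : Fˣ)).2
  rwa [mem_ballGroup, Units.val_one, norm_one] at this

theorem Residues.exists_rep {t : Fˣ} (y : F) (hy : ‖y‖ ≤ 1) :
    ∃ q : Residues t, ‖y - q.rep‖ ≤ ‖(t : F)‖ := by
  let y' : ballGroup (1 : Fˣ) := ⟨y, by rw [mem_ballGroup]; simpa using hy⟩
  refine ⟨QuotientAddGroup.mk y', ?_⟩
  have h := QuotientAddGroup.eq.1 (QuotientAddGroup.out_eq' (QuotientAddGroup.mk y' : Residues t))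
  rw [AddSubgroup.mem_addSubgroupOf, mem_ballGroup] at h
  rw [sub_eq_neg_add]
  exact h

theorem Residues.eq_of_norm_sub_le {t : Fˣ} (q q' : Residues t)
    (h : ‖q.rep - q'.rep‖ ≤ ‖(t : F)‖) : q = q' := by
  rw [← QuotientAddGroup.out_eq' q, ← QuotientAddGroup.out_eq' q']
  refine QuotientAddGroup.eq.2 ?_
  rw [AddSubgroup.mem_addSubgroupOf, mem_ballGroup]
  rw [← norm_neg] at h
  rw [neg_sub] at h
  rw [← sub_eq_neg_add]
  exact h

theorem norm_sub_le_max (x y : F) : ‖x - y‖ ≤ max ‖x‖ ‖y‖ := by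
  rw [sub_eq_add_neg, ← norm_neg y]
  exact IsUltrametricDist.norm_add_le_max x (-y)

variable [ProperSpace F]

variable (F) in
theorem uniformizer_norm_lt : ‖(uniformizer F : F)‖ < 1 := (uniformizer_spec F).1

variable (F) in
theorem uniformizer_norm_pos : 0 < ‖(uniformizer F : F)‖ := norm_pos_iff.2 (uniformizer F).ne_zero

/-- Indices for a partition of the projective line into balls. -/
abbrev CosetIndex (F : Type u) [NontriviallyNormedField F] [IsUltrametricDist F] [ProperSpace F]
    (m : ℕ) := Residues (uniformizer F ^ (m + 1)) ⊕ Residues (uniformizer F ^ m)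

/-- The centre of the ball attached to an index. -/
noncomputable def cosetRep {m : ℕ} : CosetIndex F m → PGL2 F
  | .inl q => unip q.rep
  | .inr q => weyl F * unip (uniformizer F * q.rep)

/-- The elements `unip y` and `w unip y` which move the cell to the two standard charts. -/
inductive IsChart : PGL2 F → Prop
  | ofUnip (y : F) (hy : ‖y‖ ≤ 1) : IsChart (unip y)
  | ofWeylUnip (y : F) (hy : ‖y‖ < 1) : IsChart (weyl F * unip y)

theorem norm_uniformizer_mul_rep_lt {t : Fˣ} (q : Residues t) :
    ‖(uniformizer F : F) * q.rep‖ < 1 := by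
  rw [norm_mul]
  exact (mul_le_of_le_one_right (norm_nonneg _) q.norm_rep_le).trans_lt (uniformizer_norm_lt F)

theorem norm_inv_uniformizer_mul_le {y : F} (hy : ‖y‖ < 1) : ‖(uniformizer F : F)⁻¹ * y‖ ≤ 1 := by
  rw [norm_mul, norm_inv]
  exact inv_mul_le_one_of_le₀ ((uniformizer_spec F).2 y hy) (norm_nonneg _)

theorem norm_uniformizer_mul_le_iff {m : ℕ} {x : F} :
    ‖(uniformizer F : F) * x‖ ≤ ‖((uniformizer F ^ (m + 1) : Fˣ) : F)‖ ↔
      ‖x‖ ≤ ‖((uniformizer F ^ m : Fˣ) : F)‖ := by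
  rw [pow_succ', Units.val_mul, norm_mul, norm_mul,
    mul_le_mul_iff_right₀ (uniformizer_norm_pos F)]

theorem IsChart.exists_cosetRep {c : PGL2 F} (hc : IsChart c) (m : ℕ) :
    ∃ (j : CosetIndex F m) (z : F), ‖z‖ ≤ ‖((uniformizer F ^ (m + 1) : Fˣ) : F)‖ ∧
      c = cosetRep j * unip z := by
  rcases hc with ⟨y, hy⟩ | ⟨y, hy⟩
  · obtain ⟨q, hq⟩ := Residues.exists_rep (t := uniformizer F ^ (m + 1)) y hy
    refine ⟨.inl q, _, hq, ?_⟩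
    rw [cosetRep, ← unip_add, add_sub_cancel]
  · obtain ⟨q, hq⟩ := Residues.exists_rep (t := uniformizer F ^ m) _
      (norm_inv_uniformizer_mul_le hy)
    rw [← norm_uniformizer_mul_le_iff] at hq
    refine ⟨.inr q, _, hq, ?_⟩
    rw [cosetRep, mul_assoc, ← unip_add]
    congr 2
    rw [mul_sub, mul_inv_cancel_left₀ (uniformizer F).ne_zero, add_sub_cancel]

theorem pgl_mul_unip_delta (a b c d : F) (h) (q : F) (s : Fˣ) :
    ∃ h', pgl a b c d h * (unip q * delta s) = pgl (a * s) (a * q + b) (c * s) (c * q + d) h' := by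
  refine ⟨?_, ?_⟩
  · convert mul_ne_zero h s.ne_zero using 1
    ring
  · rw [unip_eq, delta_eq, pgl_mul, pgl_mul]
    exact pgl_eq_pgl 1 (by simp) (by simp) (by simp) (by simp)

theorem pgl_mul_weyl (a b c d : F) (h) :
    ∃ h', pgl a b c d h * weyl F = pgl b a d c h' := by
  refine ⟨?_, ?_⟩
  · convert neg_ne_zero.2 h using 1
    ring
  · rw [weyl, pgl_mul]
    exact pgl_eq_pgl 1 (by simp) (by simp) (by simp) (by simp)

theorem cellTorus_pgl_ne_none (a b c d : F) (h) : cellTorus (pgl a b c d h) ≠ none ↔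
    ‖d‖ ≤ ‖c‖ := by
  rw [cellTorus_pgl]
  split_ifs with h1 <;> simp [h1]

/-- The balls form a partition. -/
theorem existsUnique_cosetRep (g : PGL2 F) (m : ℕ) : ∃! j : CosetIndex F m,
    cellTorus (g * (cosetRep j * delta (uniformizer F ^ (m + 1)))) ≠ none := by
  obtain ⟨a, b, c, d, h, rfl⟩ := pgl_surjective g
  have hl : ∀ q : Residues (uniformizer F ^ (m + 1)), cellTorus (pgl a b c d h *
      (cosetRep (.inl q : CosetIndex F m) * delta (uniformizer F ^ (m + 1)))) ≠ none ↔
      ‖c * q.rep + d‖ ≤ ‖c‖ * ‖((uniformizer F ^ (m + 1) : Fˣ) : F)‖ := by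
    intro q
    obtain ⟨h', he⟩ := pgl_mul_unip_delta a b c d h q.rep (uniformizer F ^ (m + 1))
    rw [cosetRep, he, cellTorus_pgl_ne_none, norm_mul c]
  have hr : ∀ q : Residues (uniformizer F ^ m), cellTorus (pgl a b c d h *
      (cosetRep (.inr q : CosetIndex F m) * delta (uniformizer F ^ (m + 1)))) ≠ none ↔
      ‖d * (uniformizer F * q.rep) + c‖ ≤ ‖d‖ * ‖((uniformizer F ^ (m + 1) : Fˣ) : F)‖ := by
    intro q
    obtain ⟨h1, he1⟩ := pgl_mul_weyl a b c d h
    obtain ⟨h', he⟩ := pgl_mul_unip_delta b a d c h1 (uniformizer F * q.rep)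
      (uniformizer F ^ (m + 1))
    rw [cosetRep, mul_assoc, ← mul_assoc (pgl a b c d h), he1, he, cellTorus_pgl_ne_none,
      norm_mul d]
  have hlt : ‖((uniformizer F ^ (m + 1) : Fˣ) : F)‖ < 1 := by
    rw [Units.val_pow_eq_pow_val, norm_pow]
    exact pow_lt_one₀ (norm_nonneg _) (uniformizer_norm_lt F) m.succ_ne_zero
  rcases le_or_gt ‖d‖ ‖c‖ with hdc | hdc
  · have hc : c ≠ 0 := by
      rintro rfl
      rw [norm_zero, norm_le_zero_iff] at hdc
      subst hdc
      simp at h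
    have hc' := norm_pos_iff.2 hc
    have hl' : ∀ q : Residues (uniformizer F ^ (m + 1)), ‖c * q.rep + d‖ ≤
        ‖c‖ * ‖((uniformizer F ^ (m + 1) : Fˣ) : F)‖ ↔
        ‖-(d / c) - q.rep‖ ≤ ‖((uniformizer F ^ (m + 1) : Fˣ) : F)‖ := by
      intro q
      have : c * q.rep + d = c * -(-(d / c) - q.rep) := by field_simp; ring
      rw [this, norm_mul, norm_neg, mul_le_mul_iff_right₀ hc']
    obtain ⟨q, hq⟩ := Residues.exists_rep (t := uniformizer F ^ (m + 1)) (-(d / c)) (by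
      rw [norm_neg, norm_div]
      exact div_le_one_of_le₀ hdc (norm_nonneg _))
    refine ⟨.inl q, (hl q).2 ((hl' q).2 hq), ?_⟩
    rintro (q' | q') hq'
    · replace hq' := (hl' q').1 ((hl q').1 hq')
      congr 1
      refine Residues.eq_of_norm_sub_le _ _ ?_
      have : q'.rep - q.rep = (-(d / c) - q.rep) - (-(d / c) - q'.rep) := by ring
      rw [this]
      exact (norm_sub_le_max _ _).trans (max_le hq hq')
    · replace hq' := (hr q').1 hq'
      exfalso
      have h1 : ‖d * (uniformizer F * q'.rep)‖ < ‖c‖ := by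
        rw [norm_mul]
        rcases eq_or_ne d 0 with rfl | hd
        · simpa using hc'
        · exact (mul_lt_of_lt_one_right (norm_pos_iff.2 hd)
            (norm_uniformizer_mul_rep_lt q')).trans_le hdc
      rw [IsUltrametricDist.norm_add_eq_max_of_norm_ne_norm h1.ne, max_eq_right h1.le] at hq'
      rcases eq_or_ne d 0 with rfl | hd
      · simp at hq'
        exact hc hq'
      · exact absurd hq' (not_le.2 ((mul_lt_of_lt_one_right (norm_pos_iff.2 hd) hlt).trans_le hdc))
  · have hd : 0 < ‖d‖ := (norm_nonneg _).trans_lt hdc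
    have hd' := norm_pos_iff.1 hd
    have hr' : ∀ q : Residues (uniformizer F ^ m), ‖d * (uniformizer F * q.rep) + c‖ ≤
        ‖d‖ * ‖((uniformizer F ^ (m + 1) : Fˣ) : F)‖ ↔
        ‖-((uniformizer F : F)⁻¹ * (c / d)) - q.rep‖ ≤ ‖((uniformizer F ^ m : Fˣ) : F)‖ := by
      intro q
      have h0 := (uniformizer F).ne_zero
      have : d * (uniformizer F * q.rep) + c =
          d * -((uniformizer F : F) * (-((uniformizer F : F)⁻¹ * (c / d)) - q.rep)) := by
        field_simp
        ring
      rw [this, norm_mul, norm_neg, mul_le_mul_iff_right₀ hd, norm_uniformizer_mul_le_iff]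
    obtain ⟨q, hq⟩ := Residues.exists_rep (t := uniformizer F ^ m)
      (-((uniformizer F : F)⁻¹ * (c / d))) (by
        rw [norm_neg]
        refine norm_inv_uniformizer_mul_le ?_
        rwa [norm_div, div_lt_one hd])
    refine ⟨.inr q, (hr q).2 ((hr' q).2 hq), ?_⟩
    rintro (q' | q') hq'
    · replace hq' := (hl q').1 hq'
      exfalso
      have h1 : ‖c * q'.rep‖ < ‖d‖ := by
        rw [norm_mul]
        exact (mul_le_of_le_one_right (norm_nonneg _) q'.norm_rep_le).trans_lt hdc
      rw [IsUltrametricDist.norm_add_eq_max_of_norm_ne_norm h1.ne, max_eq_right h1.le] at hq'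
      exact absurd hq' (not_le.2 ((mul_le_of_le_one_right (norm_nonneg _) hlt.le).trans_lt hdc))
    · replace hq' := (hr' q').1 ((hr q').1 hq')
      congr 1
      refine Residues.eq_of_norm_sub_le _ _ ?_
      have : q'.rep - q.rep = (-((uniformizer F : F)⁻¹ * (c / d)) - q.rep) -
        (-((uniformizer F : F)⁻¹ * (c / d)) - q'.rep) := by ring
      rw [this]
      exact (norm_sub_le_max _ _).trans (max_le hq hq')

/-- The translates of the charts by a fixed element are uniformly close to charts. -/
theorem exists_bound_mul_unip (g : PGL2 F) : ∃ B : ℝ, ∀ q : F, ‖q‖ ≤ 1 →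
    ∃ (c : PGL2 F) (t : Fˣ) (z : F), IsChart c ∧ ‖(t : F)‖ ≤ B ∧ ‖z‖ ≤ B ∧
      g * unip q = c * delta t * lowerUnip z := by
  obtain ⟨a, b, c, d, h, rfl⟩ := pgl_surjective g
  have hD := norm_pos_iff.2 h
  have key : ∀ a c β δ' : F, ∀ hh : a * δ' - β * c ≠ 0, ‖β‖ ≤ ‖δ'‖ →
      ∃ (t : Fˣ) (z : F), ‖(t : F)‖ ≤ (‖a‖ + ‖c‖) ^ 2 / ‖a * δ' - β * c‖ ∧
        ‖z‖ ≤ (‖a‖ + ‖c‖) ^ 2 / ‖a * δ' - β * c‖ ∧ δ' ≠ 0 ∧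
        pgl a β c δ' hh = unip (β / δ') * delta t * lowerUnip z := by
    intro a c β δ' hh hle
    have hδ : δ' ≠ 0 := by
      rintro rfl
      rw [norm_zero, norm_le_zero_iff] at hle
      subst hle
      simp at hh
    have hδ' := norm_pos_iff.2 hδ
    have hD := norm_pos_iff.2 hh
    have hA : ‖a * δ' - β * c‖ ≤ (‖a‖ + ‖c‖) * ‖δ'‖ := by
      refine (norm_sub_le _ _).trans ?_
      rw [norm_mul, norm_mul, add_mul, mul_comm ‖β‖]
      gcongr
    refine ⟨_, _, ?_, ?_, hδ, pgl_decomposition a β c δ' hh hδ⟩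
    · rw [val_unitOf (div_ne_zero hh (pow_ne_zero 2 hδ)), norm_div, norm_pow,
        div_le_div_iff₀ (by positivity) hD, ← sq, ← mul_pow]
      gcongr
    · rw [norm_div, div_le_div_iff₀ hδ' hD, sq, mul_assoc]
      gcongr
      exact le_add_of_nonneg_left (norm_nonneg _)
  refine ⟨(‖a‖ + ‖c‖) ^ 2 / ‖a * d - b * c‖, fun q hq => ?_⟩
  have h1 : a * (c * q + d) - (a * q + b) * c ≠ 0 := by
    convert h using 1
    ring
  have h2 : pgl a b c d h * unip q = pgl a (a * q + b) c (c * q + d) h1 := by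
    rw [unip_eq, pgl_mul]
    exact pgl_eq_pgl 1 (by simp) (by simp) (by simp) (by simp)
  rcases le_or_gt ‖a * q + b‖ ‖c * q + d‖ with hle | hlt
  · obtain ⟨t, z, ht, hz, h0, he⟩ := key a c _ _ h1 hle
    have h3 : a * (c * q + d) - (a * q + b) * c = a * d - b * c := by ring
    rw [h3] at ht hz
    refine ⟨_, t, z, .ofUnip _ ?_, ht, hz, h2.trans he⟩
    rw [norm_div]
    exact div_le_one_of_le₀ hle (norm_nonneg _)
  · have h1' : c * (a * q + b) - (c * q + d) * a ≠ 0 := by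
      convert neg_ne_zero.2 h using 1
      ring
    obtain ⟨t, z, ht, hz, h0, he⟩ := key c a _ _ h1' hlt.le
    have h3 : c * (a * q + b) - (c * q + d) * a = -(a * d - b * c) := by ring
    rw [h3, norm_neg, add_comm] at ht hz
    refine ⟨_, t, z, .ofWeylUnip ((c * q + d) / (a * q + b)) ?_, ht, hz, ?_⟩
    · rw [norm_div]
      exact (div_lt_one (norm_pos_iff.2 h0)).2 hlt
    · rw [mul_assoc, mul_assoc, ← mul_assoc (unip _), ← he, h2, weyl, pgl_mul]
      exact pgl_eq_pgl 1 (by simp) (by simp) (by simp) (by simp)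

end Cosets

end OrdCoh

namespace OrdCoh

/-! ### Functions supported on the cell -/

section CellFunction

variable {F : Type u} [NontriviallyNormedField F] [IsUltrametricDist F] {R : Type v} [CommRing R]
  {H : Subgroup Fˣ}

/-- The function on `PGL₂(F)` supported on the cell `B w N₀` attached to a vector. -/
noncomputable def cellFunction (W : Rep.{w} R (QuotBy H)) : W →ₗ[R] (PGL2 F → W) where
  toFun x g := (cellTorus g).elim 0 fun t => W.ρ (QuotBy.mk H t) x
  map_add' x y := by
    ext g
    rw [Pi.add_apply]
    cases cellTorus g <;> simp
  map_smul' c x := by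
    ext g
    rw [Pi.smul_apply]
    cases cellTorus g <;> simp

theorem cellFunction_of_none (W : Rep.{w} R (QuotBy H)) (x : W) {g : PGL2 F}
    (h : cellTorus g = none) : cellFunction W x g = 0 := by
  simp [cellFunction, h]

theorem cellFunction_of_some (W : Rep.{w} R (QuotBy H)) (x : W) {g : PGL2 F} {t : Fˣ}
    (h : cellTorus g = some t) : cellFunction W x g = W.ρ (QuotBy.mk H t) x := by
  simp [cellFunction, h]

theorem cellFunction_delta_unip_mul (W : Rep.{w} R (QuotBy H)) (x : W) (t : Fˣ) (y : F)
    (g : PGL2 F) :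
    cellFunction W x (delta t * unip y * g) = W.ρ (QuotBy.mk H t) (cellFunction W x g) := by
  have h := cellTorus_delta_unip_mul t y g
  cases hg : cellTorus g with
  | none =>
    rw [hg] at h
    rw [cellFunction_of_none W x h, cellFunction_of_none W x hg, map_zero]
  | some s =>
    rw [hg] at h
    rw [cellFunction_of_some W x h, cellFunction_of_some W x hg, ← Module.End.mul_apply, ← map_mul,
      ← map_mul]

/-- The condition that translation by `k` preserves the standard chart and acts on it through
elements of the torus fixing `x`. -/
def FixesChart (W : Rep.{w} R (QuotBy H)) (x : W) (k : PGL2 F) : Prop :=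
  ∀ z : F, ‖z‖ ≤ 1 → ∃ t, cellTorus (weyl F * unip z * k) = some t ∧ W.ρ (QuotBy.mk H t) x = x

theorem FixesChart.cellFunction_mul_of_some {W : Rep.{w} R (QuotBy H)} {x : W} {k : PGL2 F}
    (hk : FixesChart W x k) {g : PGL2 F} {t : Fˣ} (hg : cellTorus g = some t) :
    cellTorus (g * k) ≠ none ∧ cellFunction W x (g * k) = cellFunction W x g := by
  obtain ⟨y, z, hz, rfl⟩ := exists_of_cellTorus_eq_some hg
  obtain ⟨s, hs, hx⟩ := hk z hz
  have h1 : delta t * unip y * weyl F * unip z * k = delta t * unip y * (weyl F * unip z * k) := by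
    simp only [mul_assoc]
  have h2 : delta t * unip y * weyl F * unip z = delta t * unip y * (weyl F * unip z) := by
    simp only [mul_assoc]
  constructor
  · rw [h1, cellTorus_delta_unip_mul, hs]
    simp
  · rw [cellFunction_of_some W x hg, h1, cellFunction_delta_unip_mul, cellFunction_of_some W x hs,
      hx]

theorem cellFunction_mul (W : Rep.{w} R (QuotBy H)) (x : W) (k : PGL2 F)
    (hk : FixesChart W x k) (hk' : FixesChart W x k⁻¹) (g : PGL2 F) :
    cellFunction W x (g * k) = cellFunction W x g := by
  cases hg : cellTorus g with
  | some t => exact (hk.cellFunction_mul_of_some hg).2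
  | none =>
    cases hgk : cellTorus (g * k) with
    | none => rw [cellFunction_of_none W x hg, cellFunction_of_none W x hgk]
    | some t =>
      have := (hk'.cellFunction_mul_of_some hgk).1
      rw [mul_inv_cancel_right] at this
      exact absurd hg this

theorem fixesChart_unip (W : Rep.{w} R (QuotBy H)) (x : W) (y : F) (hy : ‖y‖ ≤ 1) :
    FixesChart W x (unip y) := by
  intro z hz
  refine ⟨1, ?_, by simp⟩
  have := cellTorus_delta_unip_weyl_unip (1 : Fˣ) 0 (z + y)
    ((IsUltrametricDist.norm_add_le_max _ _).trans (max_le hz hy))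
  rwa [map_one, unip_zero, one_mul, one_mul, unip_add, ← mul_assoc] at this

theorem fixesChart_delta (W : Rep.{w} R (QuotBy H)) (x : W) (t : Fˣ) (ht : ‖(t : F)‖ = 1)
    (hx : W.ρ (QuotBy.mk H t) x = x) : FixesChart W x (delta t) := by
  intro z hz
  refine ⟨t⁻¹, ?_, ?_⟩
  · rw [cellTorus_weyl_unip_delta, if_pos (hz.trans ht.ge)]
  · rw [map_inv]
    exact (vectorStabilizer W x).inv_mem hx

theorem fixesChart_lowerUnip (W : Rep.{w} R (QuotBy H)) (x : W) (y : F) (hy : ‖y‖ < 1)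
    (hx : ∀ z : F, ‖z‖ ≤ ‖y‖ → W.ρ (QuotBy.mk H (unitOf (1 / (1 + z) ^ 2))) x = x) :
    FixesChart W x (lowerUnip y) := by
  intro z hz
  have hzy : ‖z * y‖ ≤ ‖y‖ := by
    rw [norm_mul]
    exact mul_le_of_le_one_left (norm_nonneg _) hz
  have h1 : ‖1 + z * y‖ = 1 := by
    have h2 : ‖z * y‖ < ‖(1 : F)‖ := by
      rw [norm_one]
      exact hzy.trans_lt hy
    rw [IsUltrametricDist.norm_add_eq_max_of_norm_ne_norm h2.ne', max_eq_left h2.le, norm_one]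
  refine ⟨_, ?_, hx (z * y) hzy⟩
  have h3 : weyl F * unip z * lowerUnip y = pgl y 1 (1 + z * y) z (by ring_nf; simp) := by
    rw [weyl, unip_eq, lowerUnip, pgl_mul, pgl_mul]
    exact pgl_eq_pgl 1 (by simp) (by simp) (by simp) (by simp)
  rw [h3, cellTorus_pgl, if_pos (by rwa [h1])]
  congr 2
  ring

theorem lowerUnip_neg (z : F) : lowerUnip (-z) = (lowerUnip z)⁻¹ := by
  rw [lowerUnip_eq, lowerUnip_eq, mul_inv_rev, mul_inv_rev, weyl_inv, unip_neg, mul_assoc]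

theorem tendsto_unitOf : Filter.Tendsto (unitOf : F → Fˣ) (nhds 1) (nhds 1) := by
  rw [Units.isEmbedding_val₀.tendsto_nhds_iff]
  have h : ((↑) ∘ unitOf : F → F) =ᶠ[nhds 1] id := by
    filter_upwards [isOpen_ne.mem_nhds (one_ne_zero (α := F))] with x hx
    exact val_unitOf hx
  exact Filter.Tendsto.congr' h.symm Filter.tendsto_id

theorem cellFunction_mem (W : Rep.{w} R (QuotBy H)) (x : W)
    (hx : IsOpen (vectorStabilizer W x : Set (QuotBy H))) :
    cellFunction W x ∈ inducedFunctions W := by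
  let P := Rep.of (rightTranslation (PGL2 F) R W)
  let S : Subgroup (PGL2 F) := vectorStabilizer P (cellFunction W x)
  have hS : ∀ k, FixesChart W x k → FixesChart W x k⁻¹ → k ∈ S := fun k h1 h2 =>
    funext fun g => cellFunction_mul W x k h1 h2 g
  suffices hop : IsOpen (S : Set (PGL2 F)) by
    refine ⟨S, hop, fun t y g k hk => ?_⟩
    have h := congr_fun (show P.ρ k (cellFunction W x) = cellFunction W x from hk)
      (delta t * unip y * g)
    exact h.trans (cellFunction_delta_unip_mul W x t y g)
  let U : Subgroup Fˣ := (vectorStabilizer W x).comap (QuotBy.mk H) ⊓ unitGroup F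
  have hU : (U : Set Fˣ) ∈ nhds 1 :=
    IsOpen.mem_nhds (((QuotBy.isOpen_iff _).1 hx).inter isOpen_unitGroup) U.one_mem
  have hlow : ∀ᶠ z in nhds (0 : F), lowerUnip z ∈ S := by
    have h1 : Filter.Tendsto (fun z : F => unitOf (1 / (1 + z) ^ 2)) (nhds 0) (nhds 1) := by
      refine tendsto_unitOf.comp ?_
      have : ContinuousAt (fun z : F => 1 / (1 + z) ^ 2) 0 := by
        refine ContinuousAt.div continuousAt_const (by fun_prop) (by simp)
      simpa [ContinuousAt] using this
    obtain ⟨ε, hε, h2⟩ := Metric.eventually_nhds_iff.1 (h1.eventually hU)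
    filter_upwards [Metric.ball_mem_nhds (0 : F) hε, Metric.ball_mem_nhds (0 : F) one_pos]
      with y hy1 hy2
    rw [mem_ball_zero_iff] at hy1 hy2
    have h3 : ∀ y : F, ‖y‖ < ε → ‖y‖ < 1 → FixesChart W x (lowerUnip y) := fun y hy1 hy2 =>
      fixesChart_lowerUnip W x y hy2 fun z hz =>
        (h2 (y := z) (by rw [dist_zero_right]; exact hz.trans_lt hy1)).1
    refine hS _ (h3 y hy1 hy2) ?_
    rw [← lowerUnip_neg]
    exact h3 _ (by rwa [norm_neg]) (by rwa [norm_neg])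
  have hunip : ∀ y : F, ‖y‖ ≤ 1 → unip y ∈ S := fun y hy =>
    hS _ (fixesChart_unip W x y hy) (unip_neg y ▸ fixesChart_unip W x _ (by rwa [norm_neg]))
  have hdelta : ∀ t ∈ U, delta t ∈ S := fun t ht =>
    hS _ (fixesChart_delta W x t ht.2 ht.1)
      (map_inv delta t ▸ fixesChart_delta W x _ (U.inv_mem ht).2 (U.inv_mem ht).1)
  refine Subgroup.isOpen_of_mem_nhds S (g := 1) ?_
  have hc : ∀ i j, Continuous fun M : Matrix.GeneralLinearGroup (Fin 2) F => M.1 i j := fun i j =>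
    Units.continuous_val.matrix_elem i j
  have h1 : ∀ᶠ M : Matrix.GeneralLinearGroup (Fin 2) F in nhds 1,
      (QuotientGroup.mk M : PGL2 F) ∈ S := by
    have e0 : ∀ᶠ M : Matrix.GeneralLinearGroup (Fin 2) F in nhds 1, M.1 1 1 ≠ 0 :=
      (hc 1 1).continuousAt.eventually_ne (by simp)
    have e1 : ∀ᶠ M : Matrix.GeneralLinearGroup (Fin 2) F in nhds 1, unip (M.1 0 1 / M.1 1 1) ∈ S := by
      have : ContinuousAt (fun M : Matrix.GeneralLinearGroup (Fin 2) F => M.1 0 1 / M.1 1 1) 1 :=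
        (hc 0 1).continuousAt.div (hc 1 1).continuousAt (by simp)
      refine this.eventually (p := fun y => unip y ∈ S) ?_
      simp only [Units.val_one, Matrix.one_apply_eq, ne_eq, zero_ne_one, not_false_eq_true,
        Matrix.one_apply_ne, zero_div]
      filter_upwards [Metric.closedBall_mem_nhds (0 : F) one_pos] with y hy
      exact hunip y (by simpa using hy)
    have e2 : ∀ᶠ M : Matrix.GeneralLinearGroup (Fin 2) F in nhds 1,
        lowerUnip (M.1 1 0 / M.1 1 1) ∈ S := by
      have : ContinuousAt (fun M : Matrix.GeneralLinearGroup (Fin 2) F => M.1 1 0 / M.1 1 1) 1 :=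
        (hc 1 0).continuousAt.div (hc 1 1).continuousAt (by simp)
      refine this.eventually (p := fun y => lowerUnip y ∈ S) ?_
      simpa using hlow
    have e3 : ∀ᶠ M : Matrix.GeneralLinearGroup (Fin 2) F in nhds 1,
        unitOf ((M.1 0 0 * M.1 1 1 - M.1 0 1 * M.1 1 0) / M.1 1 1 ^ 2) ∈ U := by
      have : ContinuousAt (fun M : Matrix.GeneralLinearGroup (Fin 2) F =>
          (M.1 0 0 * M.1 1 1 - M.1 0 1 * M.1 1 0) / M.1 1 1 ^ 2) 1 :=
        ((((hc 0 0).mul (hc 1 1)).sub ((hc 0 1).mul (hc 1 0))).continuousAt).div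
          ((hc 1 1).pow 2).continuousAt (by simp)
      refine this.eventually (p := fun y => unitOf y ∈ U) ?_
      have h0 : ∀ᶠ y : F in nhds 1, unitOf y ∈ U := tendsto_unitOf.eventually hU
      simpa using h0
    filter_upwards [e0, e1, e2, e3] with M h0 h1 h2 h3
    have hd : M.1 0 0 * M.1 1 1 - M.1 0 1 * M.1 1 0 ≠ 0 := by
      rw [← Matrix.det_fin_two]
      exact (Matrix.GeneralLinearGroup.det M).ne_zero
    have hM : (QuotientGroup.mk M : PGL2 F) = pgl _ _ _ _ hd :=
      congr_arg _ (Units.ext (Matrix.eta_fin_two _))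
    rw [hM, pgl_decomposition _ _ _ _ hd h0]
    exact S.mul_mem (S.mul_mem h1 (hdelta _ h3)) h2
  have h2 := QuotientGroup.isOpenMap_coe
    (N := Subgroup.center (Matrix.GeneralLinearGroup (Fin 2) F)) |>.image_mem_nhds h1
  refine Filter.mem_of_superset h2 ?_
  rintro _ ⟨M, hM, rfl⟩
  exact hM

/-- The map attaching to a vector a function supported on the cell. -/
noncomputable def cellMap (W : Rep.{w} R (QuotBy H)) (hW : IsSmooth W) : W →ₗ[R] indRep W :=
  (cellFunction W).codRestrict (inducedFunctions W) fun x => cellFunction_mem W x (hW x)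

end CellFunction

end OrdCoh

namespace OrdCoh

universe w'

/-! ### Hecke equivariant maps and parabolic induction -/

section HeckeMap

variable {F : Type u} [NontriviallyNormedField F] [IsUltrametricDist F] [ProperSpace F]
  {R : Type v} [CommRing R] {H : Subgroup Fˣ}

noncomputable instance (t : Fˣ) : Fintype (Residues t) := Fintype.ofFinite _

/-- The linear maps from `W` to the `N₀`-fixed vectors of `V` under which the Hecke operator of `s`
corresponds to the action of `s⁻¹`. -/
structure IsHeckeMap (W : Rep.{w'} R (QuotBy H)) (V : Rep.{w} R (PGL2 F)) (θ : W →ₗ[R] V) :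
    Prop where
  fixed (x : W) : θ x ∈ unipotentFixed V
  hecke (s : Fˣ) (hs : ‖(s : F)‖ ≤ 1) (x : W) :
    heckeOp V s (θ x) = θ (W.ρ (QuotBy.mk H s⁻¹) x)

theorem heckeOp_apply (V : Rep.{w} R (PGL2 F)) (s : Fˣ) (x : V) :
    heckeOp V s x = ∑ q : Residues s, V.ρ (unip q.rep * delta s) x := by
  rw [heckeOp, finsum_eq_sum_of_fintype, LinearMap.sum_apply]
  rfl

variable {W : Rep.{w'} R (QuotBy H)} {V : Rep.{w} R (PGL2 F)} {θ : W →ₗ[R] V}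

theorem IsHeckeMap.eq_sum (h : IsHeckeMap W V θ) (s : Fˣ) (hs : ‖(s : F)‖ ≤ 1) (x : W) :
    θ x = ∑ q : Residues s, V.ρ (unip q.rep * delta s) (θ (W.ρ (QuotBy.mk H s) x)) := by
  rw [← heckeOp_apply, h.hecke s hs, ← Module.End.mul_apply, ← map_mul, ← map_mul,
    inv_mul_cancel, map_one, map_one]
  rfl

/-- The linear map from tuples indexed by balls of a given radius. -/
noncomputable def chartMap (θ : W →ₗ[R] V) (m : ℕ) : (CosetIndex F m → W) →ₗ[R] V :=
  ∑ j, V.ρ (cosetRep j * delta (uniformizer F ^ (m + 1))) ∘ₗ θ ∘ₗ LinearMap.proj j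

theorem chartMap_apply (θ : W →ₗ[R] V) (m : ℕ) (x : CosetIndex F m → W) : chartMap θ m x =
    ∑ j, V.ρ (cosetRep j * delta (uniformizer F ^ (m + 1))) (θ (x j)) := by
  rw [chartMap, LinearMap.sum_apply]
  rfl

theorem map_chartMap {V' : Rep.{w} R (PGL2 F)} (f : V ⟶ V') (m : ℕ) (x : CosetIndex F m → W) :
    f.hom (chartMap θ m x) = chartMap (f.hom.toLinearMap ∘ₗ θ) m x := by
  rw [chartMap_apply, chartMap_apply, map_sum]
  exact Finset.sum_congr rfl fun j _ => Rep.hom_comm_apply f _ _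

theorem IsHeckeMap.chart_mem_range (h : IsHeckeMap W V θ) {c : PGL2 F} (hc : IsChart c) (m : ℕ)
    (x : W) : V.ρ (c * delta (uniformizer F ^ (m + 1))) (θ x) ∈ LinearMap.range (chartMap θ m) := by
  classical
  obtain ⟨j, z, hz, rfl⟩ := hc.exists_cosetRep m
  set s := uniformizer F ^ (m + 1)
  have h1 : cosetRep j * unip z * delta s =
      cosetRep j * delta s * unip (((s⁻¹ : Fˣ) : F) * z) := by
    rw [mul_assoc, mul_assoc, delta_mul_unip, Units.mul_inv_cancel_left]
  refine ⟨Pi.single j x, ?_⟩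
  rw [chartMap_apply, Finset.sum_eq_single j, Pi.single_eq_same, h1, map_mul _ _ (unip _),
    Module.End.mul_apply, h.fixed]
  · rw [norm_mul, Units.val_inv_eq_inv_val, norm_inv]
    exact inv_mul_le_one_of_le₀ hz (norm_nonneg _)
  · intro i _ hi
    rw [Pi.single_eq_of_ne hi, map_zero, map_zero]
  · simp

theorem IsChart.mul_unip {c : PGL2 F} (hc : IsChart c) (y : F) (hy : ‖y‖ < 1) :
    IsChart (c * unip y) := by
  rcases hc with ⟨z, hz⟩ | ⟨z, hz⟩
  · rw [← unip_add]
    exact .ofUnip _ ((IsUltrametricDist.norm_add_le_max _ _).trans (max_le hz hy.le))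
  · rw [mul_assoc, ← unip_add]
    exact .ofWeylUnip _ ((IsUltrametricDist.norm_add_le_max _ _).trans_lt (max_lt hz hy))

theorem IsHeckeMap.chart_delta_mem_range (h : IsHeckeMap W V θ) {c : PGL2 F} (hc : IsChart c)
    (s : Fˣ) (hs : ‖(s : F)‖ < 1) (m : ℕ)
    (hm : ‖((uniformizer F ^ (m + 1) : Fˣ) : F)‖ ≤ ‖(s : F)‖) (x : W) :
    V.ρ (c * delta s) (θ x) ∈ LinearMap.range (chartMap θ m) := by
  set t := uniformizer F ^ (m + 1) with ht
  rw [h.eq_sum (s⁻¹ * t) (by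
    rw [Units.val_mul, norm_mul, Units.val_inv_eq_inv_val, norm_inv]
    exact inv_mul_le_one_of_le₀ hm (norm_nonneg _)) x, map_sum]
  refine Submodule.sum_mem _ fun q _ => ?_
  rw [← Module.End.mul_apply, ← map_mul]
  have h1 : c * delta s * (unip q.rep * delta (s⁻¹ * t)) = c * unip (s * q.rep) * delta t := by
    rw [← mul_assoc, mul_assoc c, delta_mul_unip, map_mul delta, map_inv]
    group
  rw [h1]
  refine h.chart_mem_range (hc.mul_unip _ ?_) m _
  rw [norm_mul]
  exact (mul_le_of_le_one_right (norm_nonneg _) q.norm_rep_le).trans_lt hs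

theorem tendsto_uniformizer_pow : Filter.Tendsto
    (fun m : ℕ => ‖((uniformizer F ^ (m + 1) : Fˣ) : F)‖) Filter.atTop (nhds 0) := by
  simp only [Units.val_pow_eq_pow_val, norm_pow]
  exact (tendsto_pow_atTop_nhds_zero_of_lt_one (norm_nonneg _)
    (uniformizer_norm_lt F)).comp (Filter.tendsto_add_atTop_nat 1)

theorem IsHeckeMap.eventually_mem_range (h : IsHeckeMap W V θ) (hV : IsSmooth V) (x : W)
    (hx : (cyclicSpan W x).FG) (g : PGL2 F) :
    ∀ᶠ m in Filter.atTop, V.ρ g (θ x) ∈ LinearMap.range (chartMap θ m) := by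
  obtain ⟨S, hS⟩ := hx
  have hlow : Continuous (lowerUnip : F → PGL2 F) := by
    have : (lowerUnip : F → PGL2 F) = fun z => weyl F * unip z * weyl F := funext lowerUnip_eq
    rw [this]
    exact (continuous_const.mul continuous_unip).mul continuous_const
  have h1 : ∀ᶠ z in nhds (0 : F), ∀ y ∈ S, V.ρ (lowerUnip z) (θ y) = θ y := by
    rw [Filter.eventually_all_finset]
    intro y _
    refine hlow.continuousAt.eventually (p := fun g => V.ρ g (θ y) = θ y) ?_
    refine (hV (θ y)).mem_nhds ?_
    have : lowerUnip (0 : F) = 1 := by rw [lowerUnip, one_eq_pgl]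
    rw [this]
    exact (vectorStabilizer V (θ y)).one_mem
  obtain ⟨ε, hε, h2⟩ := Metric.eventually_nhds_iff.1 h1
  have h3 : ∀ z : F, ‖z‖ < ε → ∀ y ∈ cyclicSpan W x, V.ρ (lowerUnip z) (θ y) = θ y := by
    intro z hz y hy
    rw [← hS] at hy
    induction hy using Submodule.span_induction with
    | mem y hy => exact h2 (by rwa [dist_zero_right]) y hy
    | zero => rw [map_zero, map_zero]
    | add a b _ _ ha hb => rw [map_add, map_add, ha, hb]
    | smul c a _ ha => rw [map_smul, map_smul, ha]
  obtain ⟨B, hB⟩ := exists_bound_mul_unip g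
  have hB0 : 0 ≤ B := by
    obtain ⟨c, t, z, _, ht, _⟩ := hB 0 (by simp)
    exact (norm_nonneg _).trans ht
  have hpos : 0 < min ε 1 / (B + 1) := div_pos (lt_min hε one_pos) (by linarith)
  obtain ⟨s, hs0, hs⟩ := NormedField.exists_norm_lt F (lt_min hpos one_pos)
  lift s to Fˣ using (isUnit_iff_ne_zero.2 (norm_pos_iff.1 hs0))
  have hsB : ∀ t : F, ‖t‖ ≤ B → ‖t * s‖ < min ε 1 := fun t ht => by
    have h4 := (lt_min_iff.1 hs).1
    rw [lt_div_iff₀ (by linarith)] at h4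
    rw [norm_mul]
    nlinarith [norm_nonneg t]
  rw [h.eq_sum s (lt_min_iff.1 hs).2.le x]
  have h5 : ∀ q : Residues s, ∀ᶠ m in Filter.atTop, V.ρ g (V.ρ (unip q.rep * delta s)
      (θ (W.ρ (QuotBy.mk H s) x))) ∈ LinearMap.range (chartMap θ m) := by
    intro q
    obtain ⟨c, t, z, hc, ht, hz, he⟩ := hB q.rep q.norm_rep_le
    have h6 : V.ρ g (V.ρ (unip q.rep * delta s) (θ (W.ρ (QuotBy.mk H s) x))) =
        V.ρ (c * delta (t * s)) (θ (W.ρ (QuotBy.mk H s) x)) := by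
      rw [← Module.End.mul_apply, ← map_mul, ← mul_assoc, he, mul_assoc, lowerUnip_mul_delta,
        ← mul_assoc, map_mul, Module.End.mul_apply,
        h3 _ ((hsB z hz).trans_le (min_le_left _ _)) _
          (cyclicSpan_stable W x _ (mem_cyclicSpan W x)), mul_assoc, ← map_mul]
    rw [h6]
    filter_upwards [(tendsto_uniformizer_pow (F := F)).eventually_le_const
      (norm_pos_iff.2 (t * s).ne_zero)] with m hm
    exact h.chart_delta_mem_range hc _ ((hsB t ht).trans_le (min_le_right _ _)) m hm _
  filter_upwards [Filter.eventually_all.2 h5] with m hm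
  rw [map_sum]
  exact Submodule.sum_mem _ fun q _ => hm q

/-- The subrepresentation generated by the image of a map is exhausted by the images of
`chartMap`. -/
theorem IsHeckeMap.eventually_mem_range_of_mem_span (h : IsHeckeMap W V θ) (hV : IsSmooth V)
    (hW : ∀ x : W, (cyclicSpan W x).FG) (v : V)
    (hv : v ∈ Submodule.span R {v | ∃ g x, V.ρ g (θ x) = v}) :
    ∀ᶠ m in Filter.atTop, v ∈ LinearMap.range (chartMap θ m) := by
  induction hv using Submodule.span_induction with
  | mem v hv =>
    obtain ⟨g, x, rfl⟩ := hv
    exact h.eventually_mem_range hV x (hW x) g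
  | zero => exact .of_forall fun _ => zero_mem _
  | add a b _ _ ha hb =>
    filter_upwards [ha, hb] with m h1 h2 using add_mem h1 h2
  | smul c a _ ha =>
    filter_upwards [ha] with m h1 using Submodule.smul_mem _ c h1

end HeckeMap

section CellHecke

variable {F : Type u} [NontriviallyNormedField F] [IsUltrametricDist F] [ProperSpace F]
  {R : Type v} [CommRing R] {H : Subgroup Fˣ} (W : Rep.{w} R (QuotBy H)) (hW : IsSmooth W)

theorem isHeckeMap_cellMap : IsHeckeMap W (indRep W) (cellMap W hW) where
  fixed x y hy := Subtype.ext (funext fun g => cellFunction_mul W x _ (fixesChart_unip W x y hy)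
    (unip_neg y ▸ fixesChart_unip W x _ (by rwa [norm_neg])) g)
  hecke s hs x := by
    refine Subtype.ext (funext fun g => ?_)
    rw [heckeOp_apply, AddSubmonoidClass.coe_finsetSum, Finset.sum_apply]
    change ∑ q : Residues s, cellFunction W x (g * (unip q.rep * delta s)) =
      cellFunction W (W.ρ (QuotBy.mk H s⁻¹) x) g
    cases hg : cellTorus g with
    | none =>
      rw [cellFunction_of_none _ _ hg]
      refine Finset.sum_eq_zero fun q _ => cellFunction_of_none _ _ ?_
      exact cellTorus_mul_unip_delta g _ q.norm_rep_le s hs hg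
    | some t =>
      obtain ⟨y, z, hz, rfl⟩ := exists_of_cellTorus_eq_some hg
      rw [cellFunction_of_some _ _ hg]
      have h1 : ∀ q : Residues s, cellTorus (delta t * unip y * weyl F * unip z *
          (unip q.rep * delta s)) = if ‖z + q.rep‖ ≤ ‖(s : F)‖ then some (t * s⁻¹) else none := by
        intro q
        have h2 : delta t * unip y * weyl F * unip z * (unip q.rep * delta s) =
            delta t * unip y * (weyl F * unip (z + q.rep) * delta s) := by
          rw [unip_add]
          simp only [mul_assoc]
        rw [h2, cellTorus_delta_unip_mul, cellTorus_weyl_unip_delta]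
        split_ifs <;> simp
      obtain ⟨q, hq⟩ := Residues.exists_rep (t := s) (-z) (by rwa [norm_neg])
      have hq' : ‖z + q.rep‖ ≤ ‖(s : F)‖ := by
        have : z + q.rep = -(-z - q.rep) := by ring
        rwa [this, norm_neg]
      rw [Finset.sum_eq_single q]
      · rw [cellFunction_of_some _ _ ((h1 q).trans (if_pos hq')), ← Module.End.mul_apply,
          ← map_mul, ← map_mul]
      · intro q' _ hne
        refine cellFunction_of_none _ _ ((h1 q').trans (if_neg fun h => hne ?_))
        refine Residues.eq_of_norm_sub_le _ _ ?_
        have : q'.rep - q.rep = (z + q'.rep) - (z + q.rep) := by ring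
        rw [this]
        exact (norm_sub_le_max _ _).trans (max_le h hq')
      · simp

theorem chartMap_cellMap_apply (m : ℕ) (x : CosetIndex F m → W) (j : CosetIndex F m) (g : PGL2 F)
    (hg : cellTorus (g * (cosetRep j * delta (uniformizer F ^ (m + 1)))) ≠ none) :
    (chartMap (cellMap W hW) m x).1 g =
      cellFunction W (x j) (g * (cosetRep j * delta (uniformizer F ^ (m + 1)))) := by
  rw [chartMap_apply, AddSubmonoidClass.coe_finsetSum, Finset.sum_apply, Finset.sum_eq_single j]
  · rfl
  · intro i _ hi
    refine cellFunction_of_none W (x i) ?_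
    by_contra h
    exact hi ((existsUnique_cosetRep g m).unique h hg)
  · simp

/-- The point of the projective line at which only the given index is supported. -/
noncomputable def cosetPoint {m : ℕ} (j : CosetIndex F m) : PGL2 F :=
  weyl F * (cosetRep j * delta (uniformizer F ^ (m + 1)))⁻¹

theorem cellTorus_weyl : cellTorus (weyl F) = some 1 := by
  have := cellTorus_delta_unip_weyl_unip (1 : Fˣ) (0 : F) 0 (by simp)
  rwa [map_one, unip_zero, one_mul, one_mul, mul_one] at this

theorem chartMap_cellMap_cosetPoint (m : ℕ) (x : CosetIndex F m → W) (j : CosetIndex F m) :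
    (chartMap (cellMap W hW) m x).1 (cosetPoint j) = x j := by
  have h : cosetPoint j * (cosetRep j * delta (uniformizer F ^ (m + 1))) = weyl F :=
    inv_mul_cancel_right _ _
  rw [chartMap_cellMap_apply W hW m x j _ (by rw [h, cellTorus_weyl]; simp), h,
    cellFunction_of_some W _ cellTorus_weyl, map_one, map_one]
  rfl

theorem eventually_mem_range_chartMap_cellMap (Φ : indRep W) :
    ∀ᶠ m in Filter.atTop, Φ ∈ LinearMap.range (chartMap (cellMap W hW) m) := by
  obtain ⟨U, hU, hΦ⟩ := Φ.2
  have hu : ∀ c : PGL2 F, ∀ᶠ y in nhds (0 : F), c * unip y * c⁻¹ ∈ U := by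
    intro c
    have hc : Continuous fun y : F => c * unip y * c⁻¹ :=
      (continuous_const.mul continuous_unip).mul continuous_const
    refine hc.continuousAt.eventually (p := fun g => g ∈ U) (hU.mem_nhds ?_)
    beta_reduce
    rw [unip_zero, mul_one, mul_inv_cancel]
    exact U.one_mem
  obtain ⟨ε, hε, h1⟩ := Metric.eventually_nhds_iff.1 ((hu 1).and (hu (weyl F)))
  filter_upwards [(tendsto_uniformizer_pow (F := F)).eventually_lt_const hε] with m hm
  refine ⟨fun j => Φ.1 (cosetPoint j), Subtype.ext (funext fun g => ?_)⟩
  obtain ⟨j, hj, _⟩ := existsUnique_cosetRep g m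
  rw [chartMap_cellMap_apply W hW m _ j g hj]
  obtain ⟨t, ht⟩ := Option.ne_none_iff_exists'.1 hj
  rw [cellFunction_of_some W _ ht]
  obtain ⟨y, z, hz, he⟩ := exists_of_cellTorus_eq_some ht
  set s := uniformizer F ^ (m + 1)
  have hsz : ‖s * z‖ < ε := by
    rw [norm_mul]
    exact (mul_le_of_le_one_right (norm_nonneg _) hz).trans_lt hm
  have hk : cosetRep j * unip (s * z) * (cosetRep j)⁻¹ ∈ U := by
    rcases j with q | q
    · have := (h1 (y := s * z) (by rwa [dist_zero_right])).1
      rw [one_mul, inv_one, mul_one] at this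
      rw [cosetRep, ← unip_add, ← unip_neg, ← unip_add]
      convert this using 2
      ring
    · have := (h1 (y := s * z) (by rwa [dist_zero_right])).2
      rw [cosetRep, mul_inv_rev, ← unip_neg]
      convert this using 1
      rw [mul_assoc, mul_assoc, mul_assoc, ← mul_assoc (unip (s * z)), ← mul_assoc (unip _) (_ * _),
        ← unip_add, ← unip_add]
      congr 3
      ring
  have hg : g = delta t * unip y * cosetPoint j *
      (cosetRep j * unip (s * z) * (cosetRep j)⁻¹) := by
    have h2 : unip (s * z) = delta s * unip z * (delta s)⁻¹ := by
      rw [delta_mul_unip, mul_inv_cancel_right]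
    have h3 : cosetPoint j = weyl F * (cosetRep j * delta s)⁻¹ := rfl
    rw [h3, h2, eq_mul_inv_of_mul_eq he]
    generalize delta s = D
    group
  rw [hg, hΦ t y _ _ hk]

/-- Homomorphisms out of the induced representation are determined by the functions supported on
the cell. -/
theorem indRep_hom_ext {V : Rep.{max u w} R (PGL2 F)} (f g : indRep W ⟶ V)
    (h : ∀ x, f.hom (cellMap W hW x) = g.hom (cellMap W hW x)) : f = g := by
  ext Φ
  obtain ⟨m, x, rfl⟩ := (eventually_mem_range_chartMap_cellMap W hW Φ).exists
  change f.hom _ = g.hom _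
  rw [map_chartMap, map_chartMap, chartMap_apply, chartMap_apply]
  exact Finset.sum_congr rfl fun j _ => congr_arg _ (h _)

/-- Hecke equivariant maps extend to the induced representation. -/
theorem IsHeckeMap.exists_extension {V : Rep.{max u w} R (PGL2 F)} (hV : IsSmooth V)
    (hfin : ∀ x : W, (cyclicSpan W x).FG) {θ : W →ₗ[R] V} (hθ : IsHeckeMap W V θ) :
    ∃ f : indRep W ⟶ V, ∀ x, f.hom (cellMap W hW x) = θ x := by
  let E : Rep.{max u w} R (PGL2 F) := Rep.of (V.ρ.prod (indRep W).ρ)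
  let p : W →ₗ[R] E := θ.prod (cellMap W hW)
  let pr₁ : E ⟶ V := Rep.ofHom ⟨LinearMap.fst R V (indRep W), fun g => rfl⟩
  let pr₂ : E ⟶ indRep W := Rep.ofHom ⟨LinearMap.snd R V (indRep W), fun g => rfl⟩
  have hE : IsSmooth E := fun e => isOpen_vectorStabilizer_of_le
    (U := vectorStabilizer V e.1 ⊓ vectorStabilizer (indRep W) e.2)
    ((hV e.1).inter (indRep_isSmooth W e.2)) fun g hg => Prod.ext hg.1 hg.2
  have hext : ∀ e e' : E, pr₁.hom e = pr₁.hom e' → pr₂.hom e = pr₂.hom e' → e = e' :=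
    fun e e' h1 h2 => Prod.ext h1 h2
  have hc := isHeckeMap_cellMap W hW
  have hp : IsHeckeMap W E p := by
    refine ⟨fun x y hy => Prod.ext (hθ.fixed x y hy) (hc.fixed x y hy), fun s hs x => ?_⟩
    refine hext _ _ ?_ ?_
    · rw [heckeOp_map]
      exact hθ.hecke s hs x
    · rw [heckeOp_map]
      exact hc.hecke s hs x
  let S : Submodule R E := Submodule.span R {v | ∃ g x, E.ρ g (p x) = v}
  have hS : ∀ g, S ≤ S.comap (E.ρ g) := by
    intro g
    refine Submodule.span_le.2 ?_
    rintro _ ⟨h, x, rfl⟩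
    refine Submodule.subset_span ⟨g * h, x, ?_⟩
    rw [map_mul]
    rfl
  have hS' := hp.eventually_mem_range_of_mem_span hE hfin
  let q : S →ₗ[R] indRep W := pr₂.hom.toLinearMap ∘ₗ S.subtype
  have hq : Function.Bijective q := by
    constructor
    · intro a b hab
      have h0 : pr₂.hom (a.1 - b.1) = 0 := by
        rw [map_sub, sub_eq_zero]
        exact hab
      obtain ⟨m, x, hx⟩ := (hS' (a.1 - b.1) (sub_mem a.2 b.2)).exists
      rw [← hx, map_chartMap] at h0
      have h2 : x = 0 := by
        funext j
        rw [← chartMap_cellMap_cosetPoint W hW m x j, show chartMap (cellMap W hW) m x = 0 from h0]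
        rfl
      subst h2
      rw [map_zero] at hx
      exact Subtype.ext (sub_eq_zero.1 hx.symm)
    · intro Φ
      obtain ⟨m, x, rfl⟩ := (eventually_mem_range_chartMap_cellMap W hW Φ).exists
      refine ⟨⟨chartMap p m x, ?_⟩, map_chartMap pr₂ m x⟩
      rw [chartMap_apply]
      exact Submodule.sum_mem _ fun j _ => Submodule.subset_span ⟨_, _, rfl⟩
  let e := LinearEquiv.ofBijective q hq
  have he : ∀ s : S, e.symm (pr₂.hom s.1) = s := fun s => e.symm_apply_apply s
  refine ⟨Rep.ofHom ⟨pr₁.hom.toLinearMap ∘ₗ S.subtype ∘ₗ e.symm.toLinearMap, fun g => ?_⟩, ?_⟩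
  · ext Φ
    obtain ⟨s, rfl⟩ := e.surjective Φ
    change pr₁.hom (e.symm ((indRep W).ρ g (pr₂.hom s.1))).1 =
      V.ρ g (pr₁.hom (e.symm (pr₂.hom s.1)).1)
    rw [he, ← Rep.hom_comm_apply, ← Rep.hom_comm_apply, he ⟨E.ρ g s.1, hS g s.2⟩]
  · intro x
    have hx : p x ∈ S := Submodule.subset_span ⟨1, x, by rw [map_one]; rfl⟩
    have := he ⟨p x, hx⟩
    change pr₁.hom (e.symm (pr₂.hom (p x))).1 = θ x
    rw [this]
    rfl

end CellHecke

end OrdCoh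

namespace OrdCoh

/-! ### The adjunction between parabolic induction and ordinary parts -/

section OrdUnit

variable {F : Type u} [NontriviallyNormedField F] [IsUltrametricDist F] [ProperSpace F]
  {R : Type (u + 1)} [CommRing R] [IsNoetherianRing R] {H : Subgroup Fˣ}

/-- The inclusion of locally admissible in smooth representations. -/
noncomputable abbrev ladmToSm (R : Type (u + 1)) [CommRing R] [IsNoetherianRing R] {F : Type u}
    [NontriviallyNormedField F] (H : Subgroup Fˣ) :
    LAdmRep.{u, u + 1, u + 1} R (QuotBy H) ⥤ SmRep.{u, u + 1, u + 1} R (QuotBy H) :=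
  ObjectProperty.ιOfLE isLocallyAdmissible_le_isSmooth

theorem IsHeckeMap.mem_ordinaryFunctions {W : Rep.{u + 1} R (QuotBy H)}
    {V : Rep.{u + 1} R (PGL2 F)} {θ : W →ₗ[R] V} (hθ : IsHeckeMap W V θ) (x : W)
    (hx : (cyclicSpan W x).FG) :
    (fun t : Fˣ => θ (W.ρ (QuotBy.mk H t⁻¹) x)) ∈ ordinaryFunctions V := by
  refine ⟨⟨fun t => hθ.fixed _, fun s t hs => ?_⟩, ?_⟩
  · beta_reduce
    rw [hθ.hecke s hs, ← Module.End.mul_apply, ← map_mul, ← map_mul, mul_inv]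
  · let f : W →ₗ[R] (Fˣ → V) := LinearMap.pi fun t => θ ∘ₗ W.ρ (QuotBy.mk H t⁻¹)
    refine (hx.map f).of_le ?_
    refine Submodule.span_le.2 ?_
    rintro _ ⟨i, rfl⟩
    refine ⟨W.ρ (QuotBy.mk H (uniformizer F ^ i)⁻¹) x, Submodule.subset_span ⟨_, rfl⟩,
      funext fun t => ?_⟩
    change θ (W.ρ _ (W.ρ _ x)) = θ (W.ρ (QuotBy.mk H (t * uniformizer F ^ i)⁻¹) x)
    rw [← Module.End.mul_apply, ← map_mul, ← map_mul, mul_inv]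

/-- The condition that all orbits span finitely generated modules. -/
def OrbitsFinite {G : Type u} [CommGroup G] (W : Rep.{u + 1} R G) : Prop :=
  ∀ x : W, (cyclicSpan W x).FG

/-- The linear map to the ordinary part of `V` given by a Hecke equivariant map. -/
noncomputable def IsHeckeMap.toOrdLinear {W : Rep.{u + 1} R (QuotBy H)}
    {V : Rep.{u + 1} R (PGL2 F)} {θ : W →ₗ[R] V} (hθ : IsHeckeMap W V θ) (hW : OrbitsFinite W) :
    W →ₗ[R] fixedVectors (ordRep V) H :=
  ((LinearMap.pi fun t : Fˣ => θ ∘ₗ W.ρ (QuotBy.mk H t⁻¹)).codRestrict (ordinaryFunctions V)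
    fun x => hθ.mem_ordinaryFunctions x (hW x)).codRestrict (fixedVectors (ordRep V) H) fun x => by
      intro h hh
      refine Subtype.ext (funext fun t => ?_)
      change θ (W.ρ (QuotBy.mk H (t * h)⁻¹) x) = θ (W.ρ (QuotBy.mk H t⁻¹) x)
      rw [mul_inv, map_mul (QuotBy.mk H), QuotBy.mk_eq_one.2 (H.inv_mem hh), mul_one]

theorem IsHeckeMap.toOrdLinear_apply {W : Rep.{u + 1} R (QuotBy H)}
    {V : Rep.{u + 1} R (PGL2 F)} {θ : W →ₗ[R] V} (hθ : IsHeckeMap W V θ) (hW : OrbitsFinite W)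
    (x : W) (t : Fˣ) : (hθ.toOrdLinear hW x).1.1 t = θ (W.ρ (QuotBy.mk H t⁻¹) x) := rfl

theorem IsHeckeMap.toOrdLinear_act {W : Rep.{u + 1} R (QuotBy H)}
    {V : Rep.{u + 1} R (PGL2 F)} {θ : W →ₗ[R] V} (hθ : IsHeckeMap W V θ) (hW : OrbitsFinite W)
    (g : QuotBy H) (x : W) : hθ.toOrdLinear hW (W.ρ g⁻¹ x) =
      (invariantsRep H (ordRep V)).ρ g (hθ.toOrdLinear hW x) := by
  obtain ⟨g, rfl⟩ := QuotBy.mk_surjective H g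
  refine Subtype.ext (Subtype.ext (funext fun t => ?_))
  change _ = (hθ.toOrdLinear hW x).1.1 (t * g)
  rw [toOrdLinear_apply, toOrdLinear_apply, ← Module.End.mul_apply, ← map_mul, ← map_inv,
    ← map_mul, mul_inv]

/-- The homomorphism from the twist of `W` to the ordinary part of `V` given by a Hecke equivariant
map. -/
noncomputable def IsHeckeMap.toOrd {W : SmRep.{u, u + 1, u + 1} R (QuotBy H)}
    {V : SmRep.{u, u + 1, u + 1} R (PGL2 F)} {θ : W.obj →ₗ[R] V.obj}
    (hθ : IsHeckeMap W.obj V.obj θ) (hW : OrbitsFinite W.obj) :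
    (twist R (QuotBy H)).obj W ⟶ (ordH R H ⋙ ladmToSm R H).obj V :=
  ObjectProperty.homMk (Rep.ofHom ⟨hθ.toOrdLinear hW, fun g =>
    LinearMap.ext fun x => hθ.toOrdLinear_act hW g x⟩ :
      (Rep.resFunctor (invMonoidHom : QuotBy H →* QuotBy H)).obj W.obj ⟶
        invariantsRep H (ordRep V.obj))

instance : (ladmToSm R H).Additive where
  map_add {V W f g} := by
    ext : 1
    rfl

/-- The value of an element of the ordinary part at `1`. -/
noncomputable def evalOne {W : SmRep.{u, u + 1, u + 1} R (QuotBy H)}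
    {V : SmRep.{u, u + 1, u + 1} R (PGL2 F)}
    (f : (twist R (QuotBy H)).obj W ⟶ (ordH R H ⋙ ladmToSm R H).obj V) : W.obj →ₗ[R] V.obj :=
  LinearMap.proj (R := R) (φ := fun _ : Fˣ => V.obj) (1 : Fˣ) ∘ₗ
    (ordinaryFunctions V.obj).subtype ∘ₗ (fixedVectors (ordRep V.obj) H).subtype ∘ₗ
      f.hom.hom.toLinearMap

theorem evalOne_act {W : SmRep.{u, u + 1, u + 1} R (QuotBy H)}
    {V : SmRep.{u, u + 1, u + 1} R (PGL2 F)}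
    (f : (twist R (QuotBy H)).obj W ⟶ (ordH R H ⋙ ladmToSm R H).obj V) (t : Fˣ) (x : W.obj) :
    evalOne f (W.obj.ρ (QuotBy.mk H t⁻¹) x) = (f.hom.hom x).1.1 t := by
  have h := Rep.hom_comm_apply f.hom (QuotBy.mk H t) x
  have h1 := congr_arg (fun y : fixedVectors (ordRep V.obj) H => y.1.1 1) h
  rw [map_inv]
  refine h1.trans ?_
  change (f.hom.hom x).1.1 (1 * t) = _
  rw [one_mul]

theorem isHeckeMap_evalOne {W : SmRep.{u, u + 1, u + 1} R (QuotBy H)}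
    {V : SmRep.{u, u + 1, u + 1} R (PGL2 F)}
    (f : (twist R (QuotBy H)).obj W ⟶ (ordH R H ⋙ ladmToSm R H).obj V) :
    IsHeckeMap W.obj V.obj (evalOne f) where
  fixed x := (f.hom.hom x).1.2.1.1 1
  hecke s hs x := by
    rw [evalOne_act]
    have := (f.hom.hom x).1.2.1.2 s 1 hs
    rw [mul_one] at this
    exact this.symm

theorem evalOne_injective {W : SmRep.{u, u + 1, u + 1} R (QuotBy H)}
    {V : SmRep.{u, u + 1, u + 1} R (PGL2 F)}
    {f g : (twist R (QuotBy H)).obj W ⟶ (ordH R H ⋙ ladmToSm R H).obj V}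
    (h : evalOne f = evalOne g) : f = g := by
  refine ObjectProperty.hom_ext _ (Rep.hom_ext ?_)
  ext x
  refine Subtype.ext (Subtype.ext (funext fun t => ?_))
  exact (evalOne_act f t x).symm.trans ((congr($h _)).trans (evalOne_act g t x))

variable {W : SmRep.{u, u + 1, u + 1} R (QuotBy H)} (hW : OrbitsFinite W.obj)

/-- The unit of the adjunction between parabolic induction and ordinary parts. -/
noncomputable def ordUnit :
    (twist R (QuotBy H)).obj W ⟶ (ordH R H ⋙ ladmToSm R H).obj ((indFunctor R H).obj W) :=
  IsHeckeMap.toOrd (V := (indFunctor R H).obj W) (isHeckeMap_cellMap W.obj W.property) hW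

theorem evalOne_ordUnit_comp {V : SmRep.{u, u + 1, u + 1} R (PGL2 F)}
    (f : (indFunctor R H).obj W ⟶ V) (x : W.obj) :
    evalOne (ordUnit hW ≫ (ordH R H ⋙ ladmToSm R H).map f) x =
      f.hom.hom (cellMap W.obj W.property x) := by
  change f.hom.hom (cellMap W.obj W.property (W.obj.ρ (QuotBy.mk H (1 : Fˣ)⁻¹) x)) = _
  rw [inv_one, map_one, map_one]
  rfl

theorem indMap_cellMap {W' : SmRep.{u, u + 1, u + 1} R (QuotBy H)} (f : W ⟶ W') (x : W.obj) :
    (indMap f.hom).hom (cellMap W.obj W.property x) =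
      cellMap W'.obj W'.property (f.hom.hom x) := by
  refine Subtype.ext (funext fun g => ?_)
  change f.hom.hom (cellFunction W.obj x g) = cellFunction W'.obj (f.hom.hom x) g
  cases hg : cellTorus g with
  | none => rw [cellFunction_of_none _ _ hg, cellFunction_of_none _ _ hg, map_zero]
  | some t =>
    rw [cellFunction_of_some _ _ hg, cellFunction_of_some _ _ hg, Rep.hom_comm_apply]

theorem ordUnit_naturality {W' : SmRep.{u, u + 1, u + 1} R (QuotBy H)}
    (hW' : OrbitsFinite W'.obj) (f : W ⟶ W') :
    ordUnit hW ≫ (ordH R H ⋙ ladmToSm R H).map ((indFunctor R H).map f) =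
      (twist R (QuotBy H)).map f ≫ ordUnit hW' := by
  refine evalOne_injective (LinearMap.ext fun x => ?_)
  rw [evalOne_ordUnit_comp]
  refine (indMap_cellMap f x).trans ?_
  have := evalOne_ordUnit_comp hW' (𝟙 _) (f.hom.hom x)
  rw [CategoryTheory.Functor.map_id, Category.comp_id] at this
  exact this.symm

/-- Parabolic induction is left adjoint to the ordinary part. -/
theorem ordUnit_comp_bijective (V : SmRep.{u, u + 1, u + 1} R (PGL2 F)) :
    Function.Bijective fun f : (indFunctor R H).obj W ⟶ V =>
      ordUnit hW ≫ (ordH R H ⋙ ladmToSm R H).map f := by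
  constructor
  · intro f g h
    refine ObjectProperty.hom_ext _ (indRep_hom_ext W.obj W.property _ _ fun x => ?_)
    have h1 := congr_arg (fun k => evalOne k x) h
    simp only [evalOne_ordUnit_comp] at h1
    exact h1
  · intro k
    obtain ⟨f, hf⟩ := (isHeckeMap_evalOne k).exists_extension W.obj W.property V.property hW
    refine ⟨ObjectProperty.homMk f, evalOne_injective (LinearMap.ext fun x => ?_)⟩
    rw [evalOne_ordUnit_comp]
    exact hf x

end OrdUnit

section HomFunctorIso

variable {F : Type u} [NontriviallyNormedField F] [IsUltrametricDist F] [ProperSpace F]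
  {R : Type (u + 1)} [CommRing R] [IsNoetherianRing R] {H : Subgroup Fˣ}
  {W : SmRep.{u, u + 1, u + 1} R (QuotBy H)} (hW : OrbitsFinite W.obj)

theorem ordUnit_comp_map_comp {V V' : SmRep.{u, u + 1, u + 1} R (PGL2 F)}
    (g : (indFunctor R H).obj W ⟶ V) (f : V ⟶ V') :
    ordUnit hW ≫ (ordH R H ⋙ ladmToSm R H).map (g ≫ f) =
      (ordUnit hW ≫ (ordH R H ⋙ ladmToSm R H).map g) ≫ (ordH R H ⋙ ladmToSm R H).map f := by
  rw [Functor.map_comp, Category.assoc]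

theorem ordUnit_comp_map_add {V : SmRep.{u, u + 1, u + 1} R (PGL2 F)}
    (f g : (indFunctor R H).obj W ⟶ V) :
    ordUnit hW ≫ (ordH R H ⋙ ladmToSm R H).map (f + g) =
      ordUnit hW ≫ (ordH R H ⋙ ladmToSm R H).map f +
        ordUnit hW ≫ (ordH R H ⋙ ladmToSm R H).map g := by
  rw [Functor.map_add, Preadditive.comp_add]

theorem ordUnit_comp_map_comp_lambda {V : SmRep.{u, u + 1, u + 1} R (PGL2 F)}
    (a : Lambda R (QuotBy H)) (f : (indFunctor R H).obj W ⟶ V) :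
    ordUnit hW ≫ (ordH R H ⋙ ladmToSm R H).map ((indFunctor R H).map (lambdaHom W a) ≫ f) =
      (twist R (QuotBy H)).map (lambdaHom W a) ≫ ordUnit hW ≫
        (ordH R H ⋙ ladmToSm R H).map f := by
  rw [Functor.map_comp, ← Category.assoc, ordUnit_naturality hW hW, Category.assoc]

/-- Composition with the unit of the adjunction, as a map of modules over the completed group
ring. -/
noncomputable def ordUnitLinear (V : SmRep.{u, u + 1, u + 1} R (PGL2 F)) :
    (homFunctor (indFunctor R H) W).obj V →ₗ[Lambda R (QuotBy H)]
      (homFunctor (twist R (QuotBy H)) W).obj ((ordH R H ⋙ ladmToSm R H).obj V) where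
  toFun f := ordUnit hW ≫ (ordH R H ⋙ ladmToSm R H).map (show (indFunctor R H).obj W ⟶ V from f)
  map_add' f g := ordUnit_comp_map_add hW f g
  map_smul' a f := ordUnit_comp_map_comp_lambda hW a f

/-- Homomorphisms out of the induced representation are homomorphisms into the ordinary part,
compatibly with the action of the completed group ring. -/
noncomputable def homFunctorOrdIso : homFunctor (indFunctor R H) W ≅
    (ordH R H ⋙ ladmToSm R H) ⋙ homFunctor (twist R (QuotBy H)) W :=
  NatIso.ofComponents (fun V => LinearEquiv.toModuleIso (LinearEquiv.ofBijective
    (ordUnitLinear hW V) (ordUnit_comp_bijective hW V))) fun {V V'} f => by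
      ext g
      exact ordUnit_comp_map_comp hW g f

end HomFunctorIso

section Injective

variable {F : Type u} [NontriviallyNormedField F] [IsUltrametricDist F] [ProperSpace F]
  {R : Type (u + 1)} [CommRing R] [IsNoetherianRing R] {H : Subgroup Fˣ}

theorem mono_indFunctor_map {W W' : SmRep.{u, u + 1, u + 1} R (QuotBy H)} (f : W ⟶ W')
    (hf : Function.Injective f.hom.hom) : Mono ((indFunctor R H).map f) := by
  refine (IsSmooth : ObjectProperty (Rep.{u + 1} R (PGL2 F))).ι.mono_of_mono_map
    ((Rep.mono_iff_injective _).2 fun Φ Ψ h => Subtype.ext (funext fun g => hf ?_))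
  exact congr_arg (fun Φ : inducedFunctions W'.obj => Φ.1 g) h

theorem cyclicSpan_twist {G : Type u} [CommGroup G] (V : Rep.{u + 1} R G) (x : V) :
    cyclicSpan ((Rep.resFunctor (invMonoidHom : G →* G)).obj V) x = cyclicSpan V x := by
  rw [cyclicSpan, cyclicSpan]
  congr 1
  ext y
  constructor
  · rintro ⟨g, rfl⟩
    exact ⟨g⁻¹, rfl⟩
  · rintro ⟨g, rfl⟩
    exact ⟨g⁻¹, congr_arg (fun a => V.ρ a x) (inv_inv g)⟩

/-- A representation agrees with its double twist. -/
noncomputable def twistTwist (V : SmRep.{u, u + 1, u + 1} R (QuotBy H)) :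
    (twist R (QuotBy H)).obj ((twist R (QuotBy H)).obj V) ≅ V where
  hom := ObjectProperty.homMk (Rep.ofHom ⟨LinearMap.id, fun g =>
    LinearMap.ext fun x => congr_arg (fun a => V.obj.ρ a x) (inv_inv g)⟩)
  inv := ObjectProperty.homMk (Rep.ofHom ⟨LinearMap.id, fun g =>
    LinearMap.ext fun x => congr_arg (fun a => V.obj.ρ a x) (inv_inv g).symm⟩)
  hom_inv_id := rfl
  inv_hom_id := rfl

theorem twistTwist_hom_naturality {V V' : SmRep.{u, u + 1, u + 1} R (QuotBy H)} (f : V ⟶ V') :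
    (twist R (QuotBy H)).map ((twist R (QuotBy H)).map f) ≫ (twistTwist V').hom =
      (twistTwist V).hom ≫ f := rfl

theorem ladmRep_injective_of_mono {V W : LAdmRep.{u, u + 1, u + 1} R (QuotBy H)} (f : V ⟶ W)
    [Mono f] : Function.Injective f.hom.hom := by
  have := preservesHomology_ι.{u, u + 1, u + 1} (k := R) (G := QuotBy H)
  exact (Rep.mono_iff_injective _).1 (inferInstanceAs (Mono
    ((IsLocallyAdmissible : ObjectProperty (Rep.{u + 1} R (QuotBy H))).ι.map f)))

theorem injective_ordH (V : SmRep.{u, u + 1, u + 1} R (PGL2 F)) [Injective V] :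
    Injective ((ordH R H).obj V) where
  factors {A B} g f _ := by
    let A' := (twist R (QuotBy H)).obj ((ladmToSm R H).obj A)
    let B' := (twist R (QuotBy H)).obj ((ladmToSm R H).obj B)
    let f' : A' ⟶ B' := (twist R (QuotBy H)).map ((ladmToSm R H).map f)
    have hA : OrbitsFinite A'.obj := fun x => (cyclicSpan_twist (R := R) A.obj x).symm ▸
      ((isLocallyAdmissible_iff _).1 A.property x).2
    have hB : OrbitsFinite B'.obj := fun x => (cyclicSpan_twist (R := R) B.obj x).symm ▸
      ((isLocallyAdmissible_iff _).1 B.property x).2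
    have : Mono ((indFunctor R H).map f') := mono_indFunctor_map f' (ladmRep_injective_of_mono f)
    obtain ⟨g', hg'⟩ := (ordUnit_comp_bijective hA V).2 ((twistTwist _).hom ≫ (ladmToSm R H).map g)
    let k := (twistTwist _).inv ≫ ordUnit hB ≫ (ordH R H ⋙ ladmToSm R H).map
      (Injective.factorThru g' ((indFunctor R H).map f'))
    refine ⟨(ladmToSm R H).preimage k, (ladmToSm R H).map_injective ?_⟩
    rw [Functor.map_comp, Functor.map_preimage]
    rw [← cancel_epi (twistTwist ((ladmToSm R H).obj A)).hom, ← hg', ← Category.assoc,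
      ← twistTwist_hom_naturality, Category.assoc, Iso.hom_inv_id_assoc, ← Category.assoc,
      ← ordUnit_naturality hA hB f', Category.assoc, ← Functor.map_comp, Injective.comp_factorThru]

end Injective

end OrdCoh

namespace OrdCoh

/-! ### Flatness of the lift of an exact `𝒮`-space -/

section FlatGeneral

/-- Restriction along a representably flat functor preserves injective presheaves. -/
theorem injective_whiskeringLeft {C D : Type (u + 1)} [Category.{u} C] [Category.{u} D]
    (R : Type (u + 1)) [CommRing R] (L : C ⥤ D) [RepresentablyFlat L]
    (I : Dᵒᵖ ⥤ ModuleCat.{u + 1} R) [Injective I] : Injective (L.op ⋙ I) := by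
  let C' := AsSmall.{0} C
  let D' := AsSmall.{0} D
  let L' : C' ⥤ D' := (AsSmall.equiv (C := C)).inverse ⋙ L ⋙ (AsSmall.equiv (C := D)).functor
  have : RepresentablyFlat L' := inferInstance
  let eD := (AsSmall.equiv (C := D) : D ≌ D').op.congrLeft (E := ModuleCat.{u + 1} R)
  let eC := (AsSmall.equiv (C := C) : C ≌ C').op.congrLeft (E := ModuleCat.{u + 1} R)
  have h1 : Injective (eD.functor.obj I) := eD.symm.toAdjunction.map_injective I ‹_›
  have h2 : PreservesFiniteLimits (L'.op.lan : _ ⥤ D'ᵒᵖ ⥤ ModuleCat.{u + 1} R) :=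
    lan_preservesFiniteLimits_of_flat _ L'
  have h3 : Injective (((Functor.whiskeringLeft _ _ _).obj L'.op).obj (eD.functor.obj I)) :=
    (L'.op.lanAdjunction (ModuleCat.{u + 1} R)).map_injective _ h1
  have h4 : Injective (eC.inverse.obj (((Functor.whiskeringLeft _ _ _).obj L'.op).obj
      (eD.functor.obj I))) := eC.toAdjunction.map_injective _ h3
  exact h4

end FlatGeneral

section FlatLift

variable {G : Type u} [Group G] [TopologicalSpace G] [IsTopologicalGroup G]
  {𝒦 : Set (Subgroup G)}

/-- The fibre product of two `G`-sets. -/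
def GSetCat.pullback (h : IsGoodFamily 𝒦) {S T Q : GSetCat 𝒦} (f : S ⟶ Q) (g : T ⟶ Q) :
    GSetCat 𝒦 :=
  letI : MulAction G {p : S.carrier × T.carrier // f.toFun p.1 = g.toFun p.2} :=
    { smul := fun a p => ⟨a • p.1, by
        have h1 := f.map_smul' a p.1.1
        have h2 := g.map_smul' a p.1.2
        exact h1.trans ((congr_arg _ p.2).trans h2.symm)⟩
      one_smul := fun p => Subtype.ext (one_smul G p.1)
      mul_smul := fun a b p => Subtype.ext (mul_smul a b p.1) }
  { carrier := {p : S.carrier × T.carrier // f.toFun p.1 = g.toFun p.2}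
    stabilizer_mem := fun p => by
      have h1 : MulAction.stabilizer G p =
          MulAction.stabilizer G p.1.1 ⊓ MulAction.stabilizer G p.1.2 := by
        ext a
        exact Subtype.ext_iff.trans Prod.ext_iff
      rw [h1]
      exact h.of_le _ (S.stabilizer_mem p.1.1) _ ((h.isOpen _ (S.stabilizer_mem _)).inter
        (h.isOpen _ (T.stabilizer_mem _))) inf_le_left }

/-- The equalizer of two maps of `G`-sets. -/
def GSetCat.equalizer {S T : GSetCat 𝒦} (f g : S ⟶ T) : GSetCat 𝒦 :=
  letI : MulAction G {p : S.carrier // f.toFun p = g.toFun p} :=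
    { smul := fun a p => ⟨a • p.1, by
        have h1 := f.map_smul' a p.1
        have h2 := g.map_smul' a p.1
        exact h1.trans ((congr_arg _ p.2).trans h2.symm)⟩
      one_smul := fun p => Subtype.ext (one_smul G p.1)
      mul_smul := fun a b p => Subtype.ext (mul_smul a b p.1) }
  { carrier := {p : S.carrier // f.toFun p = g.toFun p}
    stabilizer_mem := fun p => by
      have h1 : MulAction.stabilizer G p = MulAction.stabilizer G p.1 := by
        ext a
        exact Subtype.ext_iff
      rw [h1]
      exact S.stabilizer_mem p.1 }

theorem GSetCat.exists_isLimit_pullback (h : IsGoodFamily 𝒦) {S T Q : GSetCat 𝒦} (f : S ⟶ Q)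
    (g : T ⟶ Q) : ∃ c : PullbackCone f g, Nonempty (IsLimit c) := by
  let p₁ : GSetCat.pullback h f g ⟶ S := { toFun := fun p => p.1.1, map_smul' := fun _ _ => rfl }
  let p₂ : GSetCat.pullback h f g ⟶ T := { toFun := fun p => p.1.2, map_smul' := fun _ _ => rfl }
  refine ⟨PullbackCone.mk p₁ p₂ (MulActionHom.ext fun p => p.2), ⟨PullbackCone.IsLimit.mk _
    (fun s => { toFun := fun x => ⟨(s.fst.toFun x, s.snd.toFun x), congr($(s.condition).toFun x)⟩
                map_smul' := fun a x => Subtype.ext (Prod.ext (s.fst.map_smul' a x)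
                  (s.snd.map_smul' a x)) })
    (fun s => rfl) (fun s => rfl) fun s m h1 h2 => MulActionHom.ext fun x => ?_⟩⟩
  exact Subtype.ext (Prod.ext congr(($h1).toFun x) congr(($h2).toFun x))

theorem GSetCat.exists_isLimit_fork {S T : GSetCat 𝒦} (f g : S ⟶ T) :
    ∃ c : Fork f g, Nonempty (IsLimit c) := by
  let i : GSetCat.equalizer f g ⟶ S := { toFun := fun p => p.1, map_smul' := fun _ _ => rfl }
  refine ⟨Fork.ofι i (MulActionHom.ext fun p => p.2), ⟨Fork.IsLimit.mk _
    (fun s => { toFun := fun x => ⟨s.ι.toFun x, congr($(s.condition).toFun x)⟩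
                map_smul' := fun a x => Subtype.ext (s.ι.map_smul' a x) })
    (fun s => rfl) fun s m h1 => MulActionHom.ext fun x => ?_⟩⟩
  exact Subtype.ext congr(($h1).toFun x)

/-- The lift of `X` to the category of spaces over its colimit, as a functor. -/
def Over.liftFunctor (X : GSetCat 𝒦 ⥤ LHSpace.{u}) : GSetCat 𝒦 ⥤ Over X where
  obj S := Over.lift S
  map τ := Over.liftMap τ
  map_id S := Over.liftMap_id S
  map_comp σ τ := Over.liftMap_comp σ τ

variable {X : GSetCat 𝒦 ⥤ LHSpace.{u}}

theorem exists_lift_of_pullback (h : IsGoodFamily 𝒦) (hX : IsSSpace X) {U : LHSpace.{u}}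
    {S T Q : GSetCat 𝒦} (f : S ⟶ Q) (g : T ⟶ Q) (a : U ⟶ X.obj S) (b : U ⟶ X.obj T)
    (hab : a ≫ X.map f = b ≫ X.map g) :
    ∃ (P : GSetCat 𝒦) (p : P ⟶ S) (q : P ⟶ T) (c : U ⟶ X.obj P), p ≫ f = q ≫ g ∧
      c ≫ X.map p = a ∧ c ≫ X.map q = b := by
  have := hX.preservesPullbacks
  obtain ⟨c, ⟨hc⟩⟩ := GSetCat.exists_isLimit_pullback h f g
  have hc' := isLimitPullbackConeMapOfIsLimit X c.condition
    (IsLimit.ofIsoLimit hc (PullbackCone.eta c))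
  obtain ⟨l, h1, h2⟩ := PullbackCone.IsLimit.lift' hc' a b hab
  exact ⟨c.pt, c.fst, c.snd, l, c.condition, h1, h2⟩

theorem exists_lift_of_equalizer (hX : IsExactSSpace X) {U : LHSpace.{u}}
    {S T : GSetCat 𝒦} (f g : S ⟶ T) (a : U ⟶ X.obj S) (ha : a ≫ X.map f = a ≫ X.map g) :
    ∃ (P : GSetCat 𝒦) (p : P ⟶ S) (c : U ⟶ X.obj P), p ≫ f = p ≫ g ∧ c ≫ X.map p = a := by
  have : PreservesLimitsOfShape WalkingParallelPair X := hX
  obtain ⟨c, ⟨hc⟩⟩ := GSetCat.exists_isLimit_fork f g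
  have hc' := isLimitForkMapOfIsLimit X c.condition (IsLimit.ofIsoLimit hc (Fork.isoForkOfι c))
  obtain ⟨l, h1⟩ := Fork.IsLimit.lift' hc' a ha
  exact ⟨c.pt, c.ι, l, c.condition, h1⟩

theorem ColimHom.exists_of_mk_eq (h : IsGoodFamily 𝒦) (hX : IsSSpace X) {U : LHSpace.{u}}
    {S T : GSetCat 𝒦} (a : U ⟶ X.obj S) (b : U ⟶ X.obj T)
    (hab : ColimHom.mk S a = ColimHom.mk T b) :
    ∃ (P : GSetCat 𝒦) (p : P ⟶ S) (q : P ⟶ T) (c : U ⟶ X.obj P),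
      c ≫ X.map p = a ∧ c ≫ X.map q = b := by
  have key : ∀ x y : (Σ S : GSetCat 𝒦, (U ⟶ X.obj S)),
      Relation.EqvGen (fun a b => ∃ τ : a.1 ⟶ b.1, a.2 ≫ X.map τ = b.2) x y →
      ∃ (P : GSetCat 𝒦) (p : P ⟶ x.1) (q : P ⟶ y.1) (c : U ⟶ X.obj P),
        c ≫ X.map p = x.2 ∧ c ≫ X.map q = y.2 := by
    intro x y hxy
    induction hxy with
    | rel x y hxy =>
      obtain ⟨τ, hτ⟩ := hxy
      exact ⟨x.1, 𝟙 _, τ, x.2, by rw [X.map_id, Category.comp_id], hτ⟩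
    | refl x => exact ⟨x.1, 𝟙 _, 𝟙 _, x.2, by rw [X.map_id, Category.comp_id],
        by rw [X.map_id, Category.comp_id]⟩
    | symm x y _ ih =>
      obtain ⟨P, p, q, c, h1, h2⟩ := ih
      exact ⟨P, q, p, c, h2, h1⟩
    | trans x y z _ _ ih1 ih2 =>
      obtain ⟨P, p, q, c, h1, h2⟩ := ih1
      obtain ⟨P', p', q', c', h1', h2'⟩ := ih2
      obtain ⟨Q, r, s, d, _, h3, h4⟩ := exists_lift_of_pullback h hX q p' c c' (h2.trans h1'.symm)
      refine ⟨Q, r ≫ p, s ≫ q', d, ?_, ?_⟩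
      · rw [X.map_comp, ← Category.assoc, h3, h1]
      · rw [X.map_comp, ← Category.assoc, h4, h2']
  exact key ⟨S, a⟩ ⟨T, b⟩ (Quot.eqvGen_exact hab)

/-- The lift of an exact `𝒮`-space is representably flat. -/
theorem representablyFlat_liftFunctor (h : IsGoodFamily 𝒦) (hX : IsSSpace X)
    (hX' : IsExactSSpace X) : RepresentablyFlat (Over.liftFunctor X) where
  cofiltered U := by
    have hmk : ∀ A : StructuredArrow U (Over.liftFunctor X),
        ColimHom.mk A.right A.hom.1 = U.point := fun A => by
      have := A.hom.2
      exact (congr_arg (ColimHom.mk A.right) (Category.comp_id _)).symm.trans this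
    let mkA : (S : GSetCat 𝒦) → (a : U.space ⟶ X.obj S) → ColimHom.mk S a = U.point →
        StructuredArrow U (Over.liftFunctor X) := fun S a ha =>
      StructuredArrow.mk (Y := S) (S := U) (T := Over.liftFunctor X) ⟨a,
        (congr_arg (ColimHom.mk S) (Category.comp_id a)).trans ha⟩
    refine @IsCofiltered.mk _ _ ⟨fun A B => ?_, fun A B f g => ?_⟩ ?_
    · obtain ⟨P, p, q, c, h1, h2⟩ := ColimHom.exists_of_mk_eq h hX A.hom.1 B.hom.1
        ((hmk A).trans (hmk B).symm)
      refine ⟨mkA P c ?_, StructuredArrow.homMk p (Subtype.ext h1),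
        StructuredArrow.homMk q (Subtype.ext h2), trivial⟩
      rw [← ColimHom.mk_map c p, h1, hmk]
    · obtain ⟨P, p, c, h1, h2⟩ := exists_lift_of_equalizer hX' f.right g.right A.hom.1
        ((congr_arg Subtype.val (StructuredArrow.w f)).trans
          (congr_arg Subtype.val (StructuredArrow.w g)).symm)
      refine ⟨mkA P c ?_, StructuredArrow.homMk p (Subtype.ext h2), ?_⟩
      · rw [← ColimHom.mk_map c p, h2, hmk]
      · ext
        exact h1
    · obtain ⟨⟨S, a⟩, ha⟩ := Quot.exists_rep U.point
      exact ⟨mkA S a ha⟩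

end FlatLift

section SheafInjective

variable {G : Type u} [Group G] [TopologicalSpace G] [IsTopologicalGroup G]
  {𝒦 : Set (Subgroup G)} {X : GSetCat 𝒦 ⥤ LHSpace.{u}} {R : Type (u + 1)} [CommRing R]

theorem injective_obj_of_injective (I : Sh X R) [Injective I] : Injective I.obj := by
  have := hasSheafify_over X R
  exact (sheafificationAdjunction (Over.topology X) (ModuleCat.{u + 1} R)).map_injective I ‹_›

/-- The restriction of an injective sheaf on an exact `𝒮`-space to `G`-sets. -/
theorem injective_liftFunctor_comp (h : IsGoodFamily 𝒦) (hX : IsSSpace X)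
    (hX' : IsExactSSpace X) (I : Sh X R) [Injective I] :
    Injective ((Over.liftFunctor X).op ⋙ I.obj) := by
  have := representablyFlat_liftFunctor h hX hX'
  have := injective_obj_of_injective I
  exact injective_whiskeringLeft R _ _

theorem eq_zero_of_covering (hX : IsSSpace X) (𝓕 : Sh X R) {S : GSetCat 𝒦} {I : Type u}
    (T : I → GSetCat 𝒦) (f : ∀ i, T i ⟶ S) (hf : GSetCat.IsCovering T f)
    (x : 𝓕.obj.obj (Opposite.op (Over.lift S)))
    (hx : ∀ i, (𝓕.obj.map (Over.liftMap (f i)).op).hom x = 0) : x = 0 := by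
  have hs := Sheaf.isSeparated 𝓕
  refine hs (Over.lift S) (Sieve.generate (Presieve.ofArrows _ fun i => Over.liftMap (f i))) ?_
    x 0 ?_
  · intro y
    obtain ⟨i, t, ht⟩ := hX.map_covering T f hf y
    exact ⟨_, Over.liftMap (f i), t, Sieve.le_generate _ _ _ (Presieve.ofArrows.mk i), ht⟩
  · rintro Y _ ⟨Z, g, _, ⟨i⟩, rfl⟩
    rw [op_comp, Functor.map_comp, map_zero]
    change (𝓕.obj.map g.op).hom ((𝓕.obj.map (Over.liftMap (f i)).op).hom x) = 0
    rw [hx, map_zero]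

end SheafInjective

end OrdCoh

namespace OrdCoh

/-! ### Sections at infinity of injective sheaves -/

section Equivariant

variable {G : Type u} [Group G] {𝒦 : Set (Subgroup G)} {R : Type (u + 1)} [CommRing R]

/-- The equivariant maps from a `G`-set to a representation. -/
def equivariantMaps (V : Rep.{u + 1} R G) (S : GSetCat 𝒦) : Submodule R (S.carrier → V) where
  carrier := {f | ∀ (g : G) (s : S.carrier), f (g • s) = V.ρ g (f s)}
  add_mem' ha hb g s := by rw [Pi.add_apply, Pi.add_apply, ha, hb, map_add]
  zero_mem' g s := (map_zero _).symm
  smul_mem' c a ha g s := by rw [Pi.smul_apply, Pi.smul_apply, ha, map_smul]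

/-- The presheaf of equivariant maps. -/
def equivariantPresheaf (V : Rep.{u + 1} R G) : (GSetCat 𝒦)ᵒᵖ ⥤ ModuleCat.{u + 1} R where
  obj S := ModuleCat.of R (equivariantMaps V S.unop)
  map {S T} τ := ModuleCat.ofHom ((LinearMap.funLeft R V τ.unop.toFun).restrict fun f hf g s =>
    (congr_arg f (τ.unop.map_smul' g s)).trans (hf g _))
  map_id S := rfl
  map_comp f g := rfl

/-- Functoriality of the presheaf of equivariant maps. -/
def equivariantPresheafMap {V W : Rep.{u + 1} R G} (f : V ⟶ W) :
    equivariantPresheaf (𝒦 := 𝒦) V ⟶ equivariantPresheaf W where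
  app S := ModuleCat.ofHom ((f.hom.toLinearMap.compLeft S.unop.carrier).restrict fun a ha g s => by
    change f.hom (a (g • s)) = W.ρ g (f.hom (a s))
    rw [ha, Rep.hom_comm_apply])
  naturality S T τ := rfl

theorem mono_equivariantPresheafMap {V W : Rep.{u + 1} R G} (f : V ⟶ W)
    (hf : Function.Injective f.hom) : Mono (equivariantPresheafMap (𝒦 := 𝒦) f) := by
  have : ∀ S, Mono ((equivariantPresheafMap (𝒦 := 𝒦) f).app S) := fun S =>
    (ModuleCat.mono_iff_injective _).2 fun a b hab => Subtype.ext (funext fun s => hf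
      (congr_fun (congr_arg Subtype.val hab) s))
  exact NatTrans.mono_of_mono_app _

variable [TopologicalSpace G] (h : IsGoodFamily 𝒦)

/-- The equivariant map from a coset space attached to a vector fixed by the subgroup. -/
def orbitMap (V : Rep.{u + 1} R G) (v : V) (K : Level 𝒦) (hv : v ∈ fixedVectors V K.group) :
    equivariantMaps V (cosets h K) :=
  ⟨Quotient.lift (fun x : G => V.ρ x v) (by
    intro a b hab
    have h1 := hv _ (QuotientGroup.leftRel_apply.1 hab)
    change V.ρ a v = V.ρ b v
    conv_lhs => rw [← h1]
    rw [← Module.End.mul_apply, ← map_mul, mul_inv_cancel_left]), by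
    intro g s
    induction s using QuotientGroup.induction_on with | H x => ?_
    change V.ρ (g * x) v = V.ρ g (V.ρ x v)
    rw [map_mul]
    rfl⟩

theorem orbitMap_ext (V : Rep.{u + 1} R G) (K : Level 𝒦) (a b : equivariantMaps V (cosets h K))
    (hab : a.1 ((1 : G) : G ⧸ K.group) = b.1 ((1 : G) : G ⧸ K.group)) : a = b := by
  refine Subtype.ext (funext fun s => ?_)
  induction s using QuotientGroup.induction_on with | H x => ?_
  have h1 : ((x : G) : G ⧸ K.group) = x • ((1 : G) : G ⧸ K.group) := by
    change _ = ((x * 1 : G) : G ⧸ K.group)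
    rw [mul_one]
  rw [h1]
  exact (a.2 x _).trans ((congr_arg _ hab).trans (b.2 x _).symm)

theorem orbitMap_one (V : Rep.{u + 1} R G) (v : V) (K : Level 𝒦)
    (hv : v ∈ fixedVectors V K.group) :
    (orbitMap h V v K hv).1 ((1 : G) : G ⧸ K.group) = v := by
  change V.ρ 1 v = v
  rw [map_one]
  rfl

theorem map_cosetMap_orbitMap (V : Rep.{u + 1} R G) (v : V) (K K' : Level 𝒦) (g : G)
    (hg : ∀ x ∈ K'.group, g⁻¹ * x * g ∈ K.group) (hv : v ∈ fixedVectors V K.group)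
    (hv' : V.ρ g v ∈ fixedVectors V K'.group) :
    ((equivariantPresheaf V).map (cosetMap h K' K g hg).op).hom (orbitMap h V v K hv) =
      orbitMap h V (V.ρ g v) K' hv' := by
  refine orbitMap_ext h V K' _ _ ?_
  rw [orbitMap_one]
  change V.ρ (1 * g) v = V.ρ g v
  rw [one_mul]

theorem equivariantPresheafMap_orbitMap {V W : Rep.{u + 1} R G} (f : V ⟶ W) (v : V) (K : Level 𝒦)
    (hv : v ∈ fixedVectors V K.group) :
    ((equivariantPresheafMap f).app (Opposite.op (cosets h K))).hom (orbitMap h V v K hv) =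
      orbitMap h W (f.hom v) K (fun g hg => by rw [← Rep.hom_comm_apply, hv g hg]) := by
  refine orbitMap_ext h W K _ _ ?_
  exact (congr_arg f.hom (orbitMap_one h V v K hv)).trans (orbitMap_one h W _ K _).symm

/-- The equivariant map from a coset space to a `G`-set attached to a point. -/
def pointMap {S : GSetCat 𝒦} (s : S.carrier) (K : Level 𝒦) (hs : ∀ x ∈ K.group, x • s = s) :
    cosets h K ⟶ S :=
  { toFun := Quotient.lift (fun x : G => x • s) (by
      intro a b hab
      have h1 := hs _ (QuotientGroup.leftRel_apply.1 hab)
      change a • s = b • s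
      conv_lhs => rw [← h1]
      rw [← mul_smul, mul_inv_cancel_left])
    map_smul' := by
      intro g s'
      induction s' using QuotientGroup.induction_on with | H x => ?_
      exact mul_smul g x s }

theorem cosetMap_pointMap {S : GSetCat 𝒦} (s : S.carrier) (K K' : Level 𝒦) (g : G)
    (hg : ∀ x ∈ K'.group, g⁻¹ * x * g ∈ K.group) (hs : ∀ x ∈ K.group, x • s = s)
    (hs' : ∀ x ∈ K'.group, x • (g • s) = g • s) :
    cosetMap h K' K g hg ≫ pointMap h s K hs = pointMap h (g • s) K' hs' := by
  refine MulActionHom.ext fun t => ?_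
  induction t using QuotientGroup.induction_on with | H x => ?_
  exact mul_smul x g s

theorem pointMap_comp {S T : GSetCat 𝒦} (τ : S ⟶ T) (s : S.carrier) (K : Level 𝒦)
    (hs : ∀ x ∈ K.group, x • s = s) (hs' : ∀ x ∈ K.group, x • τ.toFun s = τ.toFun s) :
    pointMap h s K hs ≫ τ = pointMap h (τ.toFun s) K hs' := by
  refine MulActionHom.ext fun t => ?_
  induction t using QuotientGroup.induction_on with | H x => ?_
  exact τ.map_smul' x s

/-- The stabilizer of a point, as a level. -/
def pointLevel {S : GSetCat 𝒦} (s : S.carrier) : Level 𝒦 :=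
  OrderDual.toDual ⟨_, S.stabilizer_mem s⟩

theorem smul_eq_of_mem_pointLevel {S : GSetCat 𝒦} (s : S.carrier) :
    ∀ x ∈ (pointLevel s).group, x • s = s := fun _ hx => hx

variable {X : GSetCat 𝒦 ⥤ LHSpace.{u}} (𝓕 : Sh X R)

/-- The germ at infinity of a section, at a point of a `G`-set. -/
noncomputable def germ {S : GSetCat 𝒦} (s : S.carrier) :
    ((Over.liftFunctor X).op ⋙ 𝓕.obj).obj (Opposite.op S) →ₗ[R] SectionsInfinity h 𝓕 :=
  SectionsInfinity.of h 𝓕 (pointLevel s) ∘ₗ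
    (((Over.liftFunctor X).op ⋙ 𝓕.obj).map
      (pointMap h s (pointLevel s) (smul_eq_of_mem_pointLevel s)).op).hom

theorem sectionsPull_map_pointMap {S : GSetCat 𝒦} (s : S.carrier) (K K' : Level 𝒦) (g : G)
    (hg : ∀ x ∈ K'.group, g⁻¹ * x * g ∈ K.group) (hs : ∀ x ∈ K.group, x • s = s)
    (hs' : ∀ x ∈ K'.group, x • (g • s) = g • s)
    (j : ((Over.liftFunctor X).op ⋙ 𝓕.obj).obj (Opposite.op S)) :
    sectionsPull h 𝓕 K K' g hg ((((Over.liftFunctor X).op ⋙ 𝓕.obj).map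
      (pointMap h s K hs).op).hom j) =
    (((Over.liftFunctor X).op ⋙ 𝓕.obj).map (pointMap h (g • s) K' hs').op).hom j := by
  rw [← cosetMap_pointMap h s K K' g hg hs hs', op_comp, Functor.map_comp]
  rfl

theorem germ_eq {S : GSetCat 𝒦} (s : S.carrier) (K : Level 𝒦) (hs : ∀ x ∈ K.group, x • s = s)
    (j : ((Over.liftFunctor X).op ⋙ 𝓕.obj).obj (Opposite.op S)) :
    germ h 𝓕 s j = SectionsInfinity.of h 𝓕 K
      ((((Over.liftFunctor X).op ⋙ 𝓕.obj).map (pointMap h s K hs).op).hom j) := by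
  have h1 : ∀ x ∈ K.group, (1 : G)⁻¹ * x * 1 ∈ (pointLevel s).group := fun x hx => by
    rw [inv_one, one_mul, mul_one]
    exact hs x hx
  have h2 := SectionsInfinity.of_res h 𝓕 (pointLevel s) K (fun x hx => hs x hx)
    ((((Over.liftFunctor X).op ⋙ 𝓕.obj).map
      (pointMap h s (pointLevel s) (smul_eq_of_mem_pointLevel s)).op).hom j)
  refine h2.symm.trans (congr_arg _ ?_)
  refine (sectionsPull_map_pointMap h 𝓕 s _ K 1 h1 _ (by simpa using hs) j).trans ?_
  simp only [one_smul]
  rfl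

theorem germ_smul {S : GSetCat 𝒦} (s : S.carrier) (g : G)
    (j : ((Over.liftFunctor X).op ⋙ 𝓕.obj).obj (Opposite.op S)) :
    germ h 𝓕 (g • s) j = SectionsInfinity.act h 𝓕 g (germ h 𝓕 s j) := by
  have h1 : ∀ x ∈ (pointLevel (g • s)).group, g⁻¹ * x * g ∈ (pointLevel s).group := fun x hx => by
    change (g⁻¹ * x * g) • s = s
    rw [mul_smul, mul_smul, smul_eq_of_mem_pointLevel (g • s) x hx, inv_smul_smul]
  refine Eq.symm ((SectionsInfinity.act_of h 𝓕 g (pointLevel s) (pointLevel (g • s)) h1 _).trans ?_)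
  exact congr_arg _ (sectionsPull_map_pointMap h 𝓕 s _ _ g h1 _ (smul_eq_of_mem_pointLevel _) j)

theorem germ_map {S T : GSetCat 𝒦} (τ : S ⟶ T) (s : S.carrier)
    (j : ((Over.liftFunctor X).op ⋙ 𝓕.obj).obj (Opposite.op T)) :
    germ h 𝓕 s ((((Over.liftFunctor X).op ⋙ 𝓕.obj).map τ.op).hom j) = germ h 𝓕 (τ.toFun s) j := by
  have h1 : ∀ x ∈ (pointLevel s).group, x • τ.toFun s = τ.toFun s := fun x hx =>
    (τ.map_smul' x s).symm.trans (congr_arg τ.toFun (smul_eq_of_mem_pointLevel s x hx))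
  rw [germ_eq h 𝓕 (τ.toFun s) (pointLevel s) h1, ← pointMap_comp h τ s _
    (smul_eq_of_mem_pointLevel s), op_comp, Functor.map_comp]
  rfl

/-- The map from a sheaf to the equivariant maps to its sections at infinity. -/
noncomputable def germMap : (Over.liftFunctor X).op ⋙ 𝓕.obj ⟶
    equivariantPresheaf (SectionsInfinity.rep h 𝓕) where
  app S := ModuleCat.ofHom ((LinearMap.pi fun s : S.unop.carrier => germ h 𝓕 s).codRestrict
    (equivariantMaps (SectionsInfinity.rep h 𝓕) S.unop) fun j g s => germ_smul h 𝓕 s g j)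
  naturality S T τ := by
    ext j
    exact Subtype.ext (funext fun s => germ_map h 𝓕 τ.unop s j)

theorem of_eq_zero (K : Level 𝒦) (s : sectionsAt h 𝓕 K) (hs : SectionsInfinity.of h 𝓕 K s = 0) :
    ∃ (K' : Level 𝒦) (hK : K ≤ K'), sectionsRes h 𝓕 K K' hK s = 0 := by
  classical
  have := h.directed
  have : DirectedSystem (fun K : Level 𝒦 => sectionsAt h 𝓕 K) fun i j hij =>
      sectionsRes h 𝓕 i j hij :=
    { map_self := fun K s => by
        have h1 := cosetMap_one h K (fun x hx => by simpa using hx)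
        simp only [sectionsRes, sectionsPull]
        rw [h1, Over.liftMap_id, op_id, 𝓕.obj.map_id]
        rfl
      map_map := fun K₁ K₂ K₃ h1 h2 s => by
        simp only [sectionsRes]
        rw [sectionsPull_comp h 𝓕 _ _ _ 1 1 _ _ (fun x hx => by
          rw [one_mul, inv_one, one_mul, mul_one]
          exact h1 (h2 hx))]
        exact sectionsPull_congr h 𝓕 _ _ _ _ _ _ (by simp) s }
  exact Module.DirectLimit.of.zero_exact hs

variable [IsTopologicalGroup G]

theorem mono_germMap (hX : IsSSpace X) : Mono (germMap h 𝓕) := by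
  have : ∀ S, Mono ((germMap h 𝓕).app S) := fun S => by
    refine (ModuleCat.mono_iff_injective _).2 ((injective_iff_map_eq_zero _).2 fun j hj => ?_)
    have h1 : ∀ s : S.unop.carrier, ∃ (K : Level 𝒦) (hs : ∀ x ∈ K.group, x • s = s),
        (((Over.liftFunctor X).op ⋙ 𝓕.obj).map (pointMap h s K hs).op).hom j = 0 := by
      intro s
      have h2 : germ h 𝓕 s j = 0 := congr_fun (congr_arg Subtype.val hj) s
      obtain ⟨K, hK, h3⟩ := of_eq_zero h 𝓕 _ _ h2
      have hs : ∀ x ∈ K.group, x • s = s := fun x hx => hK hx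
      refine ⟨K, hs, ?_⟩
      have h4 := sectionsPull_map_pointMap h 𝓕 s _ K 1 (fun x hx => by
        rw [inv_one, one_mul, mul_one]; exact hK hx) (smul_eq_of_mem_pointLevel s)
          (by simpa using hs) j
      refine Eq.trans ?_ (h4.symm.trans h3)
      simp only [one_smul]
    choose K hs h2 using h1
    refine eq_zero_of_covering hX 𝓕 (S := S.unop) (fun s => cosets h (K s))
      (fun s => pointMap h s (K s) (hs s)) (fun s => ⟨s, ((1 : G) : G ⧸ (K s).group), ?_⟩) j h2
    exact one_smul G s
  exact NatTrans.mono_of_mono_app _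

end Equivariant

section OfNatTrans

variable {G : Type u} [Group G] [TopologicalSpace G] {𝒦 : Set (Subgroup G)}
  {R : Type (u + 1)} [CommRing R] (h : IsGoodFamily 𝒦) {X : GSetCat 𝒦 ⥤ LHSpace.{u}} {𝓕 : Sh X R}
  {V : Rep.{u + 1} R G} (hV : IsSmooth V)
  (a : equivariantPresheaf V ⟶ (Over.liftFunctor X).op ⋙ 𝓕.obj)

/-- The value on a vector fixed by a level of a morphism from a presheaf of equivariant maps. -/
noncomputable def valueAt (v : V) (K : Level 𝒦) (hv : v ∈ fixedVectors V K.group) :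
    SectionsInfinity h 𝓕 :=
  SectionsInfinity.of h 𝓕 K ((a.app (Opposite.op (cosets h K))).hom (orbitMap h V v K hv))

theorem sectionsPull_app_orbitMap (v : V) (K K' : Level 𝒦) (g : G)
    (hg : ∀ x ∈ K'.group, g⁻¹ * x * g ∈ K.group) (hv : v ∈ fixedVectors V K.group)
    (hv' : V.ρ g v ∈ fixedVectors V K'.group) : sectionsPull h 𝓕 K K' g hg
      ((a.app (Opposite.op (cosets h K))).hom (orbitMap h V v K hv)) =
        (a.app (Opposite.op (cosets h K'))).hom (orbitMap h V (V.ρ g v) K' hv') := by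
  exact congr(($(a.naturality (cosetMap h K' K g hg).op)).hom (orbitMap h V v K hv)).symm.trans
    (congr_arg (a.app (Opposite.op (cosets h K'))).hom
      (map_cosetMap_orbitMap h V v K K' g hg hv hv'))

theorem valueAt_mono (v : V) (K K' : Level 𝒦) (hK : K ≤ K') (hv : v ∈ fixedVectors V K.group)
    (hv' : v ∈ fixedVectors V K'.group) : valueAt h a v K hv = valueAt h a v K' hv' := by
  refine (SectionsInfinity.of_res h 𝓕 K K' hK _).symm.trans (congr_arg _ ?_)
  refine ((sectionsPull_app_orbitMap h a v K K' 1 _ hv (by simpa using hv')).trans ?_)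
  simp only [map_one, Module.End.one_apply]
  rfl

theorem valueAt_eq (v : V) (K K' : Level 𝒦) (hv : v ∈ fixedVectors V K.group)
    (hv' : v ∈ fixedVectors V K'.group) : valueAt h a v K hv = valueAt h a v K' hv' := by
  have := h.directed
  obtain ⟨L, h1, h2⟩ := exists_ge_ge K K'
  have hL : v ∈ fixedVectors V L.group := fun g hg => hv g (h1 hg)
  exact (valueAt_mono h a v K L h1 hv hL).trans (valueAt_mono h a v K' L h2 hv' hL).symm

theorem exists_level (h : IsGoodFamily 𝒦) (v : V) (hv : IsOpen (vectorStabilizer V v : Set G)) :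
    ∃ K : Level 𝒦, v ∈ fixedVectors V K.group := by
  obtain ⟨K, hK, hKv⟩ := h.cofinal _ hv
  exact ⟨OrderDual.toDual ⟨K, hK⟩, hKv⟩

theorem valueAt_add (v v' : V) (K : Level 𝒦) (hv : v ∈ fixedVectors V K.group)
    (hv' : v' ∈ fixedVectors V K.group) :
    valueAt h a (v + v') K (add_mem hv hv') = valueAt h a v K hv + valueAt h a v' K hv' := by
  have h1 : orbitMap h V (v + v') K (add_mem hv hv') = orbitMap h V v K hv + orbitMap h V v' K hv' := by
    refine orbitMap_ext h V K _ _ ?_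
    rw [orbitMap_one]
    exact (congr_arg₂ (· + ·) (orbitMap_one h V v K hv) (orbitMap_one h V v' K hv')).symm
  exact (congr_arg (fun b => SectionsInfinity.of h 𝓕 K
    ((a.app (Opposite.op (cosets h K))).hom b)) h1).trans ((congr_arg _ (map_add _ _ _)).trans
      (map_add _ _ _))

theorem valueAt_smul (c : R) (v : V) (K : Level 𝒦) (hv : v ∈ fixedVectors V K.group) :
    valueAt h a (c • v) K (Submodule.smul_mem _ c hv) = c • valueAt h a v K hv := by
  have h1 : orbitMap h V (c • v) K (Submodule.smul_mem _ c hv) = c • orbitMap h V v K hv := by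
    refine orbitMap_ext h V K _ _ ?_
    rw [orbitMap_one]
    exact (congr_arg (c • ·) (orbitMap_one h V v K hv)).symm
  exact (congr_arg (fun b => SectionsInfinity.of h 𝓕 K
    ((a.app (Opposite.op (cosets h K))).hom b)) h1).trans ((congr_arg _ (map_smul _ _ _)).trans
      (map_smul _ _ _))

/-- The homomorphism to the sections at infinity attached to a morphism from a presheaf of
equivariant maps. -/
noncomputable def ofNatTrans : V ⟶ SectionsInfinity.rep h 𝓕 :=
  Rep.ofHom ⟨
    { toFun := fun v => valueAt h a v (exists_level h v (hV v)).choose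
        (exists_level h v (hV v)).choose_spec
      map_add' := fun v v' => by
        have := h.directed
        obtain ⟨L, h1, h2⟩ := exists_ge_ge (exists_level h v (hV v)).choose
          (exists_level h v' (hV v')).choose
        have hv : v ∈ fixedVectors V L.group := fun g hg =>
          (exists_level h v (hV v)).choose_spec g (h1 hg)
        have hv' : v' ∈ fixedVectors V L.group := fun g hg =>
          (exists_level h v' (hV v')).choose_spec g (h2 hg)
        rw [valueAt_eq h a v _ L _ hv, valueAt_eq h a v' _ L _ hv',
          valueAt_eq h a (v + v') _ L _ (add_mem hv hv'), valueAt_add]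
      map_smul' := fun c v => by
        have hv := (exists_level h v (hV v)).choose_spec
        rw [valueAt_eq h a (c • v) _ _ _ (Submodule.smul_mem _ c hv), valueAt_smul]
        rfl },
    fun g => LinearMap.ext fun v => by
      have hv := (exists_level h v (hV v)).choose_spec
      set K := (exists_level h v (hV v)).choose
      have hv' : V.ρ g v ∈ fixedVectors V (K.conj h g).group := fun x hx => by
        have h1 := hv _ ((K.mem_conj h g x).1 hx)
        conv_rhs => rw [← h1]
        rw [← Module.End.mul_apply, ← Module.End.mul_apply, ← map_mul, ← map_mul]
        congr 2
        group
      change valueAt h a (V.ρ g v) _ _ = SectionsInfinity.act h 𝓕 g (valueAt h a v K hv)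
      refine (valueAt_eq h a (V.ρ g v) _ (K.conj h g) _ hv').trans (Eq.symm ?_)
      refine (SectionsInfinity.act_of h 𝓕 g K (K.conj h g)
        (fun x hx => (K.mem_conj h g x).1 hx) _).trans (congr_arg _ ?_)
      exact sectionsPull_app_orbitMap h a v K _ g _ hv hv'⟩

theorem ofNatTrans_apply (v : V) (K : Level 𝒦) (hv : v ∈ fixedVectors V K.group) :
    (ofNatTrans h hV a).hom v = valueAt h a v K hv := valueAt_eq h a v _ K _ hv

end OfNatTrans

section Injective

variable {G : Type u} [Group G] [TopologicalSpace G] [IsTopologicalGroup G]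
  {𝒦 : Set (Subgroup G)} {R : Type (u + 1)} [CommRing R] (h : IsGoodFamily 𝒦)
  {X : GSetCat 𝒦 ⥤ LHSpace.{u}}

theorem germMap_of (𝓕 : Sh X R) (K : Level 𝒦) (s : sectionsAt h 𝓕 K)
    (hv : (SectionsInfinity.of h 𝓕 K s : SectionsInfinity.rep h 𝓕) ∈
      fixedVectors (SectionsInfinity.rep h 𝓕) K.group) :
    ((germMap h 𝓕).app (Opposite.op (cosets h K))).hom s =
      orbitMap h (SectionsInfinity.rep h 𝓕) (SectionsInfinity.of h 𝓕 K s) K hv := by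
  refine orbitMap_ext h _ K _ _ (Eq.trans ?_ (orbitMap_one h _ _ K hv).symm)
  have h0 : ∀ x ∈ K.group, x • ((1 : G) : G ⧸ K.group) = ((1 : G) : G ⧸ K.group) := fun x hx => by
    change ((x * 1 : G) : G ⧸ K.group) = _
    rw [mul_one]
    exact QuotientGroup.eq.2 (by simpa using hx)
  refine (germ_eq h 𝓕 (S := cosets h K) ((1 : G) : G ⧸ K.group) K h0 s).trans (congr_arg _ ?_)
  have h1 : pointMap h (S := cosets h K) ((1 : G) : G ⧸ K.group) K h0 = 𝟙 _ := by
    refine MulActionHom.ext fun t => ?_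
    induction t using QuotientGroup.induction_on with | H x => ?_
    change ((x * 1 : G) : G ⧸ K.group) = _
    rw [mul_one]
    rfl
  rw [h1, op_id, CategoryTheory.Functor.map_id]
  rfl

/-- On an exact `𝒮`-space, the sections at infinity of an injective sheaf are injective. -/
theorem injective_H0Infinity (hX : IsSSpace X) (hX' : IsExactSSpace X) (I : Sh X R)
    [Injective I] : Injective ((H0Infinity h X R).obj I) where
  factors {V V'} φ f _ := by
    have := injective_liftFunctor_comp h hX hX' I
    have := mono_germMap h I hX
    have := mono_equivariantPresheafMap (𝒦 := 𝒦) f.hom (smRep_injective_of_mono f)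
    let ρ := Injective.factorThru (𝟙 _) (germMap h I)
    have hρ : germMap h I ≫ ρ = 𝟙 _ := Injective.comp_factorThru _ _
    let a := Injective.factorThru (equivariantPresheafMap φ.hom ≫ ρ)
      (equivariantPresheafMap (𝒦 := 𝒦) f.hom)
    have ha : equivariantPresheafMap f.hom ≫ a = equivariantPresheafMap φ.hom ≫ ρ :=
      Injective.comp_factorThru _ _
    refine ⟨ObjectProperty.homMk (ofNatTrans h V'.property a), ?_⟩
    refine ObjectProperty.hom_ext _ (Rep.hom_ext ?_)
    ext v
    change (ofNatTrans h V'.property a).hom (f.hom.hom v) = φ.hom.hom v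
    obtain ⟨K₀, s₀, hs₀⟩ := SectionsInfinity.exists_of h I (φ.hom.hom v)
    obtain ⟨K₁, hK₁⟩ := exists_level h v (V.property v)
    have := h.directed
    obtain ⟨K, h0, h1⟩ := exists_ge_ge K₀ K₁
    have hv : v ∈ fixedVectors V.obj K.group := fun g hg => hK₁ g (h1 hg)
    have hfv : f.hom.hom v ∈ fixedVectors V'.obj K.group := fun g hg => by
      rw [← Rep.hom_comm_apply, hv g hg]
    have hφv : φ.hom.hom v ∈ fixedVectors (SectionsInfinity.rep h I) K.group := fun g hg => by
      refine (Rep.hom_comm_apply φ.hom g v).symm.trans ?_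
      rw [hv g hg]
    obtain ⟨s, hs⟩ : ∃ s, SectionsInfinity.of h I K s = φ.hom.hom v :=
      ⟨sectionsRes h I K₀ K h0 s₀, (SectionsInfinity.of_res h I K₀ K h0 s₀).trans hs₀⟩
    refine (ofNatTrans_apply h V'.property a _ K hfv).trans ((congr_arg (SectionsInfinity.of h I K) ?_).trans hs)
    let S := Opposite.op (cosets h K)
    have e1 := equivariantPresheafMap_orbitMap h f.hom v K hv
    have e2 := equivariantPresheafMap_orbitMap h φ.hom v K hv
    have e3 := congr(($(ha).app S).hom (orbitMap h V.obj v K hv))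
    have e4 := congr(($(hρ).app S).hom s)
    have e5 := germMap_of h I K s (by rw [hs]; exact hφv)
    refine (congr_arg (a.app S).hom e1.symm).trans (e3.trans (Eq.trans ?_ e4))
    refine congr_arg (ρ.app S).hom (e2.trans (Eq.trans ?_ e5.symm))
    refine orbitMap_ext h _ K _ _ ?_
    exact (orbitMap_one h _ _ K _).trans (hs.symm.trans
      (orbitMap_one h (SectionsInfinity.rep h I) (SectionsInfinity.of h I K s) K _).symm)

end Injective

end OrdCoh

namespace OrdCoh

/-! ### The spectral sequences of ordinary cohomology -/

section Spectral

variable {F : Type u} [NontriviallyNormedField F] [IsUltrametricDist F] [ProperSpace F]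
  {R : Type (u + 1)} [CommRing R] [IsNoetherianRing R] {H : Subgroup Fˣ}

theorem preservesHomology_smooth_ι {G : Type u} [Group G] [TopologicalSpace G]
    [IsTopologicalGroup G] {k : Type v} [CommRing k] :
    (IsSmooth : ObjectProperty (Rep.{w} k G)).ι.PreservesHomology where
  preservesKernels X Y f :=
    have := (smoothCondition.{u, v, w} k G).subobjects IsSmooth fun _ => Iff.rfl
    ObjectProperty.preservesKernels_ι _ f
  preservesCokernels X Y f :=
    have := (smoothCondition.{u, v, w} k G).quotients IsSmooth fun _ => Iff.rfl
    ObjectProperty.preservesCokernels_ι _ f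

instance : (ladmToSm R H).PreservesHomology :=
  Functor.preservesHomology_of_map_exact _ fun S hS => by
    have := preservesHomology_smooth_ι.{u, u + 1, u + 1} (G := QuotBy H) (k := R)
    have := preservesHomology_ι.{u, u + 1, u + 1} (k := R) (G := QuotBy H)
    exact (ShortComplex.exact_map_iff_of_faithful (S.map (ladmToSm R H))
      (IsSmooth : ObjectProperty (Rep.{u + 1} R (QuotBy H))).ι).1
        (hS.map (IsLocallyAdmissible : ObjectProperty (Rep.{u + 1} R (QuotBy H))).ι)

variable {𝒦 : Set (Subgroup (PGL2 F))} (h : IsGoodFamily 𝒦) {X : GSetCat 𝒦 ⥤ LHSpace.{u}}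
  (𝓕 : Sh X R)

theorem hasSpectralSequence_derivedOrd (hX : IsSSpace X) (hX' : IsExactSSpace X)
    (H : Subgroup Fˣ) :
    HasSpectralSequence
      (fun r s => (derivedOrd R H r).obj ((cohomologyInfinity h X R s).obj 𝓕))
      (fun n => (ordCohomology h X R H n).obj 𝓕) :=
  hasSpectralSequence_comp (H0Infinity h X R) (ordH R H)
    (fun I _ => injective_H0Infinity h hX hX' I) 𝓕 (fun _ _ => ⟨Iso.refl _⟩)
    fun _ => ⟨Iso.refl _⟩

/-- Isomorphic functors have isomorphic derived functors. -/
theorem nonempty_rightDerived_obj_iso {A B : Type*} [Category* A] [Category* B] [Abelian A]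
    [Abelian B] [HasInjectiveResolutions A] {S T : A ⥤ B} [S.Additive] [T.Additive] (e : S ≅ T)
    (n : ℕ) (Z : A) : Nonempty ((S.rightDerived n).obj Z ≅ (T.rightDerived n).obj Z) :=
  ⟨⟨(NatTrans.rightDerived e.hom n).app Z, (NatTrans.rightDerived e.inv n).app Z, by
    rw [← NatTrans.comp_app, ← NatTrans.rightDerived_comp, e.hom_inv_id, NatTrans.rightDerived_id]
    rfl, by
    rw [← NatTrans.comp_app, ← NatTrans.rightDerived_comp, e.inv_hom_id, NatTrans.rightDerived_id]
    rfl⟩⟩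

theorem hasSpectralSequence_extTwist (hX : IsSSpace X) (hX' : IsExactSSpace X)
    (W : LAdmRep.{u, u + 1, u + 1} R (QuotBy H)) :
    HasSpectralSequence
      (fun r s => (extTwist W.toSm r).obj ((ordCohomology h X R H s).obj 𝓕).toSm)
      (fun n => (indCohomology h X W.toSm n).obj 𝓕) := by
  refine hasSpectralSequence_comp (ordSheaf h X R H ⋙ ladmToSm R H)
    (homFunctor (twist R (QuotBy H)) W.toSm) (fun I _ => ?_) 𝓕 (fun r s => ?_) fun n => ?_
  · have := injective_H0Infinity h hX hX' I
    have := injective_ordH (H := H) ((H0Infinity h X R).obj I)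
    exact injective_toSm (QuotBy.exists_fg_sup_eq_top H) ((ordH R H).obj ((H0Infinity h X R).obj I))
  · exact ⟨((homFunctor (twist R (QuotBy H)) W.toSm).rightDerived r).mapIso
      (rightDerivedCompIso (ordSheaf h X R H) (ladmToSm R H) s 𝓕)⟩
  · have hW : OrbitsFinite W.toSm.obj := fun x => ((isLocallyAdmissible_iff _).1 W.property x).2
    exact nonempty_rightDerived_obj_iso
      (Functor.isoWhiskerLeft (H0Infinity h X R) (homFunctorOrdIso hW)).symm n 𝓕

end Spectral

end OrdCoh

namespace OrdCoh

/-! ### Ordinary cohomology as a direct limit -/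

section Homology

variable {k : Type v} [CommRing k] {D : Type*} [Category* D] [Abelian D]
  (T : D ⥤ ModuleCat.{w} k) [T.Additive] [T.PreservesHomology]

theorem map_injective_of_mono {V W : D} (f : V ⟶ W) [Mono f] : Function.Injective (T.map f).hom :=
  (ModuleCat.mono_iff_injective _).1 inferInstance

theorem map_surjective_of_epi {V W : D} (f : V ⟶ W) [Epi f] : Function.Surjective (T.map f).hom :=
  (ModuleCat.epi_iff_surjective _).1 inferInstance

theorem map_comp_apply' {V W Z : D} (f : V ⟶ W) (g : W ⟶ Z) (x : T.obj V) :
    (T.map (f ≫ g)).hom x = (T.map g).hom ((T.map f).hom x) := by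
  rw [T.map_comp]
  rfl

theorem exists_cycle (K : CochainComplex D ℕ) (n : ℕ) (a : T.obj (K.X n))
    (ha : (T.map (K.d n (n + 1))).hom a = 0) : ∃ z, (T.map (K.iCycles n)).hom z = a := by
  have h1 : (ShortComplex.mk (K.iCycles n) (K.d n (n + 1)) (by simp)).Exact :=
    ShortComplex.exact_of_f_is_kernel _ (K.cyclesIsKernel n (n + 1) (by simp))
  exact (ShortComplex.moduleCat_exact_iff _).1 (h1.map T) a ha

theorem exists_boundary (K : CochainComplex D ℕ) (n : ℕ) (z : T.obj (K.cycles n))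
    (hz : (T.map (K.homologyπ n)).hom z = 0) :
    ∃ b, (T.map (K.toCycles ((ComplexShape.up ℕ).prev n) n)).hom b = z := by
  have h1 : (ShortComplex.mk (K.toCycles ((ComplexShape.up ℕ).prev n) n) (K.homologyπ n)
    (by simp)).Exact := ShortComplex.exact_of_g_is_cokernel _ (K.homologyIsCokernel _ n rfl)
  exact (ShortComplex.moduleCat_exact_iff _).1 (h1.map T) z hz

theorem exists_homologyMap_eq {K L : CochainComplex D ℕ} (α : L ⟶ K) (n : ℕ)
    (hα : Function.Injective (T.map (α.f (n + 1))).hom) (z : T.obj (K.cycles n))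
    (b : T.obj (L.X n)) (hb : (T.map (α.f n)).hom b = (T.map (K.iCycles n)).hom z) :
    ∃ y, (T.map (HomologicalComplex.homologyMap α n)).hom y = (T.map (K.homologyπ n)).hom z := by
  obtain ⟨z', hz'⟩ := exists_cycle T L n b (by
    apply hα
    rw [← map_comp_apply', ← α.comm, map_comp_apply', hb, ← map_comp_apply', K.iCycles_d]
    simp)
  refine ⟨(T.map (L.homologyπ n)).hom z', ?_⟩
  rw [← map_comp_apply', HomologicalComplex.homologyπ_naturality, map_comp_apply']
  congr 1
  apply map_injective_of_mono T (K.iCycles n)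
  rw [← map_comp_apply', HomologicalComplex.cyclesMap_i, map_comp_apply', hz', hb]

theorem homologyMap_eq_zero {K L L' : CochainComplex D ℕ} (α : L ⟶ K) (α' : L' ⟶ K) (τ : L ⟶ L')
    (hτ : τ ≫ α' = α) (n : ℕ) (hα : Function.Injective (T.map (α'.f n)).hom)
    (z : T.obj (L.cycles n)) (b : T.obj (K.X ((ComplexShape.up ℕ).prev n)))
    (hb : (T.map (K.toCycles ((ComplexShape.up ℕ).prev n) n)).hom b =
      (T.map (HomologicalComplex.cyclesMap α n)).hom z)
    (b' : T.obj (L'.X ((ComplexShape.up ℕ).prev n)))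
    (hb' : (T.map (α'.f ((ComplexShape.up ℕ).prev n))).hom b' = b) :
    (T.map (HomologicalComplex.homologyMap τ n)).hom ((T.map (L.homologyπ n)).hom z) = 0 := by
  have h1 : (T.map (HomologicalComplex.cyclesMap τ n)).hom z =
      (T.map (L'.toCycles ((ComplexShape.up ℕ).prev n) n)).hom b' := by
    apply map_injective_of_mono T (L'.iCycles n)
    apply hα
    have h2 := congr_arg (T.map (K.iCycles n)).hom hb
    rw [← map_comp_apply', K.toCycles_i, ← map_comp_apply', HomologicalComplex.cyclesMap_i,
      ← hb', ← map_comp_apply', α'.comm, ← hτ, HomologicalComplex.comp_f] at h2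
    simp only [← map_comp_apply', L'.toCycles_i, HomologicalComplex.cyclesMap_i, Category.assoc]
    exact h2.symm
  rw [← map_comp_apply', HomologicalComplex.homologyπ_naturality, map_comp_apply', h1,
    ← map_comp_apply', L'.toCycles_comp_homologyπ]
  simp

end Homology

section Colimit

variable {G : Type u} [CommGroup G] [TopologicalSpace G] [IsTopologicalGroup G]
  {k : Type v} [CommRing k] [IsNoetherianRing k]

variable (k G) in
/-- The underlying module of a locally admissible representation. -/
noncomputable abbrev ladmForget : LAdmRep.{u, v, w} k G ⥤ ModuleCat.{w} k :=
  (IsLocallyAdmissible : ObjectProperty (Rep.{w} k G)).ι ⋙ forget₂ _ _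

instance : (ladmForget.{u, v, w} G k).Additive where

instance : (ladmForget.{u, v, w} G k).PreservesHomology :=
  Functor.preservesHomology_of_map_exact _ fun S hS => (exact_iff_forget S).1 hS

/-- A cocone over a directed system of locally admissible representations is a colimit if it is
jointly surjective and each element that it kills is killed at some stage. -/
theorem nonempty_isColimit {J : Type*} [Preorder J] [IsDirectedOrder J]
    {S : J ⥤ LAdmRep.{u, v, w} k G} (c : Cocone S)
    (hc : ∀ x : c.pt.obj, ∃ (j : J) (y : (S.obj j).obj), (c.ι.app j).hom.hom y = x)
    (hc' : ∀ (j : J) (y : (S.obj j).obj), (c.ι.app j).hom.hom y = 0 →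
      ∃ (j' : J) (f : j ⟶ j'), (S.map f).hom.hom y = 0) : Nonempty (IsColimit c) := by
  have key : ∀ (s : Cocone S) (j j' : J) (y : (S.obj j).obj) (y' : (S.obj j').obj),
      (c.ι.app j).hom.hom y = (c.ι.app j').hom.hom y' →
        (s.ι.app j).hom.hom y = (s.ι.app j').hom.hom y' := by
    intro s j j' y y' hyy'
    have hw : ∀ (s : Cocone S) {i i' : J} (f : i ⟶ i') (y : (S.obj i).obj),
        (s.ι.app i').hom.hom ((S.map f).hom.hom y) = (s.ι.app i).hom.hom y :=
      fun s i i' f y => congr(($(s.w f)).hom.hom y)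
    obtain ⟨l, h1, h2⟩ := exists_ge_ge j j'
    obtain ⟨m, f, hm⟩ := hc' l ((S.map (homOfLE h1)).hom.hom y - (S.map (homOfLE h2)).hom.hom y')
      (by rw [map_sub, hw, hw, hyy', sub_self])
    have h3 := congr_arg (s.ι.app m).hom.hom hm
    rwa [hw, map_sub, hw, hw, map_zero, sub_eq_zero] at h3
  choose j y hy using hc
  have lin : ∀ (s : Cocone S) (i : J) (z : (S.obj i).obj) (x : c.pt.obj),
      (c.ι.app i).hom.hom z = x → (s.ι.app (j x)).hom.hom (y x) = (s.ι.app i).hom.hom z :=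
    fun s i z x hz => key s _ _ _ _ ((hy x).trans hz.symm)
  exact ⟨{
    desc := fun s => ObjectProperty.homMk (Rep.ofHom
      ⟨{ toFun := fun x => (s.ι.app (j x)).hom.hom (y x)
         map_add' := fun x x' => by
          obtain ⟨l, h1, h2⟩ := exists_ge_ge (j x) (j x')
          have e1 : (c.ι.app l).hom.hom ((S.map (homOfLE h1)).hom.hom (y x)) = x :=
            (congr(($(c.w (homOfLE h1))).hom.hom (y x))).trans (hy x)
          have e2 : (c.ι.app l).hom.hom ((S.map (homOfLE h2)).hom.hom (y x')) = x' :=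
            (congr(($(c.w (homOfLE h2))).hom.hom (y x'))).trans (hy x')
          rw [lin s l _ x e1, lin s l _ x' e2, ← map_add]
          exact lin s l _ _ (by rw [map_add, e1, e2])
         map_smul' := fun a x => by
          rw [RingHom.id_apply, ← map_smul]
          exact lin s _ _ _ (by rw [map_smul, hy]) },
        fun g => LinearMap.ext fun x => by
          refine (lin s (j x) ((S.obj (j x)).obj.ρ g (y x)) (c.pt.obj.ρ g x) ?_).trans ?_
          · rw [Rep.hom_comm_apply, hy]
            rfl
          · exact Rep.hom_comm_apply _ _ _⟩)
    fac := fun s i => by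
      refine ObjectProperty.hom_ext _ (Rep.hom_ext ?_)
      ext z
      exact lin s i z _ rfl
    uniq := fun s m hm => by
      refine ObjectProperty.hom_ext _ (Rep.hom_ext ?_)
      ext x
      change m.hom.hom x = (s.ι.app (j x)).hom.hom (y x)
      conv_lhs => rw [← hy x]
      exact congr(($(hm (j x))).hom.hom (y x)) }⟩

end Colimit

section OrdColimit

variable {F : Type u} [NontriviallyNormedField F] [IsUltrametricDist F] [ProperSpace F]
  {𝒦 : Set (Subgroup (PGL2 F))} (h : IsGoodFamily 𝒦) {X : GSetCat 𝒦 ⥤ LHSpace.{u}}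
  {R : Type (u + 1)} [CommRing R] [IsNoetherianRing R] {H : Subgroup Fˣ}

instance : IsDirectedOrder (OpenAbove H) where
  directed U V := ⟨OrderDual.toDual ⟨U.group ⊓ V.group, (OrderDual.ofDual U).2.1.inter (OrderDual.ofDual V).2.1,
    le_inf U.le_group V.le_group, inf_le_left.trans (OrderDual.ofDual U).2.2.2⟩,
      inf_le_left (a := U.group), inf_le_right (a := U.group)⟩

theorem OpenAbove.injective_transTop (U : OpenAbove H) (𝓖 : Sh X R) :
    Function.Injective ((ladmForget.{u, u + 1, u + 1} (QuotBy H) R).map ((U.transTop h X R).app 𝓖)).hom :=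
  let A := (H0Infinity h X R ⋙ ordFunctor F R).obj 𝓖
  fun (a b : fixedVectors A.obj U.group) hab =>
    Subtype.ext (congr_arg (Subtype.val : fixedVectors A.obj H → A.obj) hab)

theorem OpenAbove.exists_transTop_eq (U : OpenAbove H) (𝓖 : Sh X R)
    (x : (ladmForget.{u, u + 1, u + 1} (QuotBy H) R).obj ((ordSheaf h X R H).obj 𝓖)) :
    ∃ (U' : OpenAbove H) (_ : U ≤ U') (y : (ladmForget.{u, u + 1, u + 1} (QuotBy H) R).obj ((U'.fn h X R).obj 𝓖)),
      ((ladmForget.{u, u + 1, u + 1} (QuotBy H) R).map ((U'.transTop h X R).app 𝓖)).hom y = x := by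
  let A := (H0Infinity h X R ⋙ ordFunctor F R).obj 𝓖
  let x' : fixedVectors A.obj H := x
  have hx : IsOpen (vectorStabilizer A.obj x'.1 : Set Fˣ) :=
    ((isLocallyAdmissible_iff _).1 A.property x'.1).1
  exact ⟨OrderDual.toDual ⟨vectorStabilizer A.obj x'.1 ⊓ U.group, hx.inter (OrderDual.ofDual U).2.1,
    le_inf (fun g hg => x'.2 g hg) U.le_group, inf_le_right.trans (OrderDual.ofDual U).2.2.2⟩,
    inf_le_right (a := vectorStabilizer A.obj x'.1), ⟨x'.1, fun g hg => hg.1⟩, rfl⟩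

/-- Ordinary cohomology for a closed subgroup `H` of the unit group is the direct limit of the
ordinary cohomology for the open subgroups of the unit group that contain `H`. -/
theorem nonempty_isColimit_ordCocone (hH : H ≤ unitGroup F) (𝓕 : Sh X R) (n : ℕ) :
    Nonempty (IsColimit (ordCocone h 𝓕 n H)) := by
  let T := ladmForget.{u, u + 1, u + 1} (QuotBy H) R
  obtain ⟨P⟩ := (inferInstance : HasInjectiveResolution 𝓕).out
  let K := ((ordSheaf h X R H).mapHomologicalComplex (ComplexShape.up ℕ)).obj P.cocomplex
  let L (U : OpenAbove H) := ((U.fn h X R).mapHomologicalComplex (ComplexShape.up ℕ)).obj P.cocomplex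
  let α (U : OpenAbove H) : L U ⟶ K :=
    (NatTrans.mapHomologicalComplex (U.transTop h X R) _).app P.cocomplex
  let τ {U U' : OpenAbove H} (hU : U ≤ U') : L U ⟶ L U' :=
    (NatTrans.mapHomologicalComplex (OpenAbove.trans h X R hU) _).app P.cocomplex
  have hτ {U U' : OpenAbove H} (hU : U ≤ U') : τ hU ≫ α U' = α U := by
    ext i : 1
    exact congr(($(OpenAbove.trans_transTop h X R hU)).app (P.cocomplex.X i))
  let e (U : OpenAbove H) : (ordSystem h 𝓕 n H).obj U ≅ (L U).homology n :=
    (U.derivedIso h 𝓕 n).symm ≪≫ P.isoRightDerivedObj (U.fn h X R) n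
  let e' : (ordCocone h 𝓕 n H).pt ≅ K.homology n := P.isoRightDerivedObj (ordSheaf h X R H) n
  have h1 (U : OpenAbove H) : (ordCocone h 𝓕 n H).ι.app U =
      (e U).hom ≫ HomologicalComplex.homologyMap (α U) n ≫ e'.inv := by
    change (U.derivedIso h 𝓕 n).inv ≫ (NatTrans.rightDerived (U.transTop h X R) n).app 𝓕 = _
    rw [P.rightDerived_app_eq]
    exact (Category.assoc _ _ _).symm
  have h2 {U U' : OpenAbove H} (hU : U ≤ U') : (ordSystem h 𝓕 n H).map (homOfLE hU) =
      (e U).hom ≫ HomologicalComplex.homologyMap (τ hU) n ≫ (e U').inv := by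
    change (U.derivedIso h 𝓕 n).inv ≫ (NatTrans.rightDerived (OpenAbove.trans h X R hU) n).app 𝓕 ≫
      (U'.derivedIso h 𝓕 n).hom = _
    rw [P.rightDerived_app_eq]
    simp only [Category.assoc]
    rfl
  refine nonempty_isColimit _ (fun x => ?_) fun U y hy => ?_
  · obtain ⟨z, hz⟩ := map_surjective_of_epi T (K.homologyπ n) ((T.map e'.hom).hom x)
    obtain ⟨U, _, b, hb⟩ := OpenAbove.exists_transTop_eq h
      (OrderDual.toDual ⟨unitGroup F, isOpen_unitGroup, hH, le_rfl⟩) (P.cocomplex.X n)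
      ((T.map (K.iCycles n)).hom z)
    obtain ⟨y, hy⟩ := exists_homologyMap_eq T (α U) n
      (U.injective_transTop h (P.cocomplex.X (n + 1))) z b hb
    refine ⟨U, (T.map (e U).inv).hom y, ?_⟩
    rw [h1]
    change (T.map ((e U).hom ≫ HomologicalComplex.homologyMap (α U) n ≫ e'.inv)).hom _ = x
    rw [← map_comp_apply', Iso.inv_hom_id_assoc, map_comp_apply', hy, hz, ← map_comp_apply',
      Iso.hom_inv_id]
    exact congr(($(T.map_id _)).hom x)
  · obtain ⟨z, hz⟩ := map_surjective_of_epi T ((L U).homologyπ n) ((T.map (e U).hom).hom y)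
    have h3 : (T.map (K.homologyπ n)).hom
        ((T.map (HomologicalComplex.cyclesMap (α U) n)).hom z) = 0 := by
      rw [← map_comp_apply', ← HomologicalComplex.homologyπ_naturality, map_comp_apply', hz,
        ← map_comp_apply']
      apply map_injective_of_mono T e'.inv
      rw [← map_comp_apply', Category.assoc, ← h1, map_zero]
      exact hy
    obtain ⟨b, hb⟩ := exists_boundary T K n _ h3
    obtain ⟨U', hU, b', hb'⟩ := U.exists_transTop_eq h
      (P.cocomplex.X ((ComplexShape.up ℕ).prev n)) b
    refine ⟨U', homOfLE hU, ?_⟩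
    have h4 := homologyMap_eq_zero T (α U) (α U') (τ hU) (hτ hU) n
      (U'.injective_transTop h (P.cocomplex.X n)) z b hb b' hb'
    rw [h2 hU]
    change (T.map ((e U).hom ≫ HomologicalComplex.homologyMap (τ hU) n ≫ (e U').inv)).hom y = 0
    rw [map_comp_apply', ← hz, map_comp_apply', h4, map_zero]

end OrdColimit

end OrdCoh

theorem proposition3p1 (p : ℕ) [Fact p.Prime] (F : Type u) [NontriviallyNormedField F]
    [IsUltrametricDist F] [ProperSpace F] [NormedAlgebra ℚ_[p] F] [FiniteDimensional ℚ_[p] F]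
    (𝒪 : Type (u + 1)) [CommRing 𝒪] [IsLocalRing 𝒪] [IsNoetherianRing 𝒪]
    [IsAdicComplete (IsLocalRing.maximalIdeal 𝒪) 𝒪]
    (H : Subgroup Fˣ) (hH : IsClosed (H : Set Fˣ)) (hH' : H ≤ unitGroup F)
    (𝒦 : Set (Subgroup (PGL2 F))) (h𝒦 : IsGoodFamily 𝒦)
    (X : GSetCat 𝒦 ⥤ LHSpace.{u}) (hX : IsSSpace X) (𝓕 : Sh X 𝒪)
    (W : LAdmRep.{u, u + 1, u + 1} 𝒪 (QuotBy H)) :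
    (∀ n : ℕ, Nonempty (IsColimit (ordCocone h𝒦 𝓕 n H))) ∧
    (IsExactSSpace X →
      HasSpectralSequence
          (fun r s => (derivedOrd 𝒪 H r).obj ((cohomologyInfinity h𝒦 X 𝒪 s).obj 𝓕))
          (fun n => (ordCohomology h𝒦 X 𝒪 H n).obj 𝓕) ∧
        HasSpectralSequence
          (fun r s => (extTwist W.toSm r).obj ((ordCohomology h𝒦 X 𝒪 H s).obj 𝓕).toSm)
          (fun n => (indCohomology h𝒦 X W.toSm n).obj 𝓕)) :=
  ⟨fun n => nonempty_isColimit_ordCocone h𝒦 hH' 𝓕 n, fun hX' =>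
    ⟨hasSpectralSequence_derivedOrd h𝒦 𝓕 hX hX' H, hasSpectralSequence_extTwist h𝒦 𝓕 hX hX' W⟩⟩
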